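/- Setting. Let $n\ge 2$, $\sigma>0$, $\gamma\in(0,1)$, and let $\omega\in\mathbb R^n$ satisfy $|k\cdot\omega|\ge\gamma|k|_1^{-\sigma}$ for all $k\in\mathbb Z^n\setminus\{0\}$. Let $\mathbf U^{2n}$ be an open subset of $\mathbb R^{2n}$ or of $\mathbb T^n\times\mathbb R^n$, and let $H:\mathbf U^{2n}\to\mathbb R$ and $B=(b_{ij}):\mathbf U^{2n}\to\mathbb R^{2n\times 2n}$ be real analytic, $B(z)$ skew-symmetric and invertible with $\sum_l(\partial_l b_{ij}\,b_{lk}+\partial_l b_{jk}\,b_{li}+\partial_l b_{ki}\,b_{lj})=0$, such that the 2-form $\Omega(\xi,\eta)=\langle\xi,B(z)^{-1}\eta\rangle$ is exact, $\Omega=d\alpha$, with a smooth 1-form $\alpha$ on $\mathbf U^{2n}$. Let $\mathcal B$ be an open set of the complexified phase space (e.g. an $r$-neighbourhood of the image of a complex strip) to which $H$ and $B$ extend holomorphically, $B$ being invertible on $\mathcal B$, with $\|B\|_{C^1,\mathcal B}$, $\|B^{-1}\|_{\mathcal B}$, $\|H\|_{C^2,\mathcal B}$ finite (the $C^k$ norm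 is the largest of the suprema over $\mathcal B$ of the operator norms of the derivatives of order $\le k$). For $\rho>0$ let $U_\rho=\{\theta\in\mathbb C^n:\max_j|\mathrm{Im}\,\theta_j|<\rho\}$ and $\|f\|_\rho=\sup_{U_\rho}\|f\|$ (maximum norm for vectors, the induced operator norm for matrices; $|\cdot|$ is the largest modulus of an entry). Put $\partial_\omega f=Df\,\omega$ and $\langle f\rangle=\int_{\mathbb T^n}f$. Let $K:\overline{U_\rho}\to\mathcal B$ be continuous, one-periodic in all variables (as a map to phase space), holomorphic on $U_\rho$, mapping $\mathbb R^n$ into $\mathbf U^{2n}$. Put (with $B,\nabla H$, etc. evaluated at $K(\theta)$ and all other functions at $\theta$) $$e=B\nabla H-\partial_\omega K,\quad Ah=DB[h]\nabla H+B\,D\nabla H\,h,\quad N=(DK^TDK)^{-1},$$ $$S^0=N\,DK^T\{AB-BA-DB[B\nabla H]+B\,DK\,N\,DK^T(A+A^T)\}DK\,N,$$ $$M=(DK,\ B\,DK\,N),\quad E=AM-\partial_\omega M-M\begin{pmatrix}0&S^0\\0&0\end{pmatrix},\quad C=M^{-1}E,$$ $$L=DK^TB^{-1}DK,\quad R=\begin{pmatrix}L&0\\0&0\end{pmatrix},\quad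 V=\begin{pmatrix}0&I\\-I&-N^TDK^TB\,DK\,N\end{pmatrix},$$ $$M_e=-(I+V^{-1}R)^{-1}V^{-1}RV^{-1}M^TB^{-1},\qquad w=-M_e\,e,$$ $$p=(p_x,p_y),\quad p_x=-N^TDK^T(I-B\,DK\,N\,DK^TB^{-1})e,\quad p_y=-DK^TB^{-1}e.$$ Assume that $K$ is non-degenerate: $DK^TDK$ is invertible on $U_\rho$ and $\langle S^0\rangle$ is invertible; and that $\|DK\|_\rho$, $\|N\|_\rho$ are finite. Theorem 4.1. For given $n,\sigma$ there are numbers $1\le c_2\le c_4\le c_5$, where $c_2$ is a polynomial with nonnegative coefficients in $\|DK\|_\rho,\|N\|_\rho,\|B\|_{\mathcal B},\|B^{-1}\|_{\mathcal B}$, where $c_4$ is a polynomial with nonnegative coefficients in $\|DK\|_\rho,\|N\|_\rho,\|B\|_{C^1,\mathcal B},\|B^{-1}\|_{\mathcal B},\|H\|_{C^2,\mathcal B}$, and where $c_5$ is a function of $\|DK\|_\rho,\|N\|_\rho,|\langle S^0\rangle^{-1}|,\|B\|_{C^1,\mathcal B},\|B^{-1}\|_{\mathcal B},\|H\|_{C^2,\mathcal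 B}$ (these polynomials and this function depend only on $n,\sigma$), such that in the above setting the following holds. 1) Let $0<\delta<\rho/2$, $\delta\le 1$, and $c_2\gamma^{-1}\delta^{-(\sigma+1)}\|e\|_\rho\le\frac12$. Then for $\theta\in U_{\rho-\delta}$ the matrices $M(\theta)$ and $I+V(\theta)^{-1}R(\theta)$ are invertible, and under the substitution $\Delta=M\xi$ the linearized equation $A\Delta-\partial_\omega\Delta=-e$ at $\theta$ is equivalent to $$\left[\begin{pmatrix}0&S^0\\0&0\end{pmatrix}+C\right]\xi-\partial_\omega\xi=p+w,$$ for every $\xi$ complex differentiable at $\theta$. Moreover $\|C\|_{\rho-2\delta}\le c_4\gamma^{-1}\delta^{-(\sigma+1)}\|e\|_\rho$ and $\|w\|_{\rho-\delta}\le c_4\gamma^{-1}\delta^{-(\sigma+1)}\|e\|_\rho^2$. 2) With $C=0$, $w=0$ the transformed equation is equivalent, at every $\theta\in U_\rho$ and for every $\xi=(\xi_x,\xi_y)$ complex differentiable at $\theta$, to $$\partial_\omega\xi_x=S^0\xi_y-p_x,\qquad \partial_\omega\xi_y=-p_y.$$ For every $\delta$ with $0<\delta<\rho/2$ and $\delta\le1$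 this system has a solution $\xi=(\xi_x,\xi_y)$ on $U_{\rho-\delta}$ that is holomorphic, one-periodic in all variables and real at real points, with $$\|\xi_y\|_{\rho-\delta}\le c_5\gamma^{-1}\delta^{-\sigma}\|e\|_\rho,\qquad \|\xi_x\|_{\rho-2\delta}\le c_5\gamma^{-2}\delta^{-2\sigma}\|e\|_\rho .$$ -/

import Mathlib

open scoped Matrix Matrix.Norms.Operator

noncomputable section

namespace KAM

/-- Index set of the `2n` coordinates of phase space, split as `n + n`. -/
abbrev Idx (n : ℕ) : Type := Fin n ⊕ Fin n

/-- A real point regarded as a complex point. -/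
def toC {ι : Type*} (x : ι → ℝ) : ι → ℂ := fun i => (x i : ℂ)

/-- An integer vector regarded as a complex vector. -/
def intC {ι : Type*} (k : ι → ℤ) : ι → ℂ := fun i => (k i : ℂ)

/-- Translations under which the phase space is periodic.  Phase space is either an open subset of
`ℝ^{2n}` (`angular = false`, the only period is `0`) or lies in `𝕋ⁿ × ℝⁿ` (`angular = true`), in
which case we work on the universal cover `ℝⁿ × ℝⁿ` and the periods are the vectors of
`ℤⁿ × {0}`. -/
def IsPeriod {n : ℕ} (angular : Bool) (v : Idx n → ℝ) : Prop :=
  (∀ i, v (Sum.inr i) = 0) ∧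
    if angular = true then ∀ i, ∃ m : ℤ, v (Sum.inl i) = (m : ℝ) else ∀ i, v (Sum.inl i) = 0

/-- `j`-th partial derivative of a function of several (real or complex) variables. -/
def partialD (𝕜 : Type*) [RCLike 𝕜] {ι : Type*} [Fintype ι] [DecidableEq ι]
    {E : Type*} [NormedAddCommGroup E] [NormedSpace 𝕜 E]
    (j : ι) (f : (ι → 𝕜) → E) (z : ι → 𝕜) : E :=
  fderiv 𝕜 f z (Pi.single j 1)

/-- Jacobian matrix `(∂ f_i / ∂ z_j)_{ij}`. -/
def jac (𝕜 : Type*) [RCLike 𝕜] {ι κ : Type*} [Fintype ι] [DecidableEq ι] [Fintype κ]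
    (f : (ι → 𝕜) → κ → 𝕜) (z : ι → 𝕜) : Matrix κ ι 𝕜 :=
  Matrix.of fun i j => partialD 𝕜 j f z i

/-- A (real analytic) generalized Hamiltonian system `ż = B(z) ∇H(z)` with Hamiltonian `H` and
invertible structure matrix `B`, for which the 2-form `Ω(ξ, η) = ⟨ξ, B(z)⁻¹ η⟩` is exact. -/
structure GenHamSystem (n : ℕ) where
  /-- whether the first `n` coordinates are angles -/
  angular : Bool
  /-- phase space (lifted to the universal cover when `angular = true`) -/
  dom : Set (Idx n → ℝ)
  isOpen_dom : IsOpen dom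
  dom_periodic : ∀ v, IsPeriod angular v → ∀ x ∈ dom, x + v ∈ dom
  /-- the Hamiltonian -/
  H : (Idx n → ℝ) → ℝ
  /-- the structure matrix -/
  B : (Idx n → ℝ) → Matrix (Idx n) (Idx n) ℝ
  H_analytic : AnalyticOnNhd ℝ H dom
  B_analytic : ∀ i j, AnalyticOnNhd ℝ (fun x => B x i j) dom
  H_periodic : ∀ v, IsPeriod angular v → ∀ x ∈ dom, H (x + v) = H x
  B_periodic : ∀ v, IsPeriod angular v → ∀ x ∈ dom, B (x + v) = B x
  skew : ∀ x ∈ dom, ∀ i j, B x i j = -B x j i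
  jacobi : ∀ x ∈ dom, ∀ i j k,
    ∑ l, (partialD ℝ l (fun y => B y i j) x * B x l k
        + partialD ℝ l (fun y => B y j k) x * B x l i
        + partialD ℝ l (fun y => B y k i) x * B x l j) = 0
  invertible : ∀ x ∈ dom, IsUnit (B x)
  /-- `Ω = dα` for a 1-form `α = ∑ c_j dz_j` on phase space; the matrix of `dα` is
  `Dcᵀ - Dc`. -/
  exact : ∃ c : (Idx n → ℝ) → Idx n → ℝ, ContDiffOn ℝ (⊤ : ℕ∞) c dom ∧
    (∀ v, IsPeriod angular v → ∀ x ∈ dom, c (x + v) = c x) ∧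
    ∀ x ∈ dom, (B x)⁻¹ = (jac ℝ c x)ᵀ - jac ℝ c x

/-- Supremum norm of `f` on `s` (meaningful when `f` is bounded on `s`). -/
def supNorm {X E : Type*} [Norm E] (s : Set X) (f : X → E) : ℝ := ⨆ x : s, ‖f x‖

/-- `f` is bounded on `s`, i.e. its supremum norm on `s` is finite. -/
def BddOn {X E : Type*} [Norm E] (s : Set X) (f : X → E) : Prop :=
  BddAbove (Set.range fun x : s => ‖f x‖)

/-- `C^k` norm of a holomorphic function on `s`: the supremum over `s` of the norms of all
derivatives of order at most `k`. -/
def ckNorm {ι : Type*} [Fintype ι] {E : Type*} [NormedAddCommGroup E] [NormedSpace ℂ E]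
    (k : ℕ) (s : Set (ι → ℂ)) (f : (ι → ℂ) → E) : ℝ :=
  ⨆ p : Fin (k + 1) × s, ‖iteratedFDeriv ℂ (p.1 : ℕ) f (p.2 : ι → ℂ)‖

/-- The `C^k` norm of `f` on `s` is finite. -/
def CkBddOn {ι : Type*} [Fintype ι] {E : Type*} [NormedAddCommGroup E] [NormedSpace ℂ E]
    (k : ℕ) (s : Set (ι → ℂ)) (f : (ι → ℂ) → E) : Prop :=
  BddAbove (Set.range fun p : Fin (k + 1) × s => ‖iteratedFDeriv ℂ (p.1 : ℕ) f (p.2 : ι → ℂ)‖)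

/-- The matrix `DB(z)[h]`: the derivative of `B` at `z` in the direction `h`, entry by entry. -/
def dirB {n : ℕ} (B : (Idx n → ℂ) → Matrix (Idx n) (Idx n) ℂ) (z h : Idx n → ℂ) : Matrix (Idx n) (Idx n) ℂ :=
  Matrix.of fun i j => fderiv ℂ (fun y => B y i j) z h

/-- `C¹` norm of a holomorphic matrix-valued function on `s`: the larger of `sup ‖B(z)‖` and
`sup ‖DB(z)‖`, where `‖DB(z)‖` is the supremum of `‖DB(z)[h]‖` over `|h| ≤ 1`. -/
def c1NormMat {n : ℕ} (s : Set (Idx n → ℂ)) (B : (Idx n → ℂ) → Matrix (Idx n) (Idx n) ℂ) : ℝ :=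
  max (supNorm s B)
    (supNorm (s ×ˢ Metric.closedBall (0 : Idx n → ℂ) 1) fun p => dirB B p.1 p.2)

/-- The `C¹` norm of the matrix-valued function `B` on `s` is finite. -/
def C1BddOnMat {n : ℕ} (s : Set (Idx n → ℂ)) (B : (Idx n → ℂ) → Matrix (Idx n) (Idx n) ℂ) : Prop :=
  BddOn s B ∧ BddOn (s ×ˢ Metric.closedBall (0 : Idx n → ℂ) 1) fun p => dirB B p.1 p.2

/-- A holomorphic extension of `B` and `H` to an open set `D` of complex phase space (in the
applications `D` is the `r`-neighbourhood of the image of a complex strip under an approximate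
torus), with finite norms `‖B‖_{C¹,D}`, `‖B⁻¹‖_D` and `‖H‖_{C²,D}`. -/
structure HolomorphicExtension {n : ℕ} (S : GenHamSystem n) (D : Set (Idx n → ℂ)) where
  isOpen : IsOpen D
  periodic : ∀ v, IsPeriod S.angular v → ∀ z ∈ D, z + toC v ∈ D
  H : (Idx n → ℂ) → ℂ
  B : (Idx n → ℂ) → Matrix (Idx n) (Idx n) ℂ
  H_holo : DifferentiableOn ℂ H D
  B_holo : ∀ i j, DifferentiableOn ℂ (fun z => B z i j) D
  H_periodic : ∀ v, IsPeriod S.angular v → ∀ z ∈ D, H (z + toC v) = H z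
  B_periodic : ∀ v, IsPeriod S.angular v → ∀ z ∈ D, B (z + toC v) = B z
  H_extends : ∀ x ∈ S.dom, toC x ∈ D → H (toC x) = (S.H x : ℂ)
  B_extends : ∀ x ∈ S.dom, toC x ∈ D → B (toC x) = (S.B x).map (fun t : ℝ => (t : ℂ))
  invertible : ∀ z ∈ D, IsUnit (B z)
  B_bdd : C1BddOnMat D B
  Binv_bdd : BddOn D fun z => (B z)⁻¹
  H_bdd : CkBddOn 2 D H

/-- The open strip `U_ρ = {θ ∈ ℂⁿ : |Im θ| < ρ}` (maximum norm). -/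
def strip (n : ℕ) (ρ : ℝ) : Set (Fin n → ℂ) := {θ | ∀ j, |(θ j).im| < ρ}

/-- The closed strip `{θ ∈ ℂⁿ : |Im θ| ≤ ρ}`. -/
def closedStrip (n : ℕ) (ρ : ℝ) : Set (Fin n → ℂ) := {θ | ∀ j, |(θ j).im| ≤ ρ}

/-- `(γ, σ)`-Diophantine vectors: `|k·ω| ≥ γ |k|₁^{-σ}` for all nonzero integer vectors `k`. -/
def IsDiophantine {n : ℕ} (γ σ : ℝ) (ω : Fin n → ℝ) : Prop :=
  ∀ k : Fin n → ℤ, k ≠ 0 →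
    γ * (∑ j, |(k j : ℝ)|) ^ (-σ) ≤ |∑ j, (k j : ℝ) * ω j|

/-- The class `𝒫(U, ·)`: continuous on `U`, holomorphic in the interior of `U`, real at real points,
and one-periodic in all variables, as a map into phase space: with `angular = false` this is
ordinary periodicity, with `angular = true` the (lifted) values at `θ` and at `θ + k` differ by an
element of `ℤⁿ × {0}`. -/
structure PeriodicAnalytic {n : ℕ} (angular : Bool) (U : Set (Fin n → ℂ))
    (f : (Fin n → ℂ) → Idx n → ℂ) : Prop where
  continuousOn : ContinuousOn f U
  holo : DifferentiableOn ℂ f (interior U)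
  periodic : ∀ k : Fin n → ℤ, ∀ θ ∈ U, θ + intC k ∈ U →
    ∃ v : Idx n → ℝ, IsPeriod angular v ∧ f (θ + intC k) = f θ + toC v
  real : ∀ x : Fin n → ℝ, toC x ∈ U → ∀ i, (f (toC x) i).im = 0

/-- `∂_ω f (θ) = Df(θ) ω`. -/
def dOmega {n : ℕ} {E : Type*} [NormedAddCommGroup E] [NormedSpace ℂ E]
    (ω : Fin n → ℝ) (f : (Fin n → ℂ) → E) (θ : Fin n → ℂ) : E :=
  fderiv ℂ f θ (toC ω)

/-- `∂_ω F` for a matrix-valued function `F`, entry by entry. -/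
def dOmegaMat {n : ℕ} {κ κ' : Type*} (ω : Fin n → ℝ) (F : (Fin n → ℂ) → Matrix κ κ' ℂ)
    (θ : Fin n → ℂ) : Matrix κ κ' ℂ :=
  Matrix.of fun i j => dOmega ω (fun τ => F τ i j) θ

/-- Average over the real torus `ℝⁿ / ℤⁿ` of a matrix-valued function, entry by entry. -/
def avg {n : ℕ} {κ κ' : Type*} (F : (Fin n → ℂ) → Matrix κ κ' ℂ) : Matrix κ κ' ℂ :=
  Matrix.of fun i j => ∫ x in Set.Icc (0 : Fin n → ℝ) 1, F (toC x) i j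

/-- The maximum norm `|A| = max |a_ij|` of a matrix. -/
def maxNorm {κ κ' : Type*} [Fintype κ] [Fintype κ'] (A : Matrix κ κ' ℂ) : ℝ :=
  ‖fun p : κ × κ' => A p.1 p.2‖

section Objects

variable {n : ℕ} (B : (Idx n → ℂ) → Matrix (Idx n) (Idx n) ℂ) (H : (Idx n → ℂ) → ℂ)
  (ω : Fin n → ℝ) (K : (Fin n → ℂ) → Idx n → ℂ)

/-- `∇H`. -/
def grad (z : Idx n → ℂ) : Idx n → ℂ := fun j => partialD ℂ j H z

/-- `Φ_{ik}(z) = ∑_j (∂b_{ij}/∂z_k)(z) (∂H/∂z_j)(z)`. -/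
def Phi (z : Idx n → ℂ) : Matrix (Idx n) (Idx n) ℂ :=
  Matrix.of fun i k => ∑ j, partialD ℂ k (fun y => B y i j) z * grad H z j

/-- `Ψ(z) = D∇H(z)`. -/
def Psi (z : Idx n → ℂ) : Matrix (Idx n) (Idx n) ℂ := jac ℂ (grad H) z

/-- `A(θ) = Φ(K(θ)) + B(K(θ)) Ψ(K(θ))`. -/
def matA (θ : Fin n → ℂ) : Matrix (Idx n) (Idx n) ℂ :=
  Phi B H (K θ) + B (K θ) * Psi H (K θ)

/-- The error `e(θ) = B(K(θ)) ∇H(K(θ)) - ∂_ω K(θ)`. -/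
def err (θ : Fin n → ℂ) : Idx n → ℂ := B (K θ) *ᵥ grad H (K θ) - dOmega ω K θ

/-- `DK(θ)`, a `2n × n` matrix. -/
def DK (θ : Fin n → ℂ) : Matrix (Idx n) (Fin n) ℂ := jac ℂ K θ

/-- `N(θ) = (DK(θ)ᵀ DK(θ))⁻¹`. -/
def matN (θ : Fin n → ℂ) : Matrix (Fin n) (Fin n) ℂ := ((DK K θ)ᵀ * DK K θ)⁻¹

/-- The matrix `S⁰(θ) = N DKᵀ {A B - B A - DB[B ∇H] + B DK N DKᵀ (A + Aᵀ)} DK N`. -/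
def matS0 (θ : Fin n → ℂ) : Matrix (Fin n) (Fin n) ℂ :=
  matN K θ * (DK K θ)ᵀ *
    (matA B H K θ * B (K θ) - B (K θ) * matA B H K θ
      - dirB B (K θ) (B (K θ) *ᵥ grad H (K θ))
      + B (K θ) * DK K θ * matN K θ * (DK K θ)ᵀ * (matA B H K θ + (matA B H K θ)ᵀ))
    * DK K θ * matN K θ

/-- `M(θ) = (DK(θ), B(K(θ)) DK(θ) N(θ))`. -/
def matM (θ : Fin n → ℂ) : Matrix (Idx n) (Idx n) ℂ :=
  Matrix.fromCols (DK K θ) (B (K θ) * DK K θ * matN K θ)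

/-- `L(θ) = DKᵀ B(K)⁻¹ DK`, the matrix of the pull-back `K^*Ω`. -/
def matL (θ : Fin n → ℂ) : Matrix (Fin n) (Fin n) ℂ :=
  (DK K θ)ᵀ * (B (K θ))⁻¹ * DK K θ

/-- The matrix `V(θ)`. -/
def matV (θ : Fin n → ℂ) : Matrix (Idx n) (Idx n) ℂ :=
  Matrix.fromBlocks 0 1 (-1)
    (-((matN K θ)ᵀ * (DK K θ)ᵀ * B (K θ) * DK K θ * matN K θ))

/-- The matrix `R(θ)`. -/
def matR (θ : Fin n → ℂ) : Matrix (Idx n) (Idx n) ℂ :=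
  Matrix.fromBlocks (matL B K θ) 0 0 0

/-- `M_e(θ) = -(I + V⁻¹R)⁻¹ V⁻¹ R V⁻¹ Mᵀ B(K)⁻¹`. -/
def matMe (θ : Fin n → ℂ) : Matrix (Idx n) (Idx n) ℂ :=
  -((1 + (matV B K θ)⁻¹ * matR B K θ)⁻¹ * (matV B K θ)⁻¹ * matR B K θ * (matV B K θ)⁻¹
    * (matM B K θ)ᵀ * (B (K θ))⁻¹)

/-- The nilpotent upper triangular coefficient matrix `[[0, S⁰], [0, 0]]`. -/
def triS0 (θ : Fin n → ℂ) : Matrix (Idx n) (Idx n) ℂ :=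
  Matrix.fromBlocks 0 (matS0 B H K θ) 0 0

/-- `E(θ) = A M - ∂_ω M - M [[0, S⁰], [0, 0]]`. -/
def matE (θ : Fin n → ℂ) : Matrix (Idx n) (Idx n) ℂ :=
  matA B H K θ * matM B K θ - dOmegaMat ω (matM B K) θ - matM B K θ * triS0 B H K θ

/-- `C(θ) = M(θ)⁻¹ E(θ)`. -/
def matC (θ : Fin n → ℂ) : Matrix (Idx n) (Idx n) ℂ := (matM B K θ)⁻¹ * matE B H ω K θ

/-- `p_x(θ) = -Nᵀ DKᵀ (I - B DK N DKᵀ B⁻¹) e`. -/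
def px (θ : Fin n → ℂ) : Fin n → ℂ :=
  -(((matN K θ)ᵀ * (DK K θ)ᵀ *
    (1 - B (K θ) * DK K θ * matN K θ * (DK K θ)ᵀ * (B (K θ))⁻¹)) *ᵥ err B H ω K θ)

/-- `p_y(θ) = -DKᵀ B⁻¹ e`. -/
def py (θ : Fin n → ℂ) : Fin n → ℂ :=
  -(((DK K θ)ᵀ * (B (K θ))⁻¹) *ᵥ err B H ω K θ)

/-- `p = (p_x, p_y)`. -/
def vecP (θ : Fin n → ℂ) : Idx n → ℂ := Sum.elim (px B H ω K θ) (py B H ω K θ)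

/-- `w(θ) = -M_e(θ) e(θ)`. -/
def vecW (θ : Fin n → ℂ) : Idx n → ℂ := -(matMe B K θ *ᵥ err B H ω K θ)

/-- The linearized equation `A(θ) Δ(θ) - ∂_ω Δ(θ) = -e(θ)` at the point `θ`. -/
def LinearizedAt (Δ : (Fin n → ℂ) → Idx n → ℂ) (θ : Fin n → ℂ) : Prop :=
  matA B H K θ *ᵥ Δ θ - dOmega ω Δ θ = -err B H ω K θ

/-- The transformed equation `([[0, S⁰], [0, 0]] + C) ξ - ∂_ω ξ = p + w` at the point `θ`. -/
def TransformedAt (ξ : (Fin n → ℂ) → Idx n → ℂ) (θ : Fin n → ℂ) : Prop :=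
  (triS0 B H K θ + matC B H ω K θ) *ᵥ ξ θ - dOmega ω ξ θ = vecP B H ω K θ + vecW B H ω K θ

/-- The component `ξ_x` of `ξ = (ξ_x, ξ_y)`. -/
def xPart (ξ : (Fin n → ℂ) → Idx n → ℂ) (θ : Fin n → ℂ) : Fin n → ℂ := fun i => ξ θ (Sum.inl i)

/-- The component `ξ_y` of `ξ = (ξ_x, ξ_y)`. -/
def yPart (ξ : (Fin n → ℂ) → Idx n → ℂ) (θ : Fin n → ℂ) : Fin n → ℂ := fun i => ξ θ (Sum.inr i)

/-- The reduced triangular system `∂_ω ξ_x = S⁰ ξ_y - p_x`, `∂_ω ξ_y = -p_y` at the point `θ`. -/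
def ReducedAt (ξ : (Fin n → ℂ) → Idx n → ℂ) (θ : Fin n → ℂ) : Prop :=
  dOmega ω (xPart ξ) θ = matS0 B H K θ *ᵥ yPart ξ θ - px B H ω K θ ∧
    dOmega ω (yPart ξ) θ = -py B H ω K θ

end Objects

/-- A non-degenerate map `K ∈ 𝒫(Ū_ρ, ·)` from the closed complex strip to the complex domain `D`,
whose restriction to the real torus takes values in (real) phase space, with finite norms
`‖DK‖_ρ` and `‖N‖_ρ`. -/
structure NondegenerateTorus {n : ℕ} {S : GenHamSystem n} {D : Set (Idx n → ℂ)}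
    (X : HolomorphicExtension S D) (ρ : ℝ) (K : (Fin n → ℂ) → Idx n → ℂ) : Prop where
  mem : PeriodicAnalytic S.angular (closedStrip n ρ) K
  mapsTo : Set.MapsTo K (closedStrip n ρ) D
  real_mapsTo : ∀ x : Fin n → ℝ, (fun i => (K (toC x) i).re) ∈ S.dom
  nd1 : ∀ θ ∈ strip n ρ, IsUnit ((DK K θ)ᵀ * DK K θ)
  nd2 : IsUnit (avg (matS0 X.B X.H K))
  DK_bdd : BddOn (strip n ρ) (DK K)
  N_bdd : BddOn (strip n ρ) (matN K)

/-- A real polynomial all of whose coefficients are nonnegative. -/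
def NonnegCoeffs {m : ℕ} (P : MvPolynomial (Fin m) ℝ) : Prop := ∀ a, 0 ≤ P.coeff a

end KAM

end

/-!
The idea is to use the derivative of the approximately invariant torus as a frame.  The matrix
`M = (DK, B DK N)` is an almost symplectic frame along the torus: `Mᵀ B⁻¹ M = V + R`, where `V` is
explicitly invertible and `R` contains the pull-back `L = K^*Ω` (`matM_transpose_mul_mul`).  Hence
`M` is invertible as soon as `V⁻¹R` is small, with `M⁻¹ = V⁻¹MᵀB⁻¹ + M_e` (`matM_inv`), and
substituting `Δ = Mξ` and multiplying by `M⁻¹` transforms the linearized equation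
(`linearizedAt_iff`).

Two facts make the transformed equation nearly triangular.

* `L` is small.  The form `Ω` is exact, so `K^*Ω` is `dβ` for a periodic 1-form `β`, while
  contracting `K^*Ω` with `ω` gives `L ω = ∇(H ∘ K) + p_y` (`matL_mulVec`).  Comparing Fourier
  coefficients, `p_y` has average zero, and if `∂_ω u = -p_y` then `L` is the antisymmetrized
  Jacobian of `u` (`matL_eq_of_fderiv_eq`).  Rüssmann's estimate for `u` and Cauchy's estimate for
  its derivatives bound `L` by the error (`norm_matL_le`).
* The first column of `E = AM - ∂_ωM - M (0 S⁰; 0 0)` is `De`, since differentiating the definition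
  of `e` gives `∂_ω DK = A DK - De`.  In the second column the terms without `e` and `De` reduce to
  `(torsionCore) DK N - DK S⁰`, and `M⁻¹` maps this to `M_e (torsionCore) DK N`: the Jacobi identity
  in the form `AB + BAᵀ = DB[B∇H]` (`matA_mul_B_add`) shows that `DKᵀB⁻¹` annihilates `torsionCore`,
  and the remaining block of `V⁻¹MᵀB⁻¹ (torsionCore) DK N` is `S⁰` by definition (`matC_eq`).

The triangular system is solved from the bottom up.  The right-hand side `-p_y` has average zero,
and the average of `ξ_y` is a free constant, which, `⟨S⁰⟩` being invertible, can be chosen such that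
`S⁰ξ_y - p_x` has average zero (`exists_reducedAt`).

The optimal exponent `σ` in the solution of `∂_ω u = f` (`exists_norm_sol_le`) is Rüssmann's: the
numbers `k·ω` with `|k|₁ ≤ t` are separated by `γ (2t)^{-σ}`, hence `∑ (k·ω)⁻²` over this set is
of the order of the largest possible term (`sum_inv_divisor_sq_le`); the Cauchy–Schwarz inequality
combines this with the square summability of the Fourier coefficients on the boundary of the strip.

For the quantitative statements a single number `T`, larger than all norms in question, than the
dimension, and than the constants of the small divisor estimate, turns every bound into a power of
`T`; the polynomials `c₂` and `c₄` and the function `c₅` are powers of such a `T`.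
-/

namespace KAM

open MeasureTheory Filter Topology Metric Set

/-! ### Holomorphic functions of several variables -/

section SeveralVariables

variable {E F : Type*} [NormedAddCommGroup E] [NormedSpace ℂ E]
  [NormedAddCommGroup F] [NormedSpace ℂ F]

/-- Cauchy's estimate for a directional derivative. -/
theorem norm_fderiv_apply_le {f : E → F} {z v : E} {R C : ℝ} (hR : 0 < R)
    (hd : ∀ ζ : ℂ, ‖ζ‖ ≤ R → DifferentiableAt ℂ f (z + ζ • v))
    (hC : ∀ ζ : ℂ, ‖ζ‖ ≤ R → ‖f (z + ζ • v)‖ ≤ C) : ‖fderiv ℂ f z v‖ ≤ C / R := by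
  have hd0 : DifferentiableAt ℂ f z := by simpa using hd 0 (by simpa using hR.le)
  have hline : ∀ ζ : ℂ, HasDerivAt (fun ζ : ℂ => z + ζ • v) v ζ := fun ζ => by
    simpa using ((hasDerivAt_id ζ).smul_const v).const_add z
  have h1 : HasDerivAt (fun ζ : ℂ => f (z + ζ • v)) (fderiv ℂ f z v) 0 := by
    have h := hd0.hasFDerivAt
    have h2 : HasFDerivAt f (fderiv ℂ f z) (z + (0 : ℂ) • v) := by simpa using h
    exact h2.comp_hasDerivAt (0 : ℂ) (hline 0)
  rw [← h1.deriv]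
  refine Complex.norm_deriv_le_of_forall_mem_sphere_norm_le hR ?_ fun ζ hζ => hC ζ ?_
  · refine DifferentiableOn.diffContOnCl fun ζ hζ => ?_
    have hζ' : ‖ζ‖ ≤ R := by
      simpa using closure_ball_subset_closedBall hζ
    exact ((hd ζ hζ').comp ζ (hline ζ).differentiableAt).differentiableWithinAt
  · simpa using (mem_sphere_zero_iff_norm.1 hζ).le

theorem norm_fderiv_le_of_closedBall {f : E → F} {z : E} {R C : ℝ} (hR : 0 < R)
    (hd : ∀ y ∈ closedBall z R, DifferentiableAt ℂ f y)
    (hC : ∀ y ∈ closedBall z R, ‖f y‖ ≤ C) : ‖fderiv ℂ f z‖ ≤ C / R := by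
  have hC0 : 0 ≤ C := (norm_nonneg _).trans (hC z (mem_closedBall_self hR.le))
  refine ContinuousLinearMap.opNorm_le_of_unit_norm (𝕜 := ℂ) (by positivity) fun v hv => ?_
  have hmem : ∀ ζ : ℂ, ‖ζ‖ ≤ R → z + ζ • v ∈ closedBall z R := fun ζ hζ => by
    simpa [norm_smul, hv] using hζ
  exact norm_fderiv_apply_le hR (fun ζ hζ => hd _ (hmem ζ hζ)) fun ζ hζ => hC _ (hmem ζ hζ)

variable {ι : Type*} [Fintype ι]

/-- An integral of translates of a holomorphic function over a compact parameter set is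
holomorphic.  Cauchy's estimate supplies the uniform bound on the derivative of the integrand. -/
theorem differentiableAt_setIntegral_translate {α : Type*} [TopologicalSpace α]
    [SecondCountableTopology α]
    [MeasurableSpace α] [OpensMeasurableSpace α] {μ : Measure α} [IsFiniteMeasureOnCompacts μ]
    {S : Set α} (hS : IsCompact S) (hSm : MeasurableSet S) {w : α → ℂ} {γ : α → ι → ℂ}
    (hw : Continuous w) (hγ : Continuous γ) {U : Set (ι → ℂ)} (hU : IsOpen U)
    {f : (ι → ℂ) → ℂ} (hf : DifferentiableOn ℂ f U) {z : ι → ℂ} (hz : ∀ t ∈ S, z + γ t ∈ U) :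
    DifferentiableAt ℂ (fun y => ∫ t in S, w t * f (y + γ t) ∂μ) z := by
  have hK : IsCompact ((fun t => z + γ t) '' S) := hS.image (by fun_prop)
  obtain ⟨r, hr, hrU⟩ := hK.exists_cthickening_subset_open hU (by
    rintro _ ⟨t, ht, rfl⟩; exact hz t ht)
  obtain ⟨C, hC⟩ := (hK.cthickening (r := r)).exists_bound_of_continuousOn
    (hf.continuousOn.mono hrU)
  obtain ⟨W, hW⟩ := hS.exists_bound_of_continuousOn hw.continuousOn
  have hnear : ∀ t ∈ S, ∀ y ∈ ball z (r / 2), ∀ y' ∈ closedBall (y + γ t) (r / 2),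
      y' ∈ cthickening r ((fun t => z + γ t) '' S) := by
    intro t ht y hy y' hy'
    refine mem_cthickening_of_dist_le y' (z + γ t) r _ ⟨t, ht, rfl⟩ ?_
    have h1 : dist y' (y + γ t) ≤ r / 2 := hy'
    have h2 : dist (y + γ t) (z + γ t) < r / 2 := by simpa using hy
    linarith [dist_triangle y' (y + γ t) (z + γ t)]
  have hdiff : ∀ y' ∈ cthickening r ((fun t => z + γ t) '' S), DifferentiableAt ℂ f y' :=
    fun y' hy' => hf.differentiableAt (hU.mem_nhds (hrU hy'))
  have hself : ∀ t ∈ S, ∀ y ∈ ball z (r / 2),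
      y + γ t ∈ cthickening r ((fun t => z + γ t) '' S) :=
    fun t ht y hy => hnear t ht y hy _ (mem_closedBall_self (by positivity))
  have hcont : ∀ y ∈ ball z (r / 2), ContinuousOn (fun t => w t * f (y + γ t)) S := by
    intro y hy
    refine hw.continuousOn.mul (hf.continuousOn.comp (by fun_prop) ?_)
    exact fun t ht => hrU (hself t ht y hy)
  have hfin : μ S ≠ ⊤ := hS.measure_lt_top.ne
  have hz0 : z ∈ ball z (r / 2) := mem_ball_self (by positivity)
  have : ProperSpace ((ι → ℂ) →L[ℂ] ℂ) := FiniteDimensional.proper ℂ _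
  refine (hasFDerivAt_integral_of_dominated_of_fderiv_le (𝕜 := ℂ) (s := ball z (r / 2))
    (bound := fun _ => W * (C / (r / 2)))
    (F' := fun y t => w t • fderiv ℂ f (y + γ t)) (ball_mem_nhds z (by positivity))
    ?_ ?_ ?_ ?_ ?_ ?_).differentiableAt
  · filter_upwards [ball_mem_nhds z (half_pos hr)] with y hy
    exact (hcont y hy).aestronglyMeasurable hSm
  · exact (hcont z hz0).integrableOn_compact' hS hSm
  · have hm : Measurable fun t => fderiv ℂ f (z + γ t) :=
      (measurable_fderiv ℂ f).comp (by fun_prop : Continuous fun t => z + γ t).measurable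
    exact (hw.aestronglyMeasurable).smul hm.aestronglyMeasurable
  · filter_upwards [ae_restrict_mem hSm] with t ht y hy
    rw [norm_smul]
    have h1 := hW t ht
    have h2 : ‖fderiv ℂ f (y + γ t)‖ ≤ C / (r / 2) :=
      norm_fderiv_le_of_closedBall (half_pos hr) (fun y' hy' => hdiff y' (hnear t ht y hy y' hy'))
        fun y' hy' => hC y' (hnear t ht y hy y' hy')
    exact mul_le_mul h1 h2 (norm_nonneg _) ((norm_nonneg _).trans h1)
  · exact integrableOn_const hfin
  · filter_upwards [ae_restrict_mem hSm] with t ht y hy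
    have h1 := (hdiff _ (hself t ht y hy)).hasFDerivAt
    have h2 : HasFDerivAt (fun y => f (y + γ t)) (fderiv ℂ f (y + γ t)) y := by
      exact h1.comp y ((hasFDerivAt_id y).add_const (γ t))
    simpa using h2.const_mul (w t)

/-- Osgood's lemma: the derivative of a holomorphic function of several variables is holomorphic,
since Cauchy's formula represents it as an integral of translates of the function. -/
theorem differentiableOn_fderiv_apply {U : Set (ι → ℂ)} (hU : IsOpen U) {f : (ι → ℂ) → ℂ}
    (hf : DifferentiableOn ℂ f U) (v : ι → ℂ) :
    DifferentiableOn ℂ (fun z => fderiv ℂ f z v) U := by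
  intro z hz
  obtain ⟨r, hr, hrU⟩ := Metric.isOpen_iff.1 hU z hz
  set s : ℝ := r / (2 * (‖v‖ + 1)) with hs
  have hs0 : 0 < s := by positivity
  have hsv : s * ‖v‖ ≤ r / 2 := by
    rw [hs, div_mul_eq_mul_div, div_le_div_iff₀ (by positivity) (by positivity)]
    nlinarith [norm_nonneg v]
  have hmem : ∀ y ∈ ball z (r / 2), ∀ ζ : ℂ, ‖ζ‖ ≤ s → y + ζ • v ∈ U := by
    intro y hy ζ hζ
    apply hrU
    have h1 : dist (y + ζ • v) y ≤ r / 2 := by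
      rw [dist_eq_norm, add_sub_cancel_left, norm_smul]
      exact (mul_le_mul_of_nonneg_right hζ (norm_nonneg _)).trans hsv
    have h2 : dist y z < r / 2 := hy
    exact mem_ball.2 (by linarith [dist_triangle (y + ζ • v) y z])
  have hline : ∀ y : ι → ℂ, ∀ ζ : ℂ, HasDerivAt (fun ζ : ℂ => y + ζ • v) v ζ := fun y ζ => by
    simpa using ((hasDerivAt_id ζ).smul_const v).const_add y
  set w : ℝ → ℂ := fun t => (2 * Real.pi * Complex.I)⁻¹ *
    (deriv (circleMap 0 s) t * (1 / circleMap 0 s t ^ 2)) with hwdef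
  have hcirc : ∀ t, circleMap 0 s t ≠ 0 := fun t => by
    exact circleMap_ne_center hs0.ne'
  have hw : Continuous w := by
    have h1 : Continuous (deriv (circleMap 0 s)) := by
      rw [funext (deriv_circleMap 0 s)]
      exact (continuous_circleMap 0 s).mul continuous_const
    exact continuous_const.mul (h1.mul (continuous_const.div ((continuous_circleMap 0 s).pow 2)
      fun t => pow_ne_zero _ (hcirc t)))
  have hγ : Continuous fun t : ℝ => circleMap 0 s t • v :=
    (continuous_circleMap 0 s).smul continuous_const
  have hnorm : ∀ t, ‖circleMap 0 s t‖ ≤ s := fun t => by simp [abs_of_pos hs0]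
  have hD := differentiableAt_setIntegral_translate (μ := volume)
    (isCompact_Icc (a := (0 : ℝ)) (b := 2 * Real.pi)) measurableSet_Icc hw hγ hU hf
    (z := z) fun t _ => hmem z (mem_ball_self (by positivity)) _ (hnorm t)
  refine (hD.congr_of_eventuallyEq ?_).differentiableWithinAt
  filter_upwards [ball_mem_nhds z (half_pos hr)] with y hy
  have hdy : ∀ ζ : ℂ, ‖ζ‖ ≤ s → DifferentiableAt ℂ (fun ζ : ℂ => f (y + ζ • v)) ζ :=
    fun ζ hζ => (hf.differentiableAt (hU.mem_nhds (hmem y hy ζ hζ))).comp ζ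
      (hline y ζ).differentiableAt
  have h1 : HasDerivAt (fun ζ : ℂ => f (y + ζ • v)) (fderiv ℂ f y v) 0 := by
    have h0 := hmem y hy 0 (by simpa using hs0.le)
    have h2 := (hf.differentiableAt (hU.mem_nhds h0)).hasFDerivAt
    have h3 : fderiv ℂ f y = fderiv ℂ f (y + (0 : ℂ) • v) := by simp
    rw [h3]
    exact h2.comp_hasDerivAt (0 : ℂ) (hline y 0)
  have h2 := DifferentiableOn.deriv_eq_smul_circleIntegral (c := 0) hs0
    (f := fun ζ : ℂ => f (y + ζ • v)) fun ζ hζ =>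
      (hdy ζ (by simpa using hζ)).differentiableWithinAt
  rw [h1.deriv, circleIntegral_def_Icc] at h2
  have hpi : (2 * Real.pi * Complex.I : ℂ) ≠ 0 := Complex.two_pi_I_ne_zero
  rw [← inv_smul_eq_iff₀ hpi] at h2
  rw [← h2, ← integral_smul]
  refine integral_congr_ae (Eventually.of_forall fun t => ?_)
  simp [hwdef, mul_assoc]

theorem differentiableOn_fderiv {U : Set (ι → ℂ)} (hU : IsOpen U)
    {f : (ι → ℂ) → ℂ} (hf : DifferentiableOn ℂ f U) : DifferentiableOn ℂ (fderiv ℂ f) U := by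
  classical
  have h : fderiv ℂ f = fun z => ∑ i, fderiv ℂ f z (Pi.single i 1) •
      (ContinuousLinearMap.proj i : (ι → ℂ) →L[ℂ] ℂ) := by
    funext z
    ext v
    conv_lhs => rw [pi_eq_sum_univ' v]
    simp [mul_comm, Pi.single]
  rw [h]
  exact DifferentiableOn.fun_sum fun i _ =>
    (differentiableOn_fderiv_apply hU hf _).smul_const _

end SeveralVariables

/-! ### Complex strips -/

section Strip

variable {n : ℕ} {ρ : ℝ}

theorem toC_add {ι : Type*} (x y : ι → ℝ) : toC (x + y) = toC x + toC y := by
  funext i; simp [toC]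

theorem toC_zero {ι : Type*} : toC (0 : ι → ℝ) = 0 := by
  funext i; simp [toC]

theorem toC_smul {ι : Type*} (t : ℝ) (x : ι → ℝ) : toC (t • x) = (t : ℂ) • toC x := by
  funext i; simp [toC]

theorem toC_single {ι : Type*} [DecidableEq ι] (j : ι) :
    toC (Pi.single j 1) = (Pi.single j 1 : ι → ℂ) := by
  funext i
  by_cases h : i = j
  · subst h; simp [toC]
  · simp [toC, h]

theorem continuous_toC {ι : Type*} : Continuous (toC : (ι → ℝ) → ι → ℂ) := by
  unfold toC; fun_prop

/-- The inclusion `ℝ^ι → ℂ^ι` as a continuous real-linear map. -/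
def toCL (ι : Type*) : (ι → ℝ) →L[ℝ] (ι → ℂ) where
  toFun := toC
  map_add' := toC_add
  map_smul' t x := toC_smul t x
  cont := continuous_toC

@[simp] theorem toCL_apply {ι : Type*} (x : ι → ℝ) : toCL ι x = toC x := rfl

theorem intC_eq_toC {ι : Type*} (k : ι → ℤ) : intC k = toC fun i => (k i : ℝ) := by
  funext i; simp [toC, intC]

theorem strip_eq_pi : strip n ρ = Set.pi univ fun _ => Complex.im ⁻¹' ball 0 ρ := by
  ext θ; simp [strip]

theorem isOpen_strip : IsOpen (strip n ρ) := by
  rw [strip_eq_pi]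
  exact isOpen_set_pi finite_univ fun _ _ => isOpen_ball.preimage Complex.continuous_im

theorem convex_strip : Convex ℝ (strip n ρ) := by
  rw [strip_eq_pi]
  exact convex_pi fun _ _ => (convex_ball 0 ρ).is_linear_preimage
    (f := Complex.im) Complex.imLm.isLinear

theorem strip_mono {r : ℝ} (h : r ≤ ρ) : strip n r ⊆ strip n ρ :=
  fun _ hθ j => (hθ j).trans_le h

theorem strip_subset_closedStrip : strip n ρ ⊆ closedStrip n ρ := fun _ hθ j => (hθ j).le

theorem toC_mem_strip (hρ : 0 < ρ) (x : Fin n → ℝ) : toC x ∈ strip n ρ := fun j => by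
  simpa [toC] using hρ

theorem add_toC_mem_strip {θ : Fin n → ℂ} (hθ : θ ∈ strip n ρ) (x : Fin n → ℝ) :
    θ + toC x ∈ strip n ρ := fun j => by
  simpa [toC] using hθ j

theorem eq_toC_add_smul (θ : Fin n → ℂ) :
    θ = toC (fun j => (θ j).re) + Complex.I • toC (fun j => (θ j).im) := by
  funext j
  simp only [toC, Pi.add_apply, Pi.smul_apply, smul_eq_mul]
  rw [mul_comm]
  exact (Complex.re_add_im _).symm

/-- Identity theorem: a holomorphic function on the strip that vanishes at all real points
vanishes.  On each complex line `ζ ↦ x + ζ y` with `x`, `y` real it is the identity theorem in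
one variable. -/
theorem eq_zero_of_real {f : (Fin n → ℂ) → ℂ} (hf : DifferentiableOn ℂ f (strip n ρ))
    (h0 : ∀ x : Fin n → ℝ, f (toC x) = 0) {θ : Fin n → ℂ} (hθ : θ ∈ strip n ρ) : f θ = 0 := by
  set x : Fin n → ℝ := fun j => (θ j).re
  set y : Fin n → ℝ := fun j => (θ j).im
  set ℓ : ℂ → Fin n → ℂ := fun ζ => toC x + ζ • toC y with hℓ
  have hℓc : Differentiable ℂ ℓ := by fun_prop
  have hI : ℓ Complex.I = θ := (eq_toC_add_smul θ).symm
  have hW : IsOpen (ℓ ⁻¹' strip n ρ) := isOpen_strip.preimage hℓc.continuous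
  have hconv : Convex ℝ (ℓ ⁻¹' strip n ρ) := by
    intro a ha b hb s t hs ht hst
    have h := convex_strip ha hb hs ht hst
    have h1 : ℓ (s • a + t • b) = s • ℓ a + t • ℓ b := by
      funext j
      have h2 : (s : ℂ) + t = 1 := by exact_mod_cast hst
      simp only [hℓ, Pi.add_apply, Pi.smul_apply, smul_eq_mul, Complex.real_smul]
      linear_combination (-toC x j) * h2
    rw [mem_preimage, h1]; exact h
  have hreal : ∀ t : ℝ, f (ℓ t) = 0 := fun t => by
    rw [hℓ]
    simp only [← toC_smul, ← toC_add]
    exact h0 _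
  have h0mem : (0 : ℂ) ∈ ℓ ⁻¹' strip n ρ := by
    intro j
    have := (abs_nonneg _).trans_lt (hθ j)
    simpa [hℓ, toC] using this
  have han : AnalyticOnNhd ℂ (f ∘ ℓ) (ℓ ⁻¹' strip n ρ) :=
    (hf.comp hℓc.differentiableOn fun _ h => h).analyticOnNhd hW
  have hfreq : ∃ᶠ z in 𝓝[≠] (0 : ℂ), (f ∘ ℓ) z = (fun _ => (0 : ℂ)) z := by
    have ht : Tendsto (fun t : ℝ => (t : ℂ)) (𝓝[≠] (0 : ℝ)) (𝓝[≠] (0 : ℂ)) := by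
      refine tendsto_nhdsWithin_iff.2 ⟨?_, ?_⟩
      · have := Complex.continuous_ofReal.tendsto (0 : ℝ)
        rw [Complex.ofReal_zero] at this
        exact this.mono_left nhdsWithin_le_nhds
      · filter_upwards [self_mem_nhdsWithin] with t ht
        simpa using ht
    exact ht.frequently (Eventually.of_forall fun t => hreal t).frequently
  have := han.eqOn_of_preconnected_of_frequently_eq analyticOnNhd_const hconv.isPreconnected
    h0mem hfreq (x := Complex.I) (by rw [mem_preimage, hI]; exact hθ)
  simpa [hI] using this

theorem eqOn_strip_of_real {f g : (Fin n → ℂ) → ℂ} (hf : DifferentiableOn ℂ f (strip n ρ))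
    (hg : DifferentiableOn ℂ g (strip n ρ)) (h : ∀ x : Fin n → ℝ, f (toC x) = g (toC x)) :
    EqOn f g (strip n ρ) := fun _ hθ =>
  sub_eq_zero.1 (eq_zero_of_real (f := fun θ => f θ - g θ) (hf.sub hg)
    (fun x => sub_eq_zero.2 (h x)) hθ)

end Strip

/-! ### Periodic holomorphic functions that are real at real points -/

section RealPeriodic

variable {ι : Type*} [Fintype ι] {U : Set (ι → ℂ)} {P R : Set (ι → ℝ)}

/-- Scalar functions that are holomorphic on `U`, invariant under the real translations in `P`, and
real at the real points in `R`.  All coefficients of the linearized equation belong to this class,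
with `U` the strip, `P` the integer vectors, and `R` everything. -/
structure RealPeriodic (U : Set (ι → ℂ)) (P R : Set (ι → ℝ)) (f : (ι → ℂ) → ℂ) : Prop where
  holo : DifferentiableOn ℂ f U
  per : ∀ v ∈ P, ∀ z ∈ U, f (z + toC v) = f z
  real : ∀ x ∈ R, toC x ∈ U → (f (toC x)).im = 0

/-- The derivative, in a real direction, of a function that is real near a real point. -/
theorem im_fderiv_toC {f : (ι → ℂ) → ℂ} {x : ι → ℝ} (hf : DifferentiableAt ℂ f (toC x))
    (h : ∀ᶠ y in 𝓝 x, (f (toC y)).im = 0) (v : ι → ℝ) : (fderiv ℂ f (toC x) (toC v)).im = 0 := by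
  have h1 : HasFDerivAt (fun y => (f (toC y)).im)
      (Complex.imCLM.comp (((fderiv ℂ f (toC x)).restrictScalars ℝ).comp (toCL ι))) x :=
    Complex.imCLM.hasFDerivAt.comp x
      ((hf.hasFDerivAt.restrictScalars ℝ).comp x (toCL ι).hasFDerivAt)
  have h2 : HasFDerivAt (fun y => (f (toC y)).im) (0 : (ι → ℝ) →L[ℝ] ℝ) x :=
    (hasFDerivAt_const (0 : ℝ) x).congr_of_eventuallyEq h
  simpa using congrArg (fun L => L v) (h1.unique h2)

/-- If `F` extends the real function `g` near `x`, then the complex partial derivatives of `F`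
extend those of `g`. -/
theorem fderiv_ofReal_eq {F : (ι → ℂ) → ℂ} {g : (ι → ℝ) → ℝ} {x : ι → ℝ}
    (hF : DifferentiableAt ℂ F (toC x)) (h : ∀ᶠ y in 𝓝 x, F (toC y) = g y) (v : ι → ℝ) :
    HasFDerivAt g (Complex.reCLM.comp
      (((fderiv ℂ F (toC x)).restrictScalars ℝ).comp (toCL ι))) x ∧
      fderiv ℂ F (toC x) (toC v) = (fderiv ℝ g x v : ℝ) := by
  have h1 : HasFDerivAt (fun y => (F (toC y)).re)
      (Complex.reCLM.comp (((fderiv ℂ F (toC x)).restrictScalars ℝ).comp (toCL ι))) x :=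
    Complex.reCLM.hasFDerivAt.comp x
      ((hF.hasFDerivAt.restrictScalars ℝ).comp x (toCL ι).hasFDerivAt)
  have h2 := h1.congr_of_eventuallyEq (f₁ := g) (by
    filter_upwards [h] with y hy; rw [hy, Complex.ofReal_re])
  refine ⟨h2, Complex.ext ?_ ?_⟩
  · rw [h2.fderiv]; simp
  · rw [Complex.ofReal_im]
    exact im_fderiv_toC hF (by filter_upwards [h] with y hy; rw [hy, Complex.ofReal_im]) v

namespace RealPeriodic

variable {f g : (ι → ℂ) → ℂ}

theorem const (c : ℝ) : RealPeriodic U P R fun _ => (c : ℂ) :=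
  ⟨differentiableOn_const _, fun _ _ _ _ => rfl, fun _ _ _ => Complex.ofReal_im c⟩

theorem zero : RealPeriodic U P R fun _ => (0 : ℂ) := by
  simpa using const (U := U) (P := P) (R := R) 0

theorem one : RealPeriodic U P R fun _ => (1 : ℂ) := by
  simpa using const (U := U) (P := P) (R := R) 1

theorem add (hf : RealPeriodic U P R f) (hg : RealPeriodic U P R g) :
    RealPeriodic U P R fun z => f z + g z :=
  ⟨hf.holo.add hg.holo, fun v hv z hz => by rw [hf.per v hv z hz, hg.per v hv z hz],
    fun x hx hxU => by simp [hf.real x hx hxU, hg.real x hx hxU]⟩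

theorem neg (hf : RealPeriodic U P R f) : RealPeriodic U P R fun z => -f z :=
  ⟨hf.holo.neg, fun v hv z hz => by rw [hf.per v hv z hz],
    fun x hx hxU => by simp [hf.real x hx hxU]⟩

theorem sub (hf : RealPeriodic U P R f) (hg : RealPeriodic U P R g) :
    RealPeriodic U P R fun z => f z - g z := by
  simpa [sub_eq_add_neg] using hf.add hg.neg

theorem mul (hf : RealPeriodic U P R f) (hg : RealPeriodic U P R g) :
    RealPeriodic U P R fun z => f z * g z :=
  ⟨hf.holo.mul hg.holo, fun v hv z hz => by rw [hf.per v hv z hz, hg.per v hv z hz],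
    fun x hx hxU => by simp [hf.real x hx hxU, hg.real x hx hxU]⟩

theorem inv (hf : RealPeriodic U P R f) (h : ∀ z ∈ U, f z ≠ 0) :
    RealPeriodic U P R fun z => (f z)⁻¹ :=
  ⟨hf.holo.inv h, fun v hv z hz => by rw [hf.per v hv z hz],
    fun x hx hxU => by simp [Complex.inv_im, hf.real x hx hxU]⟩

theorem sum {α : Type*} {s : Finset α} {F : α → (ι → ℂ) → ℂ}
    (h : ∀ a ∈ s, RealPeriodic U P R (F a)) : RealPeriodic U P R fun z => ∑ a ∈ s, F a z := by
  classical
  induction s using Finset.induction_on with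
  | empty => simpa using zero
  | insert a s ha ih =>
    simp only [Finset.sum_insert ha]
    exact (h a (Finset.mem_insert_self a s)).add
      (ih fun b hb => h b (Finset.mem_insert_of_mem hb))

theorem prod {α : Type*} {s : Finset α} {F : α → (ι → ℂ) → ℂ}
    (h : ∀ a ∈ s, RealPeriodic U P R (F a)) : RealPeriodic U P R fun z => ∏ a ∈ s, F a z := by
  classical
  induction s using Finset.induction_on with
  | empty => simpa using one
  | insert a s ha ih =>
    simp only [Finset.prod_insert ha]
    exact (h a (Finset.mem_insert_self a s)).mul
      (ih fun b hb => h b (Finset.mem_insert_of_mem hb))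

theorem mono {V : Set (ι → ℂ)} (hf : RealPeriodic U P R f) (hV : V ⊆ U) :
    RealPeriodic V P R f :=
  ⟨hf.holo.mono hV, fun v hv z hz => hf.per v hv z (hV hz), fun x hx hxV => hf.real x hx (hV hxV)⟩

theorem differentiableAt (hf : RealPeriodic U P R f) (hU : IsOpen U) {z : ι → ℂ} (hz : z ∈ U) :
    DifferentiableAt ℂ f z := hf.holo.differentiableAt (hU.mem_nhds hz)

/-- The derivative in a real direction is again in the class. -/
theorem fderiv_apply (hf : RealPeriodic U P R f) (hU : IsOpen U) (hR : IsOpen R) (v : ι → ℝ) :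
    RealPeriodic U P R fun z => fderiv ℂ f z (toC v) := by
  refine ⟨differentiableOn_fderiv_apply hU hf.holo _, fun p hp z hz => ?_, fun x hx hxU => ?_⟩
  · have h : (fun y => f (y + toC p)) =ᶠ[𝓝 z] f := by
      filter_upwards [hU.mem_nhds hz] with y hy using hf.per p hp y hy
    rw [← fderiv_comp_add_right, h.fderiv_eq]
  · refine im_fderiv_toC (hf.differentiableAt hU hxU) ?_ v
    filter_upwards [hR.mem_nhds hx, (hU.preimage continuous_toC).mem_nhds hxU] with y hy hyU
    exact hf.real y hy hyU

theorem partialD [DecidableEq ι] (hf : RealPeriodic U P R f) (hU : IsOpen U) (hR : IsOpen R)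
    (j : ι) : RealPeriodic U P R fun z => KAM.partialD ℂ j f z := by
  have := hf.fderiv_apply hU hR (Pi.single j 1)
  simp only [toC_single] at this
  exact this

variable {κ κ' κ'' : Type*}

theorem det [Fintype κ] [DecidableEq κ] {A : (ι → ℂ) → Matrix κ κ ℂ}
    (hA : ∀ i j, RealPeriodic U P R fun z => A z i j) :
    RealPeriodic U P R fun z => (A z).det := by
  simp only [Matrix.det_apply']
  refine sum fun σ _ => mul ?_ (prod fun i _ => hA _ _)
  simpa using const (U := U) (P := P) (R := R) ((Equiv.Perm.sign σ : ℤ) : ℝ)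

theorem matrix_mul [Fintype κ'] {A : (ι → ℂ) → Matrix κ κ' ℂ} {B : (ι → ℂ) → Matrix κ' κ'' ℂ}
    (hA : ∀ i j, RealPeriodic U P R fun z => A z i j)
    (hB : ∀ i j, RealPeriodic U P R fun z => B z i j) :
    ∀ i j, RealPeriodic U P R fun z => (A z * B z) i j := fun i j => by
  simp only [Matrix.mul_apply]
  exact sum fun l _ => (hA i l).mul (hB l j)

theorem mulVec [Fintype κ'] {A : (ι → ℂ) → Matrix κ κ' ℂ} {b : (ι → ℂ) → κ' → ℂ}
    (hA : ∀ i j, RealPeriodic U P R fun z => A z i j)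
    (hb : ∀ i, RealPeriodic U P R fun z => b z i) :
    ∀ i, RealPeriodic U P R fun z => (A z *ᵥ b z) i := fun i => by
  simp only [Matrix.mulVec, dotProduct]
  exact sum fun l _ => (hA i l).mul (hb l)

theorem matrix_inv [Fintype κ] [DecidableEq κ] {A : (ι → ℂ) → Matrix κ κ ℂ}
    (hA : ∀ i j, RealPeriodic U P R fun z => A z i j) (h : ∀ z ∈ U, IsUnit (A z)) :
    ∀ i j, RealPeriodic U P R fun z => (A z)⁻¹ i j := fun i j => by
  simp only [Matrix.inv_def, Ring.inverse_eq_inv', Matrix.smul_apply, smul_eq_mul,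
    Matrix.adjugate_apply]
  refine mul (inv (det hA) fun z hz => ?_) (det fun a b => ?_)
  · exact ((Matrix.isUnit_iff_isUnit_det _).1 (h z hz)).ne_zero
  · simp only [Matrix.updateRow_apply]
    by_cases haj : a = j
    · by_cases hbi : b = i
      · simpa [haj, hbi] using one
      · simpa [haj, hbi] using zero
    · simpa [haj] using hA a b

end RealPeriodic

end RealPeriodic

/-! ### Fourier coefficients on the torus -/

section Fourier

/-- The circle `ℝ/ℤ` carries its Haar probability measure. -/
noncomputable local instance : MeasureSpace UnitAddCircle := ⟨AddCircle.haarAddCircle⟩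

local instance : Measure.IsAddHaarMeasure (volume : Measure UnitAddCircle) :=
  inferInstanceAs (Measure.IsAddHaarMeasure AddCircle.haarAddCircle)

local instance : IsProbabilityMeasure (volume : Measure UnitAddCircle) :=
  inferInstanceAs (IsProbabilityMeasure AddCircle.haarAddCircle)

variable {n : ℕ}

/-- `ℤⁿ`-periodicity of a function on `ℝⁿ`. -/
def IsZPeriodic {E : Type*} (f : (Fin n → ℝ) → E) : Prop :=
  ∀ (k : Fin n → ℤ) (x : Fin n → ℝ), f (x + fun i => (k i : ℝ)) = f x

/-- `k · θ` for an integer vector `k`. -/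
def kdot (k : Fin n → ℤ) (θ : Fin n → ℂ) : ℂ := ∑ j, (k j : ℂ) * θ j

/-- The exponential `e^{2πi k·θ}`. -/
noncomputable def expk (k : Fin n → ℤ) (θ : Fin n → ℂ) : ℂ :=
  Complex.exp (2 * Real.pi * Complex.I * kdot k θ)

/-- Fourier coefficients over the unit cube. -/
noncomputable def fc (f : (Fin n → ℝ) → ℂ) (k : Fin n → ℤ) : ℂ :=
  ∫ x in Icc (0 : Fin n → ℝ) 1, expk (-k) (toC x) * f x

/-- The covering map `ℝⁿ → (ℝ/ℤ)ⁿ`. -/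
def torusMk (n : ℕ) : (Fin n → ℝ) → UnitAddTorus (Fin n) := Pi.map fun _ x => (x : UnitAddCircle)

theorem isOpenQuotientMap_torusMk : IsOpenQuotientMap (torusMk n) :=
  IsOpenQuotientMap.piMap fun _ => QuotientAddGroup.isOpenQuotientMap_mk

theorem torusMk_eq_iff {x y : Fin n → ℝ} (h : torusMk n x = torusMk n y) :
    ∃ k : Fin n → ℤ, y = x + fun i => (k i : ℝ) := by
  have h1 : ∀ i, ∃ k : ℤ, y i = x i + k := fun i => by
    have h2 : ((x i : ℝ) : UnitAddCircle) = (y i : ℝ) := congrFun h i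
    have h3 : ((y i - x i : ℝ) : UnitAddCircle) = 0 := by
      rw [AddCircle.coe_sub, h2, sub_self]
    obtain ⟨m, hm⟩ := (AddCircle.coe_eq_zero_iff 1).1 h3
    refine ⟨m, ?_⟩
    have h4 : (m : ℝ) = y i - x i := by simpa using hm
    linarith
  choose k hk using h1
  exact ⟨k, funext hk⟩

/-- A continuous periodic function descends to the torus. -/
theorem exists_torus_lift {f : (Fin n → ℝ) → ℂ} (hf : Continuous f) (hp : IsZPeriodic f) :
    ∃ g : C(UnitAddTorus (Fin n), ℂ), ∀ x, g (torusMk n x) = f x := by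
  have hfac : Function.FactorsThrough f (torusMk n) := fun x y h => by
    obtain ⟨k, rfl⟩ := torusMk_eq_iff h
    exact (hp k x).symm
  let π : C(Fin n → ℝ, UnitAddTorus (Fin n)) := ⟨torusMk n, isOpenQuotientMap_torusMk.continuous⟩
  have hπ : Topology.IsQuotientMap π := isOpenQuotientMap_torusMk.isQuotientMap
  exact ⟨hπ.lift ⟨f, hf⟩ hfac, fun x => congrArg (fun F => F x) (hπ.lift_comp ⟨f, hf⟩ hfac)⟩

theorem integral_torus {E : Type*} [NormedAddCommGroup E] [NormedSpace ℝ E]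
    (g : UnitAddTorus (Fin n) → E) :
    ∫ t, g t = ∫ x in Icc (0 : Fin n → ℝ) 1, g (torusMk n x) := by
  rw [UnitAddTorus.integral_preimage g 0]
  refine setIntegral_congr_set ?_
  have h : {x : Fin n → ℝ | ∀ i, x i ∈ Ioc ((0 : Fin n → ℝ) i) ((0 : Fin n → ℝ) i + 1)} =
      Set.pi univ fun i => Ioc ((0 : Fin n → ℝ) i) ((1 : Fin n → ℝ) i) := by
    ext x; simp
  rw [h]
  exact Measure.univ_pi_Ioc_ae_eq_Icc

theorem mFourier_torusMk (k : Fin n → ℤ) (x : Fin n → ℝ) :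
    UnitAddTorus.mFourier k (torusMk n x) = expk k (toC x) := by
  simp only [UnitAddTorus.mFourier, ContinuousMap.coe_mk, torusMk, Pi.map_apply,
    fourier_coe_apply, expk, kdot, Finset.mul_sum, Complex.exp_sum, toC]
  refine Finset.prod_congr rfl fun i _ => ?_
  congr 1
  push_cast
  ring

theorem fc_eq_mFourierCoeff {f : (Fin n → ℝ) → ℂ} {g : UnitAddTorus (Fin n) → ℂ}
    (h : ∀ x, g (torusMk n x) = f x) (k : Fin n → ℤ) :
    fc f k = UnitAddTorus.mFourierCoeff g k := by
  rw [UnitAddTorus.mFourierCoeff, integral_torus]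
  simp only [mFourier_torusMk, h, smul_eq_mul, fc]

/-- A continuous periodic function with summable Fourier coefficients is the sum of its Fourier
series. -/
theorem hasSum_fc {f : (Fin n → ℝ) → ℂ} (hf : Continuous f) (hp : IsZPeriodic f)
    (hs : Summable (fc f)) (x : Fin n → ℝ) :
    HasSum (fun k => fc f k * expk k (toC x)) (f x) := by
  obtain ⟨g, hg⟩ := exists_torus_lift hf hp
  have h1 : fc f = UnitAddTorus.mFourierCoeff g := funext (fc_eq_mFourierCoeff hg)
  have h2 := UnitAddTorus.hasSum_mFourier_series_apply_of_summable (f := g) (h1 ▸ hs)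
    (torusMk n x)
  simpa [mFourier_torusMk, hg, h1] using h2

theorem continuous_expk (k : Fin n → ℤ) : Continuous (expk k) := by
  unfold expk kdot; fun_prop

theorem differentiable_expk (k : Fin n → ℤ) : Differentiable ℂ (expk k) := by
  unfold expk kdot; fun_prop

theorem kdot_add (k : Fin n → ℤ) (θ τ : Fin n → ℂ) : kdot k (θ + τ) = kdot k θ + kdot k τ := by
  simp [kdot, mul_add, Finset.sum_add_distrib]

theorem expk_add (k : Fin n → ℤ) (θ τ : Fin n → ℂ) : expk k (θ + τ) = expk k θ * expk k τ := by
  simp only [expk, kdot_add, mul_add, Complex.exp_add]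

theorem expk_int (k m : Fin n → ℤ) : expk k (toC fun i => (m i : ℝ)) = 1 := by
  have h : kdot k (toC fun i => (m i : ℝ)) = ((∑ j, k j * m j : ℤ) : ℂ) := by
    simp [kdot, toC]
  rw [expk, h, mul_comm]
  exact Complex.exp_int_mul_two_pi_mul_I _

theorem isZPeriodic_expk_mul (k : Fin n → ℤ) {f : (Fin n → ℝ) → ℂ} (hp : IsZPeriodic f) :
    IsZPeriodic fun x => expk k (toC x) * f x := fun m x => by
  simp only [toC_add, expk_add, expk_int, hp m x, mul_one]

theorem integrableOn_cube {E : Type*} [NormedAddCommGroup E] {f : (Fin n → ℝ) → E}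
    (hf : Continuous f) : IntegrableOn f (Icc (0 : Fin n → ℝ) 1) :=
  hf.continuousOn.integrableOn_compact isCompact_Icc

theorem continuous_expk_mul (k : Fin n → ℤ) {f : (Fin n → ℝ) → ℂ} (hf : Continuous f) :
    Continuous fun x => expk k (toC x) * f x :=
  ((continuous_expk k).comp continuous_toC).mul hf

theorem fc_sub {f g : (Fin n → ℝ) → ℂ} (hf : Continuous f) (hg : Continuous g)
    (k : Fin n → ℤ) : fc (fun x => f x - g x) k = fc f k - fc g k := by
  simp only [fc, mul_sub]
  exact integral_sub (integrableOn_cube (continuous_expk_mul _ hf))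
    (integrableOn_cube (continuous_expk_mul _ hg))

theorem fc_const_mul (c : ℂ) (f : (Fin n → ℝ) → ℂ) (k : Fin n → ℤ) :
    fc (fun x => c * f x) k = c * fc f k := by
  simp only [fc, mul_left_comm _ c]
  exact integral_const_mul c _

theorem fc_sum {α : Type*} (s : Finset α) {f : α → (Fin n → ℝ) → ℂ}
    (hf : ∀ a ∈ s, Continuous (f a)) (k : Fin n → ℤ) :
    fc (fun x => ∑ a ∈ s, f a x) k = ∑ a ∈ s, fc (f a) k := by
  simp only [fc, Finset.mul_sum]
  exact integral_finsetSum s fun a ha => integrableOn_cube (continuous_expk_mul _ (hf a ha))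

theorem fc_zero_eq (f : (Fin n → ℝ) → ℂ) : fc f 0 = ∫ x in Icc (0 : Fin n → ℝ) 1, f x := by
  simp [fc, expk, kdot]

/-- A continuous periodic function is determined by its Fourier coefficients. -/
theorem eq_of_fc_eq {f g : (Fin n → ℝ) → ℂ} (hf : Continuous f) (hg : Continuous g)
    (hpf : IsZPeriodic f) (hpg : IsZPeriodic g) (h : ∀ k, fc f k = fc g k) (x : Fin n → ℝ) :
    f x = g x := by
  have h0 : fc (fun x => f x - g x) = fun _ => 0 := by
    funext k; rw [fc_sub hf hg, h k, sub_self]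
  have h1 := hasSum_fc (f := fun x => f x - g x) (hf.sub hg)
    (fun k x => by simp only [hpf k x, hpg k x]) (h0 ▸ summable_zero) x
  simp only [h0, zero_mul] at h1
  exact sub_eq_zero.1 (h1.unique hasSum_zero)

/-- Bessel's inequality. -/
theorem sum_norm_fc_sq_le {f : (Fin n → ℝ) → ℂ} (hf : Continuous f) (hp : IsZPeriodic f)
    {M : ℝ} (hM : ∀ x, ‖f x‖ ≤ M) (s : Finset (Fin n → ℤ)) :
    ∑ k ∈ s, ‖fc f k‖ ^ 2 ≤ M ^ 2 := by
  obtain ⟨g, hg⟩ := exists_torus_lift hf hp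
  have h1 := UnitAddTorus.hasSum_sq_mFourierCoeff (ContinuousMap.toLp 2 volume ℂ g)
  simp only [UnitAddTorus.mFourierCoeff_toLp, ← fc_eq_mFourierCoeff hg] at h1
  refine (sum_le_hasSum s (fun _ _ => by positivity) h1).trans ?_
  have h2 : ∀ t, ‖g t‖ ≤ M := fun t => by
    obtain ⟨x, rfl⟩ := isOpenQuotientMap_torusMk.surjective t
    rw [hg]; exact hM x
  have h3 : ∫ t, ‖(ContinuousMap.toLp 2 volume ℂ g) t‖ ^ 2 = ∫ t, ‖g t‖ ^ 2 := by
    refine integral_congr_ae ?_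
    filter_upwards [ContinuousMap.coeFn_toLp (p := 2) (𝕜 := ℂ) volume g] with t ht
    rw [ht]
  rw [h3]
  refine (integral_mono_of_nonneg (g := fun _ => M ^ 2)
    (Eventually.of_forall fun _ => by positivity)
    (integrable_const _) (Eventually.of_forall fun t => ?_)).trans ?_
  · exact pow_le_pow_left₀ (norm_nonneg _) (h2 t) 2
  · simp

theorem integral_translate {f : (Fin n → ℝ) → ℂ} (hf : Continuous f) (hp : IsZPeriodic f)
    (a : Fin n → ℝ) :
    ∫ x in Icc (0 : Fin n → ℝ) 1, f (x + a) = ∫ x in Icc (0 : Fin n → ℝ) 1, f x := by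
  obtain ⟨g, hg⟩ := exists_torus_lift hf hp
  have h1 : ∀ x, g (torusMk n x + torusMk n a) = f (x + a) := fun x => by
    rw [← hg]; congr 1
  simp only [← h1, ← hg]
  rw [← integral_torus fun t => g (t + torusMk n a), ← integral_torus fun t => g t]
  exact integral_add_right_eq_self (fun t => g t) (torusMk n a)

/-- The integral of a directional derivative of a periodic function vanishes: it is the derivative
of a constant integral over translates. -/
theorem integral_fderiv_eq_zero {f : (Fin n → ℝ) → ℂ} (hf : ContDiff ℝ 1 f) (hp : IsZPeriodic f)
    (v : Fin n → ℝ) : ∫ x in Icc (0 : Fin n → ℝ) 1, fderiv ℝ f x v = 0 := by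
  have hd : Differentiable ℝ f := hf.differentiable one_ne_zero
  have hc : Continuous fun x => fderiv ℝ f x v :=
    (hf.continuous_fderiv one_ne_zero).clm_apply continuous_const
  have hS : IsCompact (closedBall (0 : ℝ) 1 ×ˢ Icc (0 : Fin n → ℝ) 1) :=
    (isCompact_closedBall 0 1).prod isCompact_Icc
  obtain ⟨C, hC⟩ := hS.exists_bound_of_continuousOn
    (f := fun p : ℝ × (Fin n → ℝ) => fderiv ℝ f (p.2 + p.1 • v) v)
    (hc.comp (by fun_prop)).continuousOn
  have key := hasDerivAt_integral_of_dominated_loc_of_deriv_le (𝕜 := ℝ)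
    (μ := volume.restrict (Icc (0 : Fin n → ℝ) 1)) (x₀ := 0) (s := ball 0 1)
    (F := fun s x => f (x + s • v)) (F' := fun s x => fderiv ℝ f (x + s • v) v)
    (bound := fun _ => C) (ball_mem_nhds 0 one_pos)
    (Eventually.of_forall fun s => (hf.continuous.comp (by fun_prop)).aestronglyMeasurable)
    (integrableOn_cube (hf.continuous.comp (by fun_prop)))
    (hc.comp (by fun_prop)).aestronglyMeasurable
    (by
      filter_upwards [ae_restrict_mem measurableSet_Icc] with x hx s hs
      exact hC (s, x) ⟨ball_subset_closedBall hs, hx⟩)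
    (integrableOn_const (isCompact_Icc.measure_lt_top.ne))
    (Eventually.of_forall fun x s _ => by
      have h1 : HasDerivAt (fun s : ℝ => x + s • v) v s := by
        simpa using ((hasDerivAt_id s).smul_const v).const_add x
      exact (hd (x + s • v)).hasFDerivAt.comp_hasDerivAt s h1)
  have h2 : HasDerivAt (fun s : ℝ => ∫ x in Icc (0 : Fin n → ℝ) 1, f (x + s • v)) 0 0 := by
    simp only [integral_translate hf.continuous hp]
    exact hasDerivAt_const _ _
  simpa using key.2.unique h2

theorem hasFDerivAt_expk (k : Fin n → ℤ) (θ : Fin n → ℂ) :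
    HasFDerivAt (expk k) ((2 * Real.pi * Complex.I * expk k θ) •
      ∑ j, (k j : ℂ) • (ContinuousLinearMap.proj j : (Fin n → ℂ) →L[ℂ] ℂ)) θ := by
  have h1 : HasFDerivAt (kdot k)
      (∑ j, (k j : ℂ) • (ContinuousLinearMap.proj j : (Fin n → ℂ) →L[ℂ] ℂ)) θ := by
    have h2 : kdot k =
        ⇑(∑ j, (k j : ℂ) • (ContinuousLinearMap.proj j : (Fin n → ℂ) →L[ℂ] ℂ)) := by
      funext θ; simp [kdot]
    rw [h2]
    exact ContinuousLinearMap.hasFDerivAt _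
  have h3 := (h1.const_mul (2 * Real.pi * Complex.I : ℂ)).cexp
  refine h3.congr_fderiv ?_
  rw [smul_smul, expk, mul_comm]

theorem fderiv_expk_apply (k : Fin n → ℤ) (θ v : Fin n → ℂ) :
    fderiv ℂ (expk k) θ v = 2 * Real.pi * Complex.I * kdot k v * expk k θ := by
  rw [(hasFDerivAt_expk k θ).fderiv]
  simp [kdot]
  ring

theorem contDiff_expk_toC (k : Fin n → ℤ) : ContDiff ℝ 1 fun x => expk k (toC x) := by
  unfold expk kdot toC
  have : ContDiff ℝ 1 fun t : ℝ => (t : ℂ) := Complex.ofRealCLM.contDiff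
  fun_prop

/-- Differentiation multiplies the Fourier coefficients by `2πi k·v`. -/
theorem fc_fderiv {f : (Fin n → ℝ) → ℂ} (hf : ContDiff ℝ 1 f) (hp : IsZPeriodic f)
    (v : Fin n → ℝ) (k : Fin n → ℤ) :
    fc (fun x => fderiv ℝ f x v) k = 2 * Real.pi * Complex.I * kdot k (toC v) * fc f k := by
  have hd : Differentiable ℝ f := hf.differentiable one_ne_zero
  have h1 := integral_fderiv_eq_zero ((contDiff_expk_toC (-k)).mul hf)
    (isZPeriodic_expk_mul (-k) hp) v
  have h2 : ∀ x, fderiv ℝ (fun x => expk (-k) (toC x) * f x) x v =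
      expk (-k) (toC x) * fderiv ℝ f x v -
        2 * Real.pi * Complex.I * kdot k (toC v) * (expk (-k) (toC x) * f x) := fun x => by
    have h3 : HasFDerivAt (fun x => expk (-k) (toC x))
        (((fderiv ℂ (expk (-k)) (toC x)).restrictScalars ℝ).comp (toCL (Fin n))) x :=
      (((differentiable_expk (-k)) _).hasFDerivAt.restrictScalars ℝ).comp x
        (toCL (Fin n)).hasFDerivAt
    have h4 : HasFDerivAt (fun x => expk (-k) (toC x) * f x) _ x := h3.mul (hd x).hasFDerivAt
    have h5 : kdot (-k) (toC v) = -kdot k (toC v) := by simp [kdot]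
    rw [h4.fderiv]
    simp [fderiv_expk_apply, h5]
    ring
  simp only [h2] at h1
  rw [integral_sub, integral_const_mul] at h1
  · exact sub_eq_zero.1 h1
  · exact integrableOn_cube (continuous_expk_mul _
      ((hf.continuous_fderiv one_ne_zero).clm_apply continuous_const))
  · exact integrableOn_cube (continuous_const.mul (continuous_expk_mul _ hf.continuous))

/-- The lattice of periods of the functions on the torus. -/
def intPeriods (n : ℕ) : Set (Fin n → ℝ) := range fun (k : Fin n → ℤ) i => (k i : ℝ)

/-- Holomorphic functions on the strip of width `ρ` that are one-periodic and real at real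
points. -/
abbrev StripFun (n : ℕ) (ρ : ℝ) (f : (Fin n → ℂ) → ℂ) : Prop :=
  RealPeriodic (strip n ρ) (intPeriods n) univ f

variable {ρ : ℝ} {f : (Fin n → ℂ) → ℂ}

theorem add_smul_mem_strip {y : Fin n → ℝ} (hy : ∀ j, |y j| < ρ) (x : Fin n → ℝ) :
    toC x + Complex.I • toC y ∈ strip n ρ := fun j => by
  simpa [toC] using hy j

theorem StripFun.isZPeriodic (hf : StripFun n ρ f) {y : Fin n → ℝ} (hy : ∀ j, |y j| < ρ) :
    IsZPeriodic fun x => f (toC x + Complex.I • toC y) := fun k x => by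
  have := hf.per _ ⟨k, rfl⟩ _ (add_smul_mem_strip hy x)
  simp only [toC_add]
  rw [← this, add_right_comm]

theorem StripFun.continuous (hf : StripFun n ρ f) {y : Fin n → ℝ} (hy : ∀ j, |y j| < ρ) :
    Continuous fun x => f (toC x + Complex.I • toC y) :=
  hf.holo.continuousOn.comp_continuous (continuous_toC.add continuous_const)
    (add_smul_mem_strip hy)

theorem StripFun.isZPeriodic_real (hf : StripFun n ρ f) (hρ : 0 < ρ) :
    IsZPeriodic fun x => f (toC x) := by
  simpa [toC_zero] using StripFun.isZPeriodic hf (y := 0) (by simpa using fun _ => hρ)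

theorem StripFun.continuous_real (hf : StripFun n ρ f) (hρ : 0 < ρ) :
    Continuous fun x => f (toC x) := by
  simpa [toC_zero] using StripFun.continuous hf (y := 0) (by simpa using fun _ => hρ)

/-- Shift of the contour of integration: the Fourier coefficients along `x + iy` are those along
the real torus times `e^{-2πk·y}`. -/
theorem StripFun.fc_shift (hf : StripFun n ρ f) (hρ : 0 < ρ) {y : Fin n → ℝ}
    (hy : ∀ j, |y j| < ρ) (k : Fin n → ℤ) :
    fc (fun x => f (toC x + Complex.I • toC y)) k =
      fc (fun x => f (toC x)) k * Real.exp (-(2 * Real.pi * ∑ j, (k j : ℝ) * y j)) := by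
  set G : (Fin n → ℂ) → ℂ := fun θ => expk (-k) θ * f θ with hG
  have hGd : DifferentiableOn ℂ G (strip n ρ) :=
    (differentiable_expk (-k)).differentiableOn.mul hf.holo
  set J : (Fin n → ℂ) → ℂ := fun θ => ∫ x in Icc (0 : Fin n → ℝ) 1, G (θ + toC x) with hJ
  have hJd : DifferentiableOn ℂ J (strip n ρ) := fun θ hθ => by
    have := differentiableAt_setIntegral_translate (μ := (volume : Measure (Fin n → ℝ)))
      (isCompact_Icc (a := (0 : Fin n → ℝ)) (b := 1)) measurableSet_Icc
      (w := fun _ => 1) (γ := toC) continuous_const continuous_toC isOpen_strip hGd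
      (z := θ) fun x _ => add_toC_mem_strip hθ x
    simp only [one_mul] at this
    exact this.differentiableWithinAt
  have hreal : ∀ a : Fin n → ℝ, J (toC a) = J 0 := fun a => by
    simp only [hJ, ← toC_add, zero_add, add_comm a]
    exact integral_translate (continuous_expk_mul (-k) (StripFun.continuous_real hf hρ))
      (isZPeriodic_expk_mul (-k) (StripFun.isZPeriodic_real hf hρ)) a
  have hIy : Complex.I • toC y ∈ strip n ρ := by
    simpa [toC_zero] using add_smul_mem_strip hy 0
  have h1 : J (Complex.I • toC y) = J 0 :=
    eqOn_strip_of_real hJd (differentiableOn_const (J 0)) hreal hIy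
  have h2 : J 0 = fc (fun x => f (toC x)) k := by simp [hJ, hG, fc]
  have h3 : J (Complex.I • toC y) =
      expk (-k) (Complex.I • toC y) * fc (fun x => f (toC x + Complex.I • toC y)) k := by
    simp only [hJ, hG, fc, expk_add]
    rw [← integral_const_mul]
    refine integral_congr_ae (Eventually.of_forall fun x => ?_)
    simp only [add_comm (toC x)]
    ring
  have h4 : expk (-k) (Complex.I • toC y) =
      (Real.exp (2 * Real.pi * ∑ j, (k j : ℝ) * y j) : ℝ) := by
    rw [expk, Complex.ofReal_exp]
    congr 1
    push_cast
    simp only [kdot, toC, Pi.neg_apply, Pi.smul_apply, smul_eq_mul, Finset.mul_sum]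
    refine Finset.sum_congr rfl fun j _ => ?_
    push_cast
    linear_combination (-2 * Real.pi * k j * y j : ℂ) * Complex.I_sq
  rw [← h2, ← h1, h3, h4, mul_comm, ← mul_assoc, ← Complex.ofReal_mul, ← Real.exp_add,
    neg_add_cancel, Real.exp_zero, Complex.ofReal_one, one_mul]

end Fourier

/-! ### Sums of inverse small divisors -/

section SmallDivisors

variable {n : ℕ}

/-- The `ℓ¹` norm of an integer vector. -/
def norm1 (k : Fin n → ℤ) : ℝ := ∑ j, |(k j : ℝ)|

/-- The small divisor `k · ω`. -/
def divisor (ω : Fin n → ℝ) (k : Fin n → ℤ) : ℝ := ∑ j, (k j : ℝ) * ω j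

theorem norm1_nonneg (k : Fin n → ℤ) : 0 ≤ norm1 k := Finset.sum_nonneg fun _ _ => abs_nonneg _

theorem norm1_pos {k : Fin n → ℤ} (hk : k ≠ 0) : 0 < norm1 k := by
  obtain ⟨j, hj⟩ := Function.ne_iff.1 hk
  exact Finset.sum_pos' (fun _ _ => abs_nonneg _) ⟨j, Finset.mem_univ j, by simpa using hj⟩

theorem norm1_sub_le (k m : Fin n → ℤ) : norm1 (k - m) ≤ norm1 k + norm1 m := by
  simp only [norm1, ← Finset.sum_add_distrib]
  refine Finset.sum_le_sum fun j _ => ?_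
  simpa using abs_sub (k j : ℝ) (m j)

theorem divisor_sub (ω : Fin n → ℝ) (k m : Fin n → ℤ) :
    divisor ω (k - m) = divisor ω k - divisor ω m := by
  simp [divisor, sub_mul]

theorem divisor_zero (ω : Fin n → ℝ) : divisor ω 0 = 0 := by simp [divisor]

theorem kdot_toC (ω : Fin n → ℝ) (k : Fin n → ℤ) : kdot k (toC ω) = (divisor ω k : ℂ) := by
  simp [kdot, divisor, toC]

variable {γ σ : ℝ} {ω : Fin n → ℝ}

theorem divisor_lower_bound (hω : IsDiophantine γ σ ω) (hγ : 0 < γ) (hσ : 0 < σ)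
    {k : Fin n → ℤ} (hk : k ≠ 0) {t : ℝ} (ht : norm1 k ≤ t) :
    γ * t ^ (-σ) ≤ |divisor ω k| := by
  refine le_trans ?_ (hω k hk)
  exact mul_le_mul_of_nonneg_left
    (Real.rpow_le_rpow_of_nonpos (norm1_pos hk) ht (by linarith)) hγ.le

theorem divisor_ne_zero (hω : IsDiophantine γ σ ω) (hγ : 0 < γ) {k : Fin n → ℤ} (hk : k ≠ 0) :
    divisor ω k ≠ 0 := by
  have h := hω k hk
  have h1 : 0 < γ * norm1 k ^ (-σ) := mul_pos hγ (Real.rpow_pos_of_pos (norm1_pos hk) _)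
  exact abs_pos.1 (h1.trans_le h)

/-- The small divisors with `|k|₁ ≤ t` are separated from each other and from zero by
`γ (2t)^{-σ}`; so the sum of their inverse squares is at most a multiple of `∑ j⁻²` times the
inverse square of that distance. -/
theorem sum_inv_divisor_sq_le (hω : IsDiophantine γ σ ω) (hγ : 0 < γ) (hσ : 0 < σ) {t : ℝ}
    (ht : 0 < t) (F : Finset (Fin n → ℤ)) (hF : ∀ k ∈ F, k ≠ 0 ∧ norm1 k ≤ t) :
    ∑ k ∈ F, (divisor ω k ^ 2)⁻¹ ≤
      4 * (∑' j : ℤ, 1 / (j : ℝ) ^ 2) * (γ⁻¹ * (2 * t) ^ σ) ^ 2 := by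
  set h : ℝ := γ * (2 * t) ^ (-σ) with hh
  have h0 : 0 < h := mul_pos hγ (Real.rpow_pos_of_pos (by positivity) _)
  have hinv : h⁻¹ = γ⁻¹ * (2 * t) ^ σ := by
    rw [hh, mul_inv, Real.rpow_neg (by positivity), inv_inv]
  set a : (Fin n → ℤ) → ℝ := fun k => divisor ω k / h with ha
  have ha1 : ∀ k ∈ F, 1 ≤ |a k| := fun k hk => by
    rw [ha]
    simp only [abs_div, abs_of_pos h0]
    rw [le_div_iff₀ h0, one_mul]
    exact divisor_lower_bound hω hγ hσ (hF k hk).1 (by linarith [(hF k hk).2])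
  have hinj : Set.InjOn (fun k => ⌊a k⌋) F := by
    intro k hk m hm hkm
    by_contra hne
    have h1 : |a k - a m| < 1 := Int.abs_sub_lt_one_of_floor_eq_floor hkm
    have h2 : h ≤ |divisor ω (k - m)| := divisor_lower_bound hω hγ hσ (sub_ne_zero.2 hne)
      (by linarith [norm1_sub_le k m, (hF k hk).2, (hF m hm).2])
    rw [divisor_sub] at h2
    rw [ha] at h1
    simp only [← sub_div, abs_div, abs_of_pos h0] at h1
    rw [div_lt_one h0] at h1
    linarith
  have hterm : ∀ k ∈ F, (divisor ω k ^ 2)⁻¹ ≤ 4 * (h⁻¹) ^ 2 * (1 / ((⌊a k⌋ : ℤ) : ℝ) ^ 2) := by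
    intro k hk
    have h1 := ha1 k hk
    have hfl := Int.floor_le (a k)
    have hfl' := Int.lt_floor_add_one (a k)
    have hj : (⌊a k⌋ : ℤ) ≠ 0 := by
      intro h2
      rw [h2] at hfl hfl'
      simp only [Int.cast_zero, zero_add] at hfl hfl'
      rw [abs_of_nonneg hfl] at h1
      linarith
    have hj2 : 0 < ((⌊a k⌋ : ℤ) : ℝ) ^ 2 := by positivity
    have hle : ((⌊a k⌋ : ℤ) : ℝ) ^ 2 ≤ 4 * a k ^ 2 := by
      have h3 : |((⌊a k⌋ : ℤ) : ℝ)| ≤ 2 * |a k| := by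
        have h4 := abs_sub_abs_le_abs_sub ((⌊a k⌋ : ℤ) : ℝ) (a k)
        have h5 : |((⌊a k⌋ : ℤ) : ℝ) - a k| ≤ 1 := abs_le.2 ⟨by linarith, by linarith⟩
        linarith
      calc ((⌊a k⌋ : ℤ) : ℝ) ^ 2 = |((⌊a k⌋ : ℤ) : ℝ)| ^ 2 := (sq_abs _).symm
        _ ≤ (2 * |a k|) ^ 2 := pow_le_pow_left₀ (abs_nonneg _) h3 2
        _ = 4 * a k ^ 2 := by rw [mul_pow, sq_abs]; norm_num
    have hd : divisor ω k = h * a k := by simp only [ha]; field_simp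
    have ha2 : 0 < a k ^ 2 := by
      have : 0 < |a k| := by linarith
      rw [← sq_abs]
      positivity
    rw [hd, mul_pow, mul_inv, one_div, inv_pow, mul_comm 4, mul_assoc]
    refine mul_le_mul_of_nonneg_left ?_ (by positivity)
    rw [← div_eq_mul_inv, le_div_iff₀ hj2, inv_mul_le_iff₀ ha2]
    linarith
  have hsum : ∑ k ∈ F, 1 / ((⌊a k⌋ : ℤ) : ℝ) ^ 2 ≤ ∑' j : ℤ, 1 / (j : ℝ) ^ 2 := by
    rw [← Finset.sum_image (f := fun j : ℤ => 1 / (j : ℝ) ^ 2) hinj]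
    exact (Real.summable_one_div_int_pow.2 one_lt_two).sum_le_tsum _ fun _ _ => by positivity
  calc ∑ k ∈ F, (divisor ω k ^ 2)⁻¹
      ≤ ∑ k ∈ F, 4 * (h⁻¹) ^ 2 * (1 / ((⌊a k⌋ : ℤ) : ℝ) ^ 2) := Finset.sum_le_sum hterm
    _ = 4 * (h⁻¹) ^ 2 * ∑ k ∈ F, 1 / ((⌊a k⌋ : ℤ) : ℝ) ^ 2 := by rw [Finset.mul_sum]
    _ ≤ 4 * (h⁻¹) ^ 2 * ∑' j : ℤ, 1 / (j : ℝ) ^ 2 :=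
        mul_le_mul_of_nonneg_left hsum (by positivity)
    _ = _ := by rw [hinv]; ring

theorem summable_block_weights (σ : ℝ) :
    Summable fun b : ℕ => ((b : ℝ) ^ σ) ^ 2 * Real.exp (-(4 * Real.pi * ((b : ℝ) - 1))) := by
  have h1 := (Real.summable_pow_mul_exp_neg_nat_mul (2 * ⌈|σ|⌉₊)
    (r := 4 * Real.pi) (by positivity)).mul_left (Real.exp (4 * Real.pi))
  refine Summable.of_norm_bounded_eventually_nat h1 ?_
  filter_upwards [eventually_ge_atTop 1] with b hb
  have hb' : (1 : ℝ) ≤ b := by exact_mod_cast hb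
  have h2 : (b : ℝ) ^ σ ≤ (b : ℝ) ^ ⌈|σ|⌉₊ := by
    rw [← Real.rpow_natCast]
    exact Real.rpow_le_rpow_of_exponent_le hb' ((le_abs_self σ).trans (Nat.le_ceil _))
  have h3 : Real.exp (-(4 * Real.pi * ((b : ℝ) - 1))) =
      Real.exp (4 * Real.pi) * Real.exp (-(4 * Real.pi) * b) := by
    rw [← Real.exp_add]; congr 1; ring
  rw [Real.norm_of_nonneg (by positivity), h3, mul_comm 2, pow_mul]
  have h4 : ((b : ℝ) ^ σ) ^ 2 ≤ ((b : ℝ) ^ ⌈|σ|⌉₊) ^ 2 :=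
    pow_le_pow_left₀ (by positivity) h2 2
  have h5 := mul_le_mul_of_nonneg_right h4
    (by positivity : 0 ≤ Real.exp (4 * Real.pi) * Real.exp (-(4 * Real.pi) * b))
  linarith

/-- Rüssmann's bound for the exponentially weighted inverse squares of the small divisors.  The
integer vectors are grouped into the blocks `b - 1 < δ|k|₁ ≤ b`, on each of which the exponential
is comparable to `e^{-4πb}`; this gives the exponent `-2σ` of `δ` without any loss. -/
theorem exists_sum_inv_divisor_sq_exp_le (n : ℕ) {σ : ℝ} (hσ : 0 < σ) :
    ∃ c : ℝ, 0 ≤ c ∧ ∀ (γ : ℝ), 0 < γ → ∀ ω : Fin n → ℝ, IsDiophantine γ σ ω →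
      ∀ δ : ℝ, 0 < δ → ∀ F : Finset (Fin n → ℤ),
      ∑ k ∈ F, (divisor ω k ^ 2)⁻¹ * Real.exp (-(4 * Real.pi * (δ * norm1 k))) ≤
        c * (γ⁻¹ * δ ^ (-σ)) ^ 2 := by
  set Z : ℝ := ∑' j : ℤ, 1 / (j : ℝ) ^ 2 with hZ
  have hZ0 : 0 ≤ Z := tsum_nonneg fun _ => by positivity
  set W : ℝ := ∑' b : ℕ, ((b : ℝ) ^ σ) ^ 2 * Real.exp (-(4 * Real.pi * ((b : ℝ) - 1))) with hW
  have hW0 : 0 ≤ W := tsum_nonneg fun _ => by positivity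
  refine ⟨4 * Z * (2 ^ σ) ^ 2 * W, by positivity, fun γ hγ ω hω δ hδ F => ?_⟩
  have hF0 : ∑ k ∈ F, (divisor ω k ^ 2)⁻¹ * Real.exp (-(4 * Real.pi * (δ * norm1 k))) =
      ∑ k ∈ F.filter (· ≠ 0),
        (divisor ω k ^ 2)⁻¹ * Real.exp (-(4 * Real.pi * (δ * norm1 k))) := by
    refine (Finset.sum_filter_of_ne fun k _ hk => ?_).symm
    rintro rfl
    simp [divisor_zero] at hk
  rw [hF0]
  set F' := F.filter (· ≠ 0) with hF'
  set b : (Fin n → ℤ) → ℕ := fun k => ⌈δ * norm1 k⌉₊ with hb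
  rw [← Finset.sum_fiberwise_of_maps_to (t := F'.image b) (g := b)
    fun k hk => Finset.mem_image_of_mem b hk]
  have hblock : ∀ m ∈ F'.image b,
      ∑ k ∈ F'.filter (fun k => b k = m),
        (divisor ω k ^ 2)⁻¹ * Real.exp (-(4 * Real.pi * (δ * norm1 k))) ≤
      4 * Z * (2 ^ σ) ^ 2 * (γ⁻¹ * δ ^ (-σ)) ^ 2 *
        (((m : ℝ) ^ σ) ^ 2 * Real.exp (-(4 * Real.pi * ((m : ℝ) - 1)))) := by
    intro m hm
    obtain ⟨k₀, hk₀, hk₀m⟩ := Finset.mem_image.1 hm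
    have hm0 : (0 : ℝ) < m := by
      have h1 : 0 < δ * norm1 k₀ := mul_pos hδ (norm1_pos (Finset.mem_filter.1 hk₀).2)
      have h2 : δ * norm1 k₀ ≤ b k₀ := Nat.le_ceil _
      rw [hk₀m] at h2
      linarith
    have h1 : ∀ k ∈ F'.filter (fun k => b k = m),
        (divisor ω k ^ 2)⁻¹ * Real.exp (-(4 * Real.pi * (δ * norm1 k))) ≤
        (divisor ω k ^ 2)⁻¹ * Real.exp (-(4 * Real.pi * ((m : ℝ) - 1))) := by
      intro k hk
      refine mul_le_mul_of_nonneg_left (Real.exp_le_exp.2 ?_) (by positivity)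
      have h2 : (b k : ℝ) < δ * norm1 k + 1 :=
        Nat.ceil_lt_add_one (mul_nonneg hδ.le (norm1_nonneg k))
      rw [(Finset.mem_filter.1 hk).2] at h2
      have h3 : (m : ℝ) - 1 ≤ δ * norm1 k := by linarith
      exact neg_le_neg (mul_le_mul_of_nonneg_left h3 (by positivity))
    refine (Finset.sum_le_sum h1).trans ?_
    rw [← Finset.sum_mul]
    have h4 := sum_inv_divisor_sq_le hω hγ hσ (t := m / δ) (by positivity)
      (F'.filter (fun k => b k = m)) fun k hk => by
        obtain ⟨hk1, hk2⟩ := Finset.mem_filter.1 hk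
        refine ⟨(Finset.mem_filter.1 hk1).2, ?_⟩
        rw [le_div_iff₀ hδ, mul_comm, ← hk2]
        exact Nat.le_ceil _
    have h5 : (2 * ((m : ℝ) / δ)) ^ σ = 2 ^ σ * (m : ℝ) ^ σ * δ ^ (-σ) := by
      rw [Real.mul_rpow (by norm_num) (by positivity), Real.div_rpow hm0.le hδ.le,
        Real.rpow_neg hδ.le]
      ring
    rw [h5] at h4
    calc _ ≤ 4 * Z * (γ⁻¹ * (2 ^ σ * (m : ℝ) ^ σ * δ ^ (-σ))) ^ 2 *
          Real.exp (-(4 * Real.pi * ((m : ℝ) - 1))) :=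
          mul_le_mul_of_nonneg_right h4 (Real.exp_pos _).le
      _ = _ := by ring
  refine (Finset.sum_le_sum hblock).trans ?_
  rw [← Finset.mul_sum]
  have h6 := (summable_block_weights σ).sum_le_tsum (F'.image b) fun _ _ => by positivity
  calc _ ≤ 4 * Z * (2 ^ σ) ^ 2 * (γ⁻¹ * δ ^ (-σ)) ^ 2 * W :=
        mul_le_mul_of_nonneg_left h6 (by positivity)
    _ = _ := by ring

end SmallDivisors

/-! ### The small divisor equation -/

section Russmann

variable {n : ℕ} {ρ : ℝ} {f : (Fin n → ℂ) → ℂ}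

/-- Bessel's inequality on the torus shifted by `±ir` in every variable; the sum over all choices
of signs bounds the Fourier coefficients weighted with `e^{4πr|k|₁}`. -/
theorem StripFun.sum_fc_sq_exp_lt (hf : StripFun n ρ f) {r M : ℝ} (hr : 0 ≤ r) (hrρ : r < ρ)
    (hM : ∀ θ ∈ strip n ρ, ‖f θ‖ ≤ M) (F : Finset (Fin n → ℤ)) :
    ∑ k ∈ F, ‖fc (fun x => f (toC x)) k‖ ^ 2 * Real.exp (4 * Real.pi * (r * norm1 k)) ≤
      2 ^ n * M ^ 2 := by
  have hρ : 0 < ρ := hr.trans_lt hrρ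
  set Y : (Fin n → Bool) → Fin n → ℝ := fun s j => if s j then r else -r with hY
  have hYρ : ∀ s j, |Y s j| < ρ := fun s j => by
    simp only [hY]
    split_ifs
    · rwa [abs_of_nonneg hr]
    · rwa [abs_neg, abs_of_nonneg hr]
  have h1 : ∀ k, ‖fc (fun x => f (toC x)) k‖ ^ 2 * Real.exp (4 * Real.pi * (r * norm1 k)) ≤
      ∑ s, ‖fc (fun x => f (toC x + Complex.I • toC (Y s))) k‖ ^ 2 := by
    intro k
    set s : Fin n → Bool := fun j => decide (k j < 0) with hs
    have h2 : ∑ j, (k j : ℝ) * Y s j = -(r * norm1 k) := by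
      rw [norm1, Finset.mul_sum, ← Finset.sum_neg_distrib]
      refine Finset.sum_congr rfl fun j _ => ?_
      simp only [hY, hs, decide_eq_true_eq]
      by_cases hk : k j < 0
      · have : (k j : ℝ) < 0 := by exact_mod_cast hk
        rw [if_pos hk, abs_of_neg this]; ring
      · have : (0 : ℝ) ≤ k j := by exact_mod_cast not_lt.1 hk
        rw [if_neg hk, abs_of_nonneg this]; ring
    refine le_trans (le_of_eq ?_) (Finset.single_le_sum
      (f := fun s => ‖fc (fun x => f (toC x + Complex.I • toC (Y s))) k‖ ^ 2)
      (fun _ _ => by positivity) (Finset.mem_univ s))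
    rw [StripFun.fc_shift hf hρ (hYρ s) k, h2, norm_mul, mul_pow, Complex.norm_real,
      Real.norm_of_nonneg (Real.exp_pos _).le, ← Real.exp_nat_mul]
    congr 2
    push_cast
    ring
  calc _ ≤ ∑ k ∈ F, ∑ s, ‖fc (fun x => f (toC x + Complex.I • toC (Y s))) k‖ ^ 2 :=
        Finset.sum_le_sum fun k _ => h1 k
    _ = ∑ s, ∑ k ∈ F, ‖fc (fun x => f (toC x + Complex.I • toC (Y s))) k‖ ^ 2 :=
        Finset.sum_comm
    _ ≤ ∑ s : Fin n → Bool, M ^ 2 := Finset.sum_le_sum fun s _ =>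
        sum_norm_fc_sq_le (StripFun.continuous hf (hYρ s)) (StripFun.isZPeriodic hf (hYρ s))
          (fun x => hM _ (add_smul_mem_strip (hYρ s) x)) F
    _ = 2 ^ n * M ^ 2 := by simp

theorem StripFun.sum_fc_sq_exp_le (hf : StripFun n ρ f) {r M : ℝ} (hr : 0 < r) (hrρ : r ≤ ρ)
    (hM : ∀ θ ∈ strip n r, ‖f θ‖ ≤ M) (F : Finset (Fin n → ℤ)) :
    ∑ k ∈ F, ‖fc (fun x => f (toC x)) k‖ ^ 2 * Real.exp (4 * Real.pi * (r * norm1 k)) ≤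
      2 ^ n * M ^ 2 := by
  have hc : Continuous fun s : ℝ => ∑ k ∈ F,
      ‖fc (fun x => f (toC x)) k‖ ^ 2 * Real.exp (4 * Real.pi * (s * norm1 k)) := by fun_prop
  refine le_of_tendsto (hc.continuousWithinAt (s := Iio r) (x := r)) ?_
  filter_upwards [Ioo_mem_nhdsLT hr] with s hs
  exact StripFun.sum_fc_sq_exp_lt (ρ := r) (hf.mono (strip_mono hrρ)) hs.1.le hs.2 hM F

/-- The Fourier coefficients of the solution of `∂_ω u = f`.  The coefficient at `k = 0` is `0`
because of the convention `x / 0 = 0`. -/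
noncomputable def solCoeff (ω : Fin n → ℝ) (f : (Fin n → ℂ) → ℂ) (k : Fin n → ℤ) : ℂ :=
  fc (fun x => f (toC x)) k / (2 * Real.pi * Complex.I * divisor ω k)

/-- The solution `u = ∑ u_k e^{2πi k·θ}` of `∂_ω u = f` with average zero. -/
noncomputable def sol (ω : Fin n → ℝ) (f : (Fin n → ℂ) → ℂ) (θ : Fin n → ℂ) : ℂ :=
  ∑' k, solCoeff ω f k * expk k θ

theorem norm_expk_le (k : Fin n → ℤ) {θ : Fin n → ℂ} {r : ℝ} (hθ : θ ∈ strip n r) :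
    ‖expk k θ‖ ≤ Real.exp (2 * Real.pi * (r * norm1 k)) := by
  have h1 : (2 * Real.pi * Complex.I * kdot k θ).re =
      2 * Real.pi * -∑ j, (k j : ℝ) * (θ j).im := by
    simp [kdot, mul_assoc]
  rw [expk, Complex.norm_exp, h1]
  refine Real.exp_le_exp.2 (mul_le_mul_of_nonneg_left ?_ (by positivity))
  rw [norm1, Finset.mul_sum, ← Finset.sum_neg_distrib]
  refine Finset.sum_le_sum fun j _ => ?_
  have h2 : |(k j : ℝ) * (θ j).im| ≤ r * |(k j : ℝ)| := by
    rw [abs_mul, mul_comm]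
    exact mul_le_mul_of_nonneg_right (hθ j).le (abs_nonneg _)
  exact (neg_le_abs _).trans h2

theorem norm_solCoeff (ω : Fin n → ℝ) (f : (Fin n → ℂ) → ℂ) (k : Fin n → ℤ) :
    ‖solCoeff ω f k‖ = (2 * Real.pi)⁻¹ * (‖fc (fun x => f (toC x)) k‖ * |divisor ω k|⁻¹) := by
  rw [solCoeff, norm_div]
  simp only [norm_mul, Complex.norm_I, Complex.norm_real, Complex.norm_ofNat, mul_one,
    Real.norm_eq_abs, abs_of_pos Real.pi_pos]
  rw [div_eq_mul_inv, mul_inv]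
  ring

/-- Rüssmann's estimate: Cauchy–Schwarz combines the square-summability of the Fourier
coefficients on the strip with the weighted sum of the inverse squares of the small divisors. -/
theorem exists_sum_solCoeff_le (n : ℕ) {σ : ℝ} (hσ : 0 < σ) :
    ∃ c : ℝ, 1 ≤ c ∧ ∀ (γ : ℝ), 0 < γ → ∀ ω : Fin n → ℝ, IsDiophantine γ σ ω →
      ∀ (ρ : ℝ) (f : (Fin n → ℂ) → ℂ), StripFun n ρ f →
      ∀ r δ M : ℝ, r ≤ ρ → 0 < δ → δ < r → (∀ θ ∈ strip n r, ‖f θ‖ ≤ M) →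
      ∀ F : Finset (Fin n → ℤ),
      ∑ k ∈ F, ‖solCoeff ω f k‖ * Real.exp (2 * Real.pi * ((r - δ) * norm1 k)) ≤
        c * γ⁻¹ * δ ^ (-σ) * M := by
  obtain ⟨c, hc0, hc⟩ := exists_sum_inv_divisor_sq_exp_le n hσ
  refine ⟨Real.sqrt (2 ^ n * c) + 1, by linarith [Real.sqrt_nonneg (2 ^ n * c)],
    fun γ hγ ω hω ρ f hf r δ M hrρ hδ hδr hM F => ?_⟩
  have hr : 0 < r := hδ.trans hδr
  have hM0 : 0 ≤ M := (norm_nonneg _).trans (hM _ (toC_mem_strip hr 0))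
  have h1 := StripFun.sum_fc_sq_exp_le hf hr hrρ hM F
  have h2 := hc γ hγ ω hω δ hδ F
  set a : (Fin n → ℤ) → ℝ := fun k =>
    ‖fc (fun x => f (toC x)) k‖ * Real.exp (2 * Real.pi * (r * norm1 k)) with ha
  set b : (Fin n → ℤ) → ℝ := fun k =>
    |divisor ω k|⁻¹ * Real.exp (-(2 * Real.pi * (δ * norm1 k))) with hb
  have ha2 : ∀ k, a k ^ 2 =
      ‖fc (fun x => f (toC x)) k‖ ^ 2 * Real.exp (4 * Real.pi * (r * norm1 k)) := fun k => by
    simp only [ha, mul_pow, ← Real.exp_nat_mul]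
    congr 2; push_cast; ring
  have hb2 : ∀ k, b k ^ 2 =
      (divisor ω k ^ 2)⁻¹ * Real.exp (-(4 * Real.pi * (δ * norm1 k))) := fun k => by
    simp only [hb, mul_pow, ← Real.exp_nat_mul, inv_pow, sq_abs]
    congr 2; push_cast; ring
  have hab : ∀ k, ‖solCoeff ω f k‖ * Real.exp (2 * Real.pi * ((r - δ) * norm1 k)) =
      (2 * Real.pi)⁻¹ * (a k * b k) := fun k => by
    have h3 : Real.exp (2 * Real.pi * ((r - δ) * norm1 k)) =
        Real.exp (2 * Real.pi * (r * norm1 k)) * Real.exp (-(2 * Real.pi * (δ * norm1 k))) := by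
      rw [← Real.exp_add]; congr 1; ring
    rw [norm_solCoeff, h3]
    simp only [ha, hb]
    ring
  have hCS := Finset.sum_mul_sq_le_sq_mul_sq F a b
  simp only [ha2, hb2] at hCS
  have hγδ : 0 ≤ γ⁻¹ * δ ^ (-σ) := by positivity
  have h4 : (∑ k ∈ F, a k * b k) ≤ Real.sqrt (2 ^ n * c) * (γ⁻¹ * δ ^ (-σ)) * M := by
    refine (sq_le_sq₀ (Finset.sum_nonneg fun k _ => by positivity) (by positivity)).1 ?_
    rw [mul_pow, mul_pow, Real.sq_sqrt (by positivity)]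
    calc _ ≤ _ := hCS
      _ ≤ (2 ^ n * M ^ 2) * (c * (γ⁻¹ * δ ^ (-σ)) ^ 2) :=
          mul_le_mul h1 h2 (Finset.sum_nonneg fun k _ => by positivity) (by positivity)
      _ = _ := by ring
  have h5 : 0 ≤ ∑ k ∈ F, a k * b k := Finset.sum_nonneg fun k _ => by positivity
  have h6 : (2 * Real.pi)⁻¹ ≤ 1 := inv_le_one_of_one_le₀ (by linarith [Real.pi_gt_three])
  simp only [hab, ← Finset.mul_sum]
  calc _ ≤ 1 * ∑ k ∈ F, a k * b k := mul_le_mul_of_nonneg_right h6 h5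
    _ ≤ Real.sqrt (2 ^ n * c) * (γ⁻¹ * δ ^ (-σ)) * M := by rw [one_mul]; exact h4
    _ ≤ (Real.sqrt (2 ^ n * c) + 1) * (γ⁻¹ * δ ^ (-σ)) * M := by gcongr; linarith
    _ = _ := by ring

variable {γ σ : ℝ} {ω : Fin n → ℝ}

theorem summable_solCoeff (hσ : 0 < σ) (hγ : 0 < γ) (hω : IsDiophantine γ σ ω)
    (hf : StripFun n ρ f) (hb : ∀ r < ρ, ∃ M, ∀ θ ∈ strip n r, ‖f θ‖ ≤ M) {r : ℝ}
    (hr : 0 ≤ r) (hrρ : r < ρ) :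
    Summable fun k => ‖solCoeff ω f k‖ * Real.exp (2 * Real.pi * (r * norm1 k)) := by
  obtain ⟨c, -, hc⟩ := exists_sum_solCoeff_le n hσ
  obtain ⟨r', hr', hr'ρ⟩ := exists_between hrρ
  obtain ⟨M, hM⟩ := hb r' hr'ρ
  rcases hr.eq_or_lt with rfl | hr0
  · refine summable_of_sum_le (fun k => by positivity) fun F => le_trans
      (Finset.sum_le_sum fun k _ => ?_)
      (hc γ hγ ω hω ρ f hf r' (r' / 2) M hr'ρ.le (by linarith) (by linarith) hM F)
    refine mul_le_mul_of_nonneg_left (Real.exp_le_exp.2 ?_) (norm_nonneg _)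
    have := norm1_nonneg k
    have h2 : 0 ≤ (r' - r' / 2) * norm1 k := mul_nonneg (by linarith) this
    rw [zero_mul]
    exact mul_le_mul_of_nonneg_left h2 (by positivity)
  · refine summable_of_sum_le (fun k => by positivity) fun F =>
      by simpa using hc γ hγ ω hω ρ f hf r' (r' - r) M hr'ρ.le (by linarith) (by linarith) hM F

theorem summable_norm1_mul_solCoeff (hσ : 0 < σ) (hγ : 0 < γ) (hω : IsDiophantine γ σ ω)
    (hf : StripFun n ρ f) (hb : ∀ r < ρ, ∃ M, ∀ θ ∈ strip n r, ‖f θ‖ ≤ M) {r : ℝ}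
    (hr : 0 ≤ r) (hrρ : r < ρ) :
    Summable fun k =>
      norm1 k * (‖solCoeff ω f k‖ * Real.exp (2 * Real.pi * (r * norm1 k))) := by
  obtain ⟨r', hr', hr'ρ⟩ := exists_between hrρ
  refine Summable.of_nonneg_of_le (fun k => mul_nonneg (norm1_nonneg k) (by positivity))
    (fun k => ?_) ((summable_solCoeff hσ hγ hω hf hb (hr.trans hr'.le) hr'ρ).mul_left
      (2 * Real.pi * (r' - r))⁻¹)
  have hη : 0 < 2 * Real.pi * (r' - r) := mul_pos (by positivity) (by linarith)
  have h1 : 2 * Real.pi * (r' - r) * norm1 k ≤ Real.exp (2 * Real.pi * (r' - r) * norm1 k) := by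
    linarith [Real.add_one_le_exp (2 * Real.pi * (r' - r) * norm1 k)]
  have h2 : Real.exp (2 * Real.pi * (r' * norm1 k)) =
      Real.exp (2 * Real.pi * (r' - r) * norm1 k) * Real.exp (2 * Real.pi * (r * norm1 k)) := by
    rw [← Real.exp_add]; congr 1; ring
  rw [le_inv_mul_iff₀ hη, h2]
  calc _ = (2 * Real.pi * (r' - r) * norm1 k) *
        (‖solCoeff ω f k‖ * Real.exp (2 * Real.pi * (r * norm1 k))) := by ring
    _ ≤ Real.exp (2 * Real.pi * (r' - r) * norm1 k) *
        (‖solCoeff ω f k‖ * Real.exp (2 * Real.pi * (r * norm1 k))) :=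
        mul_le_mul_of_nonneg_right h1 (by positivity)
    _ = _ := by ring

theorem hasFDerivAt_sol (hσ : 0 < σ) (hγ : 0 < γ) (hω : IsDiophantine γ σ ω)
    (hf : StripFun n ρ f) (hb : ∀ r < ρ, ∃ M, ∀ θ ∈ strip n r, ‖f θ‖ ≤ M) {θ : Fin n → ℂ}
    (hθ : θ ∈ strip n ρ) (hρ : 0 < ρ) :
    HasFDerivAt (sol ω f) (∑' k, solCoeff ω f k • fderiv ℂ (expk k) θ) θ ∧
      Summable fun k => solCoeff ω f k • fderiv ℂ (expk k) θ := by
  obtain ⟨r, hr, hrρ, hθr⟩ : ∃ r, 0 < r ∧ r < ρ ∧ θ ∈ strip n r := by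
    have hlt : ‖fun j => (θ j).im‖ < ρ := (pi_norm_lt_iff hρ).2 fun j => hθ j
    obtain ⟨r, h1, h2⟩ := exists_between hlt
    exact ⟨r, (norm_nonneg _).trans_lt h1, h2, fun j =>
      (norm_le_pi_norm (fun j => (θ j).im) j).trans_lt h1⟩
  have hbd : ∀ k, ∀ τ ∈ strip n r, ‖solCoeff ω f k • fderiv ℂ (expk k) τ‖ ≤
      2 * Real.pi *
        (norm1 k * (‖solCoeff ω f k‖ * Real.exp (2 * Real.pi * (r * norm1 k)))) := by
    intro k τ hτ
    have h1 : ‖∑ j, (k j : ℂ) • (ContinuousLinearMap.proj j : (Fin n → ℂ) →L[ℂ] ℂ)‖ ≤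
        norm1 k := by
      refine (norm_sum_le _ _).trans (Finset.sum_le_sum fun j _ => ?_)
      rw [norm_smul]
      have h2 : ‖(ContinuousLinearMap.proj j : (Fin n → ℂ) →L[ℂ] ℂ)‖ ≤ 1 :=
        ContinuousLinearMap.opNorm_le_bound _ zero_le_one fun v => by
          simpa using norm_le_pi_norm v j
      have h3 : ‖(k j : ℂ)‖ = |(k j : ℝ)| := Complex.norm_intCast _
      rw [h3]
      exact mul_le_of_le_one_right (abs_nonneg _) h2
    rw [(hasFDerivAt_expk k τ).fderiv, norm_smul, norm_smul]
    simp only [norm_mul, Complex.norm_I, Complex.norm_real, Complex.norm_ofNat, mul_one,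
      Real.norm_eq_abs, abs_of_pos Real.pi_pos]
    calc _ ≤ ‖solCoeff ω f k‖ * (2 * Real.pi * Real.exp (2 * Real.pi * (r * norm1 k)) *
          norm1 k) := by
          gcongr
          exact norm_expk_le k hτ
      _ = _ := by ring
  have hsum := (summable_norm1_mul_solCoeff hσ hγ hω hf hb hr.le hrρ).mul_left (2 * Real.pi)
  refine ⟨hasFDerivAt_tsum_of_isPreconnected hsum isOpen_strip convex_strip.isPreconnected
    (f := fun k θ => solCoeff ω f k * expk k θ)
    (fun k τ _ => ((differentiable_expk k) τ).hasFDerivAt.const_mul _) hbd hθr ?_ hθr,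
    Summable.of_norm_bounded hsum fun k => hbd k θ hθr⟩
  refine Summable.of_norm_bounded (summable_solCoeff hσ hγ hω hf hb hr.le hrρ) fun k => ?_
  rw [norm_mul]
  exact mul_le_mul_of_nonneg_left (norm_expk_le k hθr) (norm_nonneg _)

theorem solCoeff_mul_divisor (hγ : 0 < γ) (hω : IsDiophantine γ σ ω)
    (h0 : fc (fun x => f (toC x)) 0 = 0) (k : Fin n → ℤ) :
    solCoeff ω f k * (2 * Real.pi * Complex.I * divisor ω k) = fc (fun x => f (toC x)) k := by
  rcases eq_or_ne k 0 with rfl | hk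
  · simp [divisor_zero, h0]
  · rw [solCoeff, div_mul_cancel₀]
    exact mul_ne_zero Complex.two_pi_I_ne_zero
      (Complex.ofReal_ne_zero.2 (divisor_ne_zero hω hγ hk))

theorem conj_expk_toC (k : Fin n → ℤ) (x : Fin n → ℝ) :
    (starRingEnd ℂ) (expk k (toC x)) = expk (-k) (toC x) := by
  rw [expk, expk, ← Complex.exp_conj]
  congr 1
  simp [kdot, toC, map_ofNat (starRingEnd ℂ) 2]

theorem conj_fc {g : (Fin n → ℝ) → ℂ} (hg : ∀ x, (g x).im = 0) (k : Fin n → ℤ) :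
    (starRingEnd ℂ) (fc g k) = fc g (-k) := by
  rw [fc, ← integral_conj]
  simp only [map_mul, conj_expk_toC, Complex.conj_eq_iff_im.2 (hg _), fc]

theorem conj_solCoeff (hf : ∀ x, (f (toC x)).im = 0) (ω : Fin n → ℝ) (k : Fin n → ℤ) :
    (starRingEnd ℂ) (solCoeff ω f k) = solCoeff ω f (-k) := by
  have h : divisor ω (-k) = -divisor ω k := by simp [divisor]
  simp only [solCoeff, map_div₀, conj_fc hf, map_mul, Complex.conj_I, Complex.conj_ofReal, h,
    map_ofNat (starRingEnd ℂ) 2]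
  simp

theorem stripFun_sol (hσ : 0 < σ) (hγ : 0 < γ) (hω : IsDiophantine γ σ ω)
    (hf : StripFun n ρ f) (hb : ∀ r < ρ, ∃ M, ∀ θ ∈ strip n r, ‖f θ‖ ≤ M) (hρ : 0 < ρ) :
    StripFun n ρ (sol ω f) := by
  refine ⟨fun θ hθ =>
    (hasFDerivAt_sol hσ hγ hω hf hb hθ hρ).1.differentiableAt.differentiableWithinAt,
    ?_, fun x _ _ => ?_⟩
  · rintro _ ⟨m, rfl⟩ θ _
    simp only [sol, expk_add, expk_int, mul_one]
  · refine Complex.conj_eq_iff_im.1 ?_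
    rw [sol, Complex.conj_tsum, ← (Equiv.neg (Fin n → ℤ)).tsum_eq]
    refine tsum_congr fun k => ?_
    rw [map_mul, conj_expk_toC, conj_solCoeff (fun x => hf.real x trivial (toC_mem_strip hρ x))]
    simp

/-- `∂_ω u = f`: the Fourier series of both sides agree on the real torus, and both sides are
holomorphic on the strip. -/
theorem fderiv_sol (hσ : 0 < σ) (hγ : 0 < γ) (hω : IsDiophantine γ σ ω)
    (hf : StripFun n ρ f) (hb : ∀ r < ρ, ∃ M, ∀ θ ∈ strip n r, ‖f θ‖ ≤ M) (hρ : 0 < ρ)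
    (h0 : fc (fun x => f (toC x)) 0 = 0) {θ : Fin n → ℂ} (hθ : θ ∈ strip n ρ) :
    fderiv ℂ (sol ω f) θ (toC ω) = f θ := by
  refine eqOn_strip_of_real (f := fun θ => fderiv ℂ (sol ω f) θ (toC ω))
    (differentiableOn_fderiv_apply isOpen_strip (stripFun_sol hσ hγ hω hf hb hρ).holo _)
    hf.holo (fun x => ?_) hθ
  obtain ⟨h1, h2⟩ := hasFDerivAt_sol hσ hγ hω hf hb (toC_mem_strip hρ x) hρ
  have h3 : HasSum (fun k => fc (fun x => f (toC x)) k * expk k (toC x))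
      (fderiv ℂ (sol ω f) (toC x) (toC ω)) := by
    rw [h1.fderiv]
    have h4 := (ContinuousLinearMap.apply ℂ ℂ (toC ω)).hasSum h2.hasSum
    refine h4.congr_fun fun k => ?_
    simp only [ContinuousLinearMap.apply_apply, _root_.smul_apply, smul_eq_mul,
      fderiv_expk_apply, kdot_toC, ← solCoeff_mul_divisor hγ hω h0 k]
    ring
  have hsum : Summable (fc fun x => f (toC x)) := by
    have h5 := h3.summable.norm
    refine Summable.of_norm (h5.congr fun k => ?_)
    have h6 : ‖expk k (toC x)‖ = 1 := by
      have h7 : (2 * Real.pi * Complex.I * kdot k (toC x) : ℂ) =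
          ((2 * Real.pi * divisor x k : ℝ) : ℂ) * Complex.I := by
        rw [kdot_toC]; push_cast; ring
      rw [expk, h7, Complex.norm_exp_ofReal_mul_I]
    rw [norm_mul, h6, mul_one]
  exact h3.unique (hasSum_fc (StripFun.continuous_real hf hρ) (StripFun.isZPeriodic_real hf hρ)
    hsum x)

/-- Rüssmann's theorem on the small divisor equation `∂_ω u = f`: there is a solution on the whole
strip on which `f` is given, with the optimal loss `δ^{-σ}` on every smaller strip. -/
theorem exists_norm_sol_le (n : ℕ) {σ : ℝ} (hσ : 0 < σ) :
    ∃ c : ℝ, 1 ≤ c ∧ ∀ (γ : ℝ), 0 < γ → ∀ ω : Fin n → ℝ, IsDiophantine γ σ ω →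
      ∀ (ρ : ℝ) (f : (Fin n → ℂ) → ℂ), StripFun n ρ f →
      ∀ r δ M : ℝ, r ≤ ρ → 0 < δ → δ < r → (∀ θ ∈ strip n r, ‖f θ‖ ≤ M) →
      ∀ θ ∈ strip n (r - δ), ‖sol ω f θ‖ ≤ c * γ⁻¹ * δ ^ (-σ) * M := by
  obtain ⟨c, hc1, hc⟩ := exists_sum_solCoeff_le n hσ
  refine ⟨c, hc1, fun γ hγ ω hω ρ f hf r δ M hrρ hδ hδr hM θ hθ => ?_⟩
  have h1 := hc γ hγ ω hω ρ f hf r δ M hrρ hδ hδr hM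
  have h2 : Summable fun k =>
      ‖solCoeff ω f k‖ * Real.exp (2 * Real.pi * ((r - δ) * norm1 k)) :=
    summable_of_sum_le (fun k => by positivity) h1
  refine (tsum_of_norm_bounded h2.hasSum fun k => ?_).trans
    (Real.tsum_le_of_sum_le (fun k => by positivity) h1)
  rw [norm_mul]
  exact mul_le_mul_of_nonneg_left (norm_expk_le k hθ) (norm_nonneg _)

end Russmann

/-! ### Regularity of the coefficients along the torus -/

section Coefficients

variable {n : ℕ} {S : GenHamSystem n} {D : Set (Idx n → ℂ)} {X : HolomorphicExtension S D}
  {ρ : ℝ} {K : (Fin n → ℂ) → Idx n → ℂ}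

/-- Functions on complex phase space that are holomorphic on `D`, invariant under the periods of
phase space, and real on real phase space. -/
abbrev PhaseFun (S : GenHamSystem n) (D : Set (Idx n → ℂ)) (F : (Idx n → ℂ) → ℂ) : Prop :=
  RealPeriodic D {v | IsPeriod S.angular v} S.dom F

theorem phaseFun_H (X : HolomorphicExtension S D) : PhaseFun S D X.H :=
  ⟨X.H_holo, X.H_periodic, fun x hx hxD => by rw [X.H_extends x hx hxD, Complex.ofReal_im]⟩

theorem phaseFun_B (X : HolomorphicExtension S D) (i j : Idx n) :
    PhaseFun S D fun z => X.B z i j :=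
  ⟨X.B_holo i j, fun v hv z hz => by rw [X.B_periodic v hv z hz],
    fun x hx hxD => by rw [X.B_extends x hx hxD]; exact Complex.ofReal_im _⟩

theorem NondegenerateTorus.mapsTo_strip (hK : NondegenerateTorus X ρ K) {θ : Fin n → ℂ}
    (hθ : θ ∈ strip n ρ) : K θ ∈ D := hK.mapsTo (strip_subset_closedStrip hθ)

theorem NondegenerateTorus.differentiableOn (hK : NondegenerateTorus X ρ K) :
    DifferentiableOn ℂ K (strip n ρ) :=
  hK.mem.holo.mono (interior_maximal strip_subset_closedStrip isOpen_strip)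

theorem NondegenerateTorus.differentiableAt (hK : NondegenerateTorus X ρ K) {θ : Fin n → ℂ}
    (hθ : θ ∈ strip n ρ) : DifferentiableAt ℂ K θ :=
  hK.differentiableOn.differentiableAt (isOpen_strip.mem_nhds hθ)

theorem NondegenerateTorus.differentiableOn_apply (hK : NondegenerateTorus X ρ K) (i : Idx n) :
    DifferentiableOn ℂ (fun θ => K θ i) (strip n ρ) :=
  differentiableOn_pi.1 hK.differentiableOn i

/-- The restriction of `K` to real points as a map to real phase space.  The values of `K` at real
points are real, so taking real parts loses nothing. -/
def realTorus (K : (Fin n → ℂ) → Idx n → ℂ) (x : Fin n → ℝ) : Idx n → ℝ :=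
  fun i => (K (toC x) i).re

theorem NondegenerateTorus.toC_realTorus (hK : NondegenerateTorus X ρ K) (hρ : 0 < ρ)
    (x : Fin n → ℝ) : K (toC x) = toC (realTorus K x) := by
  funext i
  exact Complex.ext rfl
    (by rw [hK.mem.real x (strip_subset_closedStrip (toC_mem_strip hρ x)) i]; rfl)

theorem NondegenerateTorus.comp (hK : NondegenerateTorus X ρ K) (hρ : 0 < ρ)
    {F : (Idx n → ℂ) → ℂ} (hF : PhaseFun S D F) : StripFun n ρ fun θ => F (K θ) := by
  refine ⟨hF.holo.comp hK.differentiableOn fun θ hθ => hK.mapsTo_strip hθ, ?_, fun x _ _ => ?_⟩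
  · rintro _ ⟨k, rfl⟩ θ hθ
    have h1 : θ + intC k ∈ strip n ρ := by
      rw [intC_eq_toC]; exact add_toC_mem_strip hθ _
    obtain ⟨v, hv, h2⟩ := hK.mem.periodic k θ (strip_subset_closedStrip hθ)
      (strip_subset_closedStrip h1)
    change F (K (θ + toC fun i => (k i : ℝ))) = F (K θ)
    rw [← intC_eq_toC, h2]
    exact hF.per v hv _ (hK.mapsTo_strip hθ)
  · have h := hK.mapsTo_strip (toC_mem_strip hρ x)
    rw [hK.toC_realTorus hρ] at h ⊢
    exact hF.real _ (hK.real_mapsTo x) h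

theorem partialD_apply {m : ℕ} {𝕜 : Type*} [RCLike 𝕜] {κ : Type*} [Fintype κ]
    {f : (Fin m → 𝕜) → κ → 𝕜} {θ : Fin m → 𝕜} (hf : DifferentiableAt 𝕜 f θ) (j : Fin m) (i : κ) :
    partialD 𝕜 j f θ i = partialD 𝕜 j (fun τ => f τ i) θ := by
  rw [partialD, partialD, (hasFDerivAt_pi'.1 hf.hasFDerivAt i).fderiv]
  rfl

theorem NondegenerateTorus.DK_apply (hK : NondegenerateTorus X ρ K) {θ : Fin n → ℂ}
    (hθ : θ ∈ strip n ρ) (i : Idx n) (j : Fin n) :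
    DK K θ i j = fderiv ℂ (fun τ => K τ i) θ (Pi.single j 1) :=
  partialD_apply (hK.differentiableAt hθ) j i

theorem RealPeriodic.congr {ι : Type*} {U : Set (ι → ℂ)} {P R : Set (ι → ℝ)}
    {f g : (ι → ℂ) → ℂ} (hf : RealPeriodic U P R f) (hU : ∀ v ∈ P, ∀ z ∈ U, z + toC v ∈ U)
    (h : EqOn g f U) : RealPeriodic U P R g :=
  ⟨hf.holo.congr h, fun v hv z hz => by rw [h (hU v hv z hz), h hz, hf.per v hv z hz],
    fun x hx hxU => by rw [h hxU, hf.real x hx hxU]⟩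

/-- The entries of `DK` are periodic even when `K` is periodic only up to the periods of phase
space: the difference of `K` at `θ + k` and at `θ` is holomorphic and real valued, so its
derivative vanishes. -/
theorem NondegenerateTorus.stripFun_DK (hK : NondegenerateTorus X ρ K) (i : Idx n)
    (j : Fin n) : StripFun n ρ fun θ => DK K θ i j := by
  have h0 : StripFun n ρ fun θ => fderiv ℂ (fun τ => K τ i) θ (Pi.single j 1) := by
    refine ⟨differentiableOn_fderiv_apply isOpen_strip (hK.differentiableOn_apply i) _, ?_,
      fun x _ hx => ?_⟩
    · rintro _ ⟨k, rfl⟩ θ hθ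
      change fderiv ℂ (fun τ => K τ i) (θ + toC fun i => (k i : ℝ)) (Pi.single j 1) = _
      rw [← intC_eq_toC]
      have hmem : ∀ τ ∈ strip n ρ, τ + intC k ∈ strip n ρ := fun τ hτ => by
        rw [intC_eq_toC]; exact add_toC_mem_strip hτ _
      set g : (Fin n → ℂ) → ℂ := fun τ => K (τ + intC k) i - K τ i with hg
      have hd1 : DifferentiableAt ℂ (fun τ => K τ i) (θ + intC k) :=
        (hK.differentiableOn_apply i).differentiableAt (isOpen_strip.mem_nhds (hmem θ hθ))
      have hd2 : DifferentiableAt ℂ (fun τ => K τ i) θ :=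
        (hK.differentiableOn_apply i).differentiableAt (isOpen_strip.mem_nhds hθ)
      have hd1' : HasFDerivAt (fun τ => K (τ + intC k) i)
          (fderiv ℂ (fun τ => K τ i) (θ + intC k)) θ :=
        (hasFDerivAt_comp_add_right (intC k)).2 hd1.hasFDerivAt
      have hgd : HasFDerivAt g (fderiv ℂ (fun τ => K τ i) (θ + intC k) -
          fderiv ℂ (fun τ => K τ i) θ) θ := hd1'.sub hd2.hasFDerivAt
      have him : ∀ᶠ τ in 𝓝 θ, (g τ).im = 0 := by
        filter_upwards [isOpen_strip.mem_nhds hθ] with τ hτ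
        obtain ⟨v, -, h2⟩ := hK.mem.periodic k τ (strip_subset_closedStrip hτ)
          (strip_subset_closedStrip (hmem τ hτ))
        rw [hg]
        simp [h2, toC]
      have h3 : ∀ v, (fderiv ℂ g θ v).im = 0 := by
        intro v
        have h4 : HasFDerivAt (fun τ => (g τ).im)
            (Complex.imCLM.comp ((fderiv ℂ g θ).restrictScalars ℝ)) θ :=
          Complex.imCLM.hasFDerivAt.comp θ
            (hgd.differentiableAt.hasFDerivAt.restrictScalars ℝ)
        have h5 : HasFDerivAt (fun τ => (g τ).im) (0 : (Fin n → ℂ) →L[ℝ] ℝ) θ :=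
          (hasFDerivAt_const (0 : ℝ) θ).congr_of_eventuallyEq him
        simpa using congrArg (fun L => L v) (h4.unique h5)
      have h6 : fderiv ℂ g θ (Pi.single j 1) = 0 := by
        have h7 := h3 (Complex.I • Pi.single j 1)
        rw [map_smul] at h7
        exact Complex.ext (by simpa using h7) (h3 _)
      rw [hgd.fderiv] at h6
      exact sub_eq_zero.1 (by simpa using h6)
    · rw [← toC_single]
      refine im_fderiv_toC ((hK.differentiableOn_apply i).differentiableAt
        (isOpen_strip.mem_nhds hx)) ?_ _
      filter_upwards [(isOpen_strip.preimage continuous_toC).mem_nhds hx] with y hy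
      exact hK.mem.real y (strip_subset_closedStrip hy) i
  exact h0.congr (fun v _ z hz => add_toC_mem_strip hz v) fun θ hθ => hK.DK_apply hθ i j

theorem NondegenerateTorus.dOmega_K (hK : NondegenerateTorus X ρ K) {θ : Fin n → ℂ}
    (hθ : θ ∈ strip n ρ) (ω : Fin n → ℝ) : dOmega ω K θ = DK K θ *ᵥ toC ω := by
  funext i
  have h := hK.differentiableAt hθ
  have h1 : toC ω = ∑ j, toC ω j • (Pi.single j 1 : Fin n → ℂ) := by
    conv_lhs => rw [pi_eq_sum_univ' (toC ω)]
  rw [dOmega]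
  conv_lhs => rw [h1, map_sum]
  simp only [map_smul, Finset.sum_apply, Pi.smul_apply, smul_eq_mul, Matrix.mulVec, dotProduct]
  exact Finset.sum_congr rfl fun j _ => mul_comm _ _

theorem fderiv_eq_sum_partialD {ι : Type*} [Fintype ι] [DecidableEq ι] (f : (ι → ℂ) → ℂ)
    (z v : ι → ℂ) : fderiv ℂ f z v = ∑ j, partialD ℂ j f z * v j := by
  conv_lhs => rw [pi_eq_sum_univ' v, map_sum]
  refine Finset.sum_congr rfl fun j _ => ?_
  rw [map_smul, smul_eq_mul, mul_comm]
  rfl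

theorem dirB_apply (B : (Idx n → ℂ) → Matrix (Idx n) (Idx n) ℂ) (z h : Idx n → ℂ)
    (i j : Idx n) : dirB B z h i j = ∑ l, partialD ℂ l (fun y => B y i j) z * h l :=
  fderiv_eq_sum_partialD _ _ _

theorem NondegenerateTorus.stripFun_B (hK : NondegenerateTorus X ρ K) (hρ : 0 < ρ)
    (i j : Idx n) : StripFun n ρ fun θ => X.B (K θ) i j := hK.comp hρ (phaseFun_B X i j)

theorem NondegenerateTorus.stripFun_partialB (hK : NondegenerateTorus X ρ K) (hρ : 0 < ρ)
    (l i j : Idx n) : StripFun n ρ fun θ => partialD ℂ l (fun y => X.B y i j) (K θ) :=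
  hK.comp hρ ((phaseFun_B X i j).partialD X.isOpen S.isOpen_dom l)

theorem phaseFun_grad (X : HolomorphicExtension S D) (i : Idx n) :
    PhaseFun S D fun z => grad X.H z i :=
  (phaseFun_H X).partialD X.isOpen S.isOpen_dom i

theorem NondegenerateTorus.stripFun_grad (hK : NondegenerateTorus X ρ K) (hρ : 0 < ρ)
    (i : Idx n) : StripFun n ρ fun θ => grad X.H (K θ) i := hK.comp hρ (phaseFun_grad X i)

theorem Psi_apply (X : HolomorphicExtension S D) {z : Idx n → ℂ} (hz : z ∈ D) (i j : Idx n) :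
    Psi X.H z i j = partialD ℂ j (fun y => grad X.H y i) z := by
  have h : DifferentiableAt ℂ (grad X.H) z := differentiableAt_pi.2 fun i =>
    (phaseFun_grad X i).differentiableAt X.isOpen hz
  change fderiv ℂ (grad X.H) z (Pi.single j 1) i = fderiv ℂ (fun y => grad X.H y i) z _
  rw [(hasFDerivAt_pi'.1 h.hasFDerivAt i).fderiv]
  rfl

theorem StripFun.congr {f g : (Fin n → ℂ) → ℂ} (hf : StripFun n ρ f)
    (h : EqOn g f (strip n ρ)) : StripFun n ρ g :=
  RealPeriodic.congr hf (fun v _ _ hz => add_toC_mem_strip hz v) h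

theorem NondegenerateTorus.stripFun_Psi (hK : NondegenerateTorus X ρ K) (hρ : 0 < ρ)
    (i j : Idx n) : StripFun n ρ fun θ => Psi X.H (K θ) i j :=
  StripFun.congr (hK.comp hρ ((phaseFun_grad X i).partialD X.isOpen S.isOpen_dom j))
    fun _ hθ => Psi_apply X (hK.mapsTo_strip hθ) i j

theorem NondegenerateTorus.stripFun_matA (hK : NondegenerateTorus X ρ K) (hρ : 0 < ρ)
    (i j : Idx n) : StripFun n ρ fun θ => matA X.B X.H K θ i j := by
  refine RealPeriodic.add ?_
    (RealPeriodic.matrix_mul (hK.stripFun_B hρ) (hK.stripFun_Psi hρ) i j)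
  simp only [Phi, Matrix.of_apply]
  exact RealPeriodic.sum fun l _ => (hK.stripFun_partialB hρ j i l).mul (hK.stripFun_grad hρ l)

theorem NondegenerateTorus.stripFun_Binv (hK : NondegenerateTorus X ρ K) (hρ : 0 < ρ)
    (i j : Idx n) : StripFun n ρ fun θ => (X.B (K θ))⁻¹ i j :=
  RealPeriodic.matrix_inv (hK.stripFun_B hρ)
    (fun _ hθ => X.invertible _ (hK.mapsTo_strip hθ)) i j

theorem NondegenerateTorus.stripFun_matN (hK : NondegenerateTorus X ρ K)
    (i j : Fin n) : StripFun n ρ fun θ => matN K θ i j :=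
  RealPeriodic.matrix_inv (RealPeriodic.matrix_mul (fun a b => hK.stripFun_DK b a)
    hK.stripFun_DK) hK.nd1 i j

theorem NondegenerateTorus.stripFun_vf (hK : NondegenerateTorus X ρ K) (hρ : 0 < ρ)
    (i : Idx n) : StripFun n ρ fun θ => (X.B (K θ) *ᵥ grad X.H (K θ)) i :=
  RealPeriodic.mulVec (hK.stripFun_B hρ) (hK.stripFun_grad hρ) i

theorem NondegenerateTorus.err_eq (hK : NondegenerateTorus X ρ K) {θ : Fin n → ℂ}
    (hθ : θ ∈ strip n ρ) (ω : Fin n → ℝ) :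
    err X.B X.H ω K θ = X.B (K θ) *ᵥ grad X.H (K θ) - DK K θ *ᵥ toC ω := by
  rw [err, hK.dOmega_K hθ]

theorem NondegenerateTorus.stripFun_err (hK : NondegenerateTorus X ρ K) (hρ : 0 < ρ)
    (ω : Fin n → ℝ) (i : Idx n) : StripFun n ρ fun θ => err X.B X.H ω K θ i := by
  refine StripFun.congr (f := fun θ => (X.B (K θ) *ᵥ grad X.H (K θ)) i - (DK K θ *ᵥ toC ω) i)
    ((hK.stripFun_vf hρ i).sub ?_) fun θ hθ => by simp only [hK.err_eq hθ, Pi.sub_apply]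
  exact RealPeriodic.mulVec hK.stripFun_DK (fun j => RealPeriodic.const (ω j)) i

theorem NondegenerateTorus.stripFun_BDKN (hK : NondegenerateTorus X ρ K) (hρ : 0 < ρ)
    (i : Idx n) (j : Fin n) :
    StripFun n ρ fun θ => (X.B (K θ) * DK K θ * matN K θ) i j :=
  RealPeriodic.matrix_mul (RealPeriodic.matrix_mul (hK.stripFun_B hρ) hK.stripFun_DK)
    hK.stripFun_matN i j

theorem NondegenerateTorus.stripFun_BDKNDKT (hK : NondegenerateTorus X ρ K) (hρ : 0 < ρ)
    (i j : Idx n) :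
    StripFun n ρ fun θ => (X.B (K θ) * DK K θ * matN K θ * (DK K θ)ᵀ) i j :=
  RealPeriodic.matrix_mul (hK.stripFun_BDKN hρ) (fun a b => hK.stripFun_DK b a) i j

/-- The matrix `AB - BA - DB[B∇H] + B DK N DKᵀ (A + Aᵀ)` occurring in `S⁰`. -/
noncomputable def torsionCore (X : HolomorphicExtension S D) (K : (Fin n → ℂ) → Idx n → ℂ)
    (θ : Fin n → ℂ) : Matrix (Idx n) (Idx n) ℂ :=
  matA X.B X.H K θ * X.B (K θ) - X.B (K θ) * matA X.B X.H K θ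
      - dirB X.B (K θ) (X.B (K θ) *ᵥ grad X.H (K θ))
      + X.B (K θ) * DK K θ * matN K θ * (DK K θ)ᵀ * (matA X.B X.H K θ + (matA X.B X.H K θ)ᵀ)

theorem matS0_eq (X : HolomorphicExtension S D) (K : (Fin n → ℂ) → Idx n → ℂ)
    (θ : Fin n → ℂ) : matS0 X.B X.H K θ =
      matN K θ * (DK K θ)ᵀ * torsionCore X K θ * DK K θ * matN K θ := rfl

theorem NondegenerateTorus.stripFun_torsionCore (hK : NondegenerateTorus X ρ K) (hρ : 0 < ρ)
    (i j : Idx n) : StripFun n ρ fun θ => torsionCore X K θ i j := by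
  refine RealPeriodic.add (RealPeriodic.sub (RealPeriodic.sub
    (RealPeriodic.matrix_mul (hK.stripFun_matA hρ) (hK.stripFun_B hρ) i j)
    (RealPeriodic.matrix_mul (hK.stripFun_B hρ) (hK.stripFun_matA hρ) i j)) ?_)
    (RealPeriodic.matrix_mul (hK.stripFun_BDKNDKT hρ)
      (fun a b => (hK.stripFun_matA hρ a b).add (hK.stripFun_matA hρ b a)) i j)
  simp only [dirB_apply]
  exact RealPeriodic.sum fun l _ => (hK.stripFun_partialB hρ l i j).mul (hK.stripFun_vf hρ l)

theorem NondegenerateTorus.stripFun_matS0 (hK : NondegenerateTorus X ρ K) (hρ : 0 < ρ)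
    (i j : Fin n) : StripFun n ρ fun θ => matS0 X.B X.H K θ i j := by
  simp only [matS0_eq]
  exact RealPeriodic.matrix_mul (RealPeriodic.matrix_mul (RealPeriodic.matrix_mul
    (RealPeriodic.matrix_mul hK.stripFun_matN fun a b => hK.stripFun_DK b a)
    (hK.stripFun_torsionCore hρ)) hK.stripFun_DK) hK.stripFun_matN i j

theorem NondegenerateTorus.stripFun_px (hK : NondegenerateTorus X ρ K) (hρ : 0 < ρ)
    (ω : Fin n → ℝ) (i : Fin n) : StripFun n ρ fun θ => px X.B X.H ω K θ i := by
  have h1 : ∀ a b, StripFun n ρ fun θ => (1 - X.B (K θ) * DK K θ * matN K θ * (DK K θ)ᵀ *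
      (X.B (K θ))⁻¹ : Matrix (Idx n) (Idx n) ℂ) a b := fun a b => by
    refine RealPeriodic.sub (f := fun _ => (1 : Matrix (Idx n) (Idx n) ℂ) a b) ?_
      (RealPeriodic.matrix_mul (hK.stripFun_BDKNDKT hρ) (hK.stripFun_Binv hρ) a b)
    by_cases h : a = b
    · subst h
      simp only [Matrix.one_apply_eq]
      exact RealPeriodic.one
    · simp only [Matrix.one_apply_ne h]
      exact RealPeriodic.zero
  have h2 : ∀ a b, StripFun n ρ fun θ => ((matN K θ)ᵀ * (DK K θ)ᵀ) a b :=
    RealPeriodic.matrix_mul (fun a b => hK.stripFun_matN b a) fun a b => hK.stripFun_DK b a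
  exact RealPeriodic.neg (RealPeriodic.mulVec (RealPeriodic.matrix_mul h2 h1)
    (hK.stripFun_err hρ ω) i)

theorem NondegenerateTorus.stripFun_py (hK : NondegenerateTorus X ρ K) (hρ : 0 < ρ)
    (ω : Fin n → ℝ) (i : Fin n) : StripFun n ρ fun θ => py X.B X.H ω K θ i :=
  RealPeriodic.neg (RealPeriodic.mulVec (RealPeriodic.matrix_mul
    (fun a b => hK.stripFun_DK b a) (hK.stripFun_Binv hρ)) (hK.stripFun_err hρ ω) i)

theorem NondegenerateTorus.stripFun_matL (hK : NondegenerateTorus X ρ K) (hρ : 0 < ρ)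
    (i j : Fin n) : StripFun n ρ fun θ => matL X.B K θ i j :=
  RealPeriodic.matrix_mul (RealPeriodic.matrix_mul (fun a b => hK.stripFun_DK b a)
    (hK.stripFun_Binv hρ)) hK.stripFun_DK i j

end Coefficients

/-! ### The Poisson structure along the torus -/

section Geometry

variable {n : ℕ} {S : GenHamSystem n} {D : Set (Idx n → ℂ)} {X : HolomorphicExtension S D}
  {ρ : ℝ} {K : (Fin n → ℂ) → Idx n → ℂ}

theorem NondegenerateTorus.realTorus_mem (hK : NondegenerateTorus X ρ K) (x : Fin n → ℝ) :
    realTorus K x ∈ S.dom := hK.real_mapsTo x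

theorem NondegenerateTorus.toC_realTorus_mem (hK : NondegenerateTorus X ρ K) (hρ : 0 < ρ)
    (x : Fin n → ℝ) : toC (realTorus K x) ∈ D := by
  rw [← hK.toC_realTorus hρ]
  exact hK.mapsTo_strip (toC_mem_strip hρ x)

theorem NondegenerateTorus.B_real (hK : NondegenerateTorus X ρ K) (hρ : 0 < ρ)
    (x : Fin n → ℝ) :
    X.B (K (toC x)) = (S.B (realTorus K x)).map (fun t : ℝ => (t : ℂ)) := by
  rw [hK.toC_realTorus hρ]
  exact X.B_extends _ (hK.realTorus_mem x) (hK.toC_realTorus_mem hρ x)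

theorem NondegenerateTorus.partialB_real (hK : NondegenerateTorus X ρ K) (hρ : 0 < ρ)
    (x : Fin n → ℝ) (l i j : Idx n) :
    partialD ℂ l (fun y => X.B y i j) (K (toC x)) =
      (partialD ℝ l (fun y => S.B y i j) (realTorus K x) : ℝ) := by
  have hmem := hK.toC_realTorus_mem hρ x
  have h := (fderiv_ofReal_eq (F := fun y => X.B y i j) (g := fun y => S.B y i j)
    ((phaseFun_B X i j).differentiableAt X.isOpen hmem) (by
      filter_upwards [S.isOpen_dom.mem_nhds (hK.realTorus_mem x),
        (X.isOpen.preimage continuous_toC).mem_nhds hmem] with y hy hyD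
      rw [X.B_extends y hy hyD]; rfl) (Pi.single l 1)).2
  rw [toC_single] at h
  rw [hK.toC_realTorus hρ]
  exact h

/-- Skew-symmetry of the structure matrix persists along the complexified torus. -/
theorem NondegenerateTorus.B_transpose (hK : NondegenerateTorus X ρ K) (hρ : 0 < ρ)
    {θ : Fin n → ℂ} (hθ : θ ∈ strip n ρ) : (X.B (K θ))ᵀ = -X.B (K θ) := by
  ext i j
  refine eqOn_strip_of_real (f := fun θ => X.B (K θ) j i) (g := fun θ => -X.B (K θ) i j)
    (hK.stripFun_B hρ j i).holo (hK.stripFun_B hρ i j).neg.holo (fun x => ?_) hθ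
  simp only [hK.B_real hρ, Matrix.map_apply]
  rw [S.skew _ (hK.realTorus_mem x) j i, Complex.ofReal_neg]

theorem NondegenerateTorus.partialB_swap (hK : NondegenerateTorus X ρ K) (hρ : 0 < ρ)
    {θ : Fin n → ℂ} (hθ : θ ∈ strip n ρ) (l i j : Idx n) :
    partialD ℂ l (fun y => X.B y j i) (K θ) = -partialD ℂ l (fun y => X.B y i j) (K θ) := by
  refine eqOn_strip_of_real (hK.stripFun_partialB hρ l j i).holo
    (hK.stripFun_partialB hρ l i j).neg.holo (fun x => ?_) hθ
  simp only [hK.partialB_real hρ]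
  rw [← Complex.ofReal_neg]
  congr 1
  have h : (fun y => S.B y j i) =ᶠ[𝓝 (realTorus K x)] fun y => -S.B y i j := by
    filter_upwards [S.isOpen_dom.mem_nhds (hK.realTorus_mem x)] with y hy using S.skew y hy j i
  rw [partialD, partialD, h.fderiv_eq, fderiv_fun_neg]
  rfl

theorem NondegenerateTorus.jacobi (hK : NondegenerateTorus X ρ K) (hρ : 0 < ρ)
    {θ : Fin n → ℂ} (hθ : θ ∈ strip n ρ) (i j k : Idx n) :
    ∑ l, (partialD ℂ l (fun y => X.B y i j) (K θ) * X.B (K θ) l k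
        + partialD ℂ l (fun y => X.B y j k) (K θ) * X.B (K θ) l i
        + partialD ℂ l (fun y => X.B y k i) (K θ) * X.B (K θ) l j) = 0 := by
  have hd : StripFun n ρ fun θ => ∑ l, (partialD ℂ l (fun y => X.B y i j) (K θ) * X.B (K θ) l k
        + partialD ℂ l (fun y => X.B y j k) (K θ) * X.B (K θ) l i
        + partialD ℂ l (fun y => X.B y k i) (K θ) * X.B (K θ) l j) :=
    RealPeriodic.sum fun l _ =>
      (((hK.stripFun_partialB hρ l i j).mul (hK.stripFun_B hρ l k)).add
        ((hK.stripFun_partialB hρ l j k).mul (hK.stripFun_B hρ l i))).add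
        ((hK.stripFun_partialB hρ l k i).mul (hK.stripFun_B hρ l j))
  refine eq_zero_of_real hd.holo (fun x => ?_) hθ
  simp only [hK.partialB_real hρ, hK.B_real hρ, Matrix.map_apply]
  exact_mod_cast S.jacobi _ (hK.realTorus_mem x) i j k

theorem Psi_transpose (X : HolomorphicExtension S D) {z : Idx n → ℂ} (hz : z ∈ D) :
    (Psi X.H z)ᵀ = Psi X.H z := by
  ext i j
  rw [Matrix.transpose_apply, Psi_apply X hz, Psi_apply X hz]
  have h1 : ∀ᶠ y in 𝓝 z, HasFDerivAt X.H (fderiv ℂ X.H y) y := by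
    filter_upwards [X.isOpen.mem_nhds hz] with y hy
    exact ((phaseFun_H X).differentiableAt X.isOpen hy).hasFDerivAt
  have h2 : HasFDerivAt (fderiv ℂ X.H) (fderiv ℂ (fderiv ℂ X.H) z) z :=
    ((differentiableOn_fderiv X.isOpen X.H_holo).differentiableAt
      (X.isOpen.mem_nhds hz)).hasFDerivAt
  have h3 : ∀ a b : Idx n, partialD ℂ a (fun y => grad X.H y b) z =
      fderiv ℂ (fderiv ℂ X.H) z (Pi.single a 1) (Pi.single b 1) := fun a b => by
    have h4 : HasFDerivAt (fun y => fderiv ℂ X.H y (Pi.single b 1)) _ z :=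
      h2.clm_apply (hasFDerivAt_const (Pi.single b 1 : Idx n → ℂ) z)
    change fderiv ℂ (fun y => fderiv ℂ X.H y (Pi.single b 1)) z (Pi.single a 1) = _
    rw [h4.fderiv]
    simp
  rw [h3, h3]
  exact second_derivative_symmetric_of_eventually h1 h2 _ _

/-- The infinitesimal form of the invariance of the Poisson structure under the flow of
`B∇H`; this is where the Jacobi identity enters. -/
theorem NondegenerateTorus.matA_mul_B_add (hK : NondegenerateTorus X ρ K) (hρ : 0 < ρ)
    {θ : Fin n → ℂ} (hθ : θ ∈ strip n ρ) :
    matA X.B X.H K θ * X.B (K θ) + X.B (K θ) * (matA X.B X.H K θ)ᵀ =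
      dirB X.B (K θ) (X.B (K θ) *ᵥ grad X.H (K θ)) := by
  have hB := hK.B_transpose hρ hθ
  have hPsi := Psi_transpose X (hK.mapsTo_strip hθ)
  have h1 : matA X.B X.H K θ * X.B (K θ) + X.B (K θ) * (matA X.B X.H K θ)ᵀ =
      Phi X.B X.H (K θ) * X.B (K θ) + X.B (K θ) * (Phi X.B X.H (K θ))ᵀ := by
    rw [matA, Matrix.transpose_add, Matrix.transpose_mul, hB, hPsi]
    noncomm_ring
  rw [h1]
  ext i j
  have hJ : ∑ l, grad X.H (K θ) l *
      ∑ k, (partialD ℂ k (fun y => X.B y i j) (K θ) * X.B (K θ) k l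
        + partialD ℂ k (fun y => X.B y j l) (K θ) * X.B (K θ) k i
        + partialD ℂ k (fun y => X.B y l i) (K θ) * X.B (K θ) k j) = 0 :=
    Finset.sum_eq_zero fun l _ => by rw [hK.jacobi hρ hθ, mul_zero]
  have hs : ∀ k, X.B (K θ) k i = -X.B (K θ) i k := fun k => by
    simpa using congrFun (congrFun hB i) k
  have hd : ∀ k l, partialD ℂ k (fun y => X.B y l i) (K θ) =
      -partialD ℂ k (fun y => X.B y i l) (K θ) := fun k l => hK.partialB_swap hρ hθ k i l
  simp only [hs, hd, Finset.mul_sum] at hJ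
  rw [Finset.sum_comm] at hJ
  simp only [Matrix.add_apply, Matrix.mul_apply, Matrix.transpose_apply, dirB_apply, Phi,
    Matrix.of_apply, Matrix.mulVec, dotProduct]
  simp only [Finset.mul_sum, Finset.sum_mul]
  rw [← sub_eq_zero, ← neg_eq_zero, ← hJ]
  simp only [← Finset.sum_add_distrib, ← Finset.sum_sub_distrib, ← Finset.sum_neg_distrib]
  refine Finset.sum_congr rfl fun k _ => Finset.sum_congr rfl fun l _ => ?_
  ring

theorem StripFun.contDiff_real {f : (Fin n → ℂ) → ℂ} (hf : DifferentiableOn ℂ f (strip n ρ))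
    (hρ : 0 < ρ) : ContDiff ℝ 1 (fun x => f (toC x)) ∧ ∀ x v,
      fderiv ℝ (fun x => f (toC x)) x v = fderiv ℂ f (toC x) (toC v) := by
  have h1 : ∀ x, HasFDerivAt (fun x => f (toC x))
      (((fderiv ℂ f (toC x)).restrictScalars ℝ).comp (toCL (Fin n))) x := fun x =>
    ((hf.differentiableAt (isOpen_strip.mem_nhds (toC_mem_strip hρ x))).hasFDerivAt.restrictScalars
      ℝ).comp x (toCL (Fin n)).hasFDerivAt
  refine ⟨contDiff_one_iff_fderiv.2 ⟨fun x => (h1 x).differentiableAt, ?_⟩, fun x v => by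
    rw [(h1 x).fderiv]; rfl⟩
  rw [funext fun x => (h1 x).fderiv]
  have h2 : Continuous fun x => fderiv ℂ f (toC x) :=
    (differentiableOn_fderiv isOpen_strip hf).continuousOn.comp_continuous continuous_toC
      (toC_mem_strip hρ)
  exact ((ContinuousLinearMap.continuous_restrictScalars ..).comp h2).clm_comp continuous_const

/-- Mixed second derivatives of `K`. -/
theorem NondegenerateTorus.fderiv_DK_comm (hK : NondegenerateTorus X ρ K) {θ : Fin n → ℂ}
    (hθ : θ ∈ strip n ρ) (l : Idx n) (i j : Fin n) :
    fderiv ℂ (fun τ => DK K τ l j) θ (Pi.single i 1) =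
      fderiv ℂ (fun τ => DK K τ l i) θ (Pi.single j 1) := by
  have hKl := hK.differentiableOn_apply l
  have h1 : ∀ᶠ y in 𝓝 θ, HasFDerivAt (fun τ => K τ l) (fderiv ℂ (fun τ => K τ l) y) y := by
    filter_upwards [isOpen_strip.mem_nhds hθ] with y hy
    exact (hKl.differentiableAt (isOpen_strip.mem_nhds hy)).hasFDerivAt
  have h2 : HasFDerivAt (fderiv ℂ fun τ => K τ l) (fderiv ℂ (fderiv ℂ fun τ => K τ l) θ) θ :=
    ((differentiableOn_fderiv isOpen_strip hKl).differentiableAt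
      (isOpen_strip.mem_nhds hθ)).hasFDerivAt
  have h3 : ∀ a b : Fin n, fderiv ℂ (fun τ => DK K τ l b) θ (Pi.single a 1) =
      fderiv ℂ (fderiv ℂ fun τ => K τ l) θ (Pi.single a 1) (Pi.single b 1) := fun a b => by
    have h4 : HasFDerivAt (fun y => fderiv ℂ (fun τ => K τ l) y (Pi.single b 1)) _ θ :=
      h2.clm_apply (hasFDerivAt_const (Pi.single b 1 : Fin n → ℂ) θ)
    have h5 : (fun τ => DK K τ l b) =ᶠ[𝓝 θ]
        fun y => fderiv ℂ (fun τ => K τ l) y (Pi.single b 1) := by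
      filter_upwards [isOpen_strip.mem_nhds hθ] with y hy using hK.DK_apply hy l b
    rw [h5.fderiv_eq, h4.fderiv]
    simp
  rw [h3, h3]
  exact second_derivative_symmetric_of_eventually h1 h2 _ _

end Geometry

/-! ### The pull-back of the symplectic form -/

section Pullback

variable {n : ℕ} {S : GenHamSystem n} {D : Set (Idx n → ℂ)} {X : HolomorphicExtension S D}
  {ρ : ℝ} {K : (Fin n → ℂ) → Idx n → ℂ}

/-- The components `a_j = ∑ c_l(K) ∂_j K_l` of the pull-back of a 1-form `∑ c_l dz_l` to the real
torus. -/
noncomputable def pullbackForm (c : (Idx n → ℝ) → Idx n → ℝ) (K : (Fin n → ℂ) → Idx n → ℂ)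
    (j : Fin n) (x : Fin n → ℝ) : ℂ :=
  ∑ l, (c (realTorus K x) l : ℂ) * DK K (toC x) l j

theorem NondegenerateTorus.realTorus_contDiff (hK : NondegenerateTorus X ρ K) (hρ : 0 < ρ) :
    ContDiff ℝ 1 (realTorus K) :=
  contDiff_pi.2 fun l => Complex.reCLM.contDiff.comp
    (StripFun.contDiff_real (hK.differentiableOn_apply l) hρ).1

theorem NondegenerateTorus.fderiv_realTorus (hK : NondegenerateTorus X ρ K) (hρ : 0 < ρ)
    (x : Fin n → ℝ) (i : Fin n) (m : Idx n) :
    ((fderiv ℝ (realTorus K) x (Pi.single i 1) m : ℝ) : ℂ) = DK K (toC x) m i := by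
  have hx := toC_mem_strip hρ x
  have h1 := (fderiv_ofReal_eq (F := fun τ => K τ m) (g := fun y => realTorus K y m)
    ((hK.differentiableOn_apply m).differentiableAt (isOpen_strip.mem_nhds hx))
    (Eventually.of_forall fun y => by rw [hK.toC_realTorus hρ]; rfl) (Pi.single i 1)).2
  have h2 := ((hK.realTorus_contDiff hρ).differentiable one_ne_zero x).hasFDerivAt
  rw [hK.DK_apply hx, ← toC_single, h1, (hasFDerivAt_pi'.1 h2 m).fderiv]
  rfl

variable {c : (Idx n → ℝ) → Idx n → ℝ}

theorem NondegenerateTorus.pullbackForm_contDiff (hK : NondegenerateTorus X ρ K) (hρ : 0 < ρ)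
    (hc : ContDiffOn ℝ (⊤ : ℕ∞) c S.dom) (j : Fin n) : ContDiff ℝ 1 (pullbackForm c K j) := by
  refine ContDiff.sum fun l _ => ContDiff.mul ?_
    (StripFun.contDiff_real (hK.stripFun_DK l j).holo hρ).1
  have h1 : ContDiff ℝ 1 (c ∘ realTorus K) := by
    rw [← contDiffOn_univ]
    exact (hc.of_le (by exact_mod_cast le_top)).comp (hK.realTorus_contDiff hρ).contDiffOn
      fun x _ => hK.realTorus_mem x
  exact Complex.ofRealCLM.contDiff.comp (contDiff_pi.1 h1 l)

theorem NondegenerateTorus.isZPeriodic_pullbackForm (hK : NondegenerateTorus X ρ K)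
    (hρ : 0 < ρ)
    (hc : ∀ v, IsPeriod S.angular v → ∀ x ∈ S.dom, c (x + v) = c x) (j : Fin n) :
    IsZPeriodic (pullbackForm c K j) := by
  intro k x
  have hx := toC_mem_strip hρ x
  have h1 : toC x + intC k ∈ strip n ρ := by
    rw [intC_eq_toC]; exact add_toC_mem_strip hx _
  obtain ⟨v, hv, h2⟩ := hK.mem.periodic k _ (strip_subset_closedStrip hx)
    (strip_subset_closedStrip h1)
  have h3 : realTorus K (x + fun i => (k i : ℝ)) = realTorus K x + v := by
    funext i
    simp only [realTorus, toC_add, ← intC_eq_toC, h2, Pi.add_apply, Complex.add_re]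
    rfl
  have h4 : ∀ l, DK K (toC (x + fun i => (k i : ℝ))) l j = DK K (toC x) l j := fun l =>
    StripFun.isZPeriodic_real (hK.stripFun_DK l j) hρ k x
  simp only [pullbackForm, h3, h4, hc v hv _ (hK.realTorus_mem x)]

theorem NondegenerateTorus.fderiv_pullbackForm (hK : NondegenerateTorus X ρ K) (hρ : 0 < ρ)
    (hc : ContDiffOn ℝ (⊤ : ℕ∞) c S.dom) (i j : Fin n) (x : Fin n → ℝ) :
    fderiv ℝ (pullbackForm c K j) x (Pi.single i 1) =
      ∑ l, ((∑ m, (jac ℝ c (realTorus K x) l m : ℂ) * DK K (toC x) m i) * DK K (toC x) l j +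
        (c (realTorus K x) l : ℂ) *
          fderiv ℂ (fun τ => DK K τ l j) (toC x) (Pi.single i 1)) := by
  have hκ := ((hK.realTorus_contDiff hρ).differentiable one_ne_zero x).hasFDerivAt
  have hcd : DifferentiableAt ℝ c (realTorus K x) :=
    (hc.differentiableOn (by simp)).differentiableAt
      (S.isOpen_dom.mem_nhds (hK.realTorus_mem x))
  have hterm : ∀ l, HasFDerivAt
      (fun y => (c (realTorus K y) l : ℂ) * DK K (toC y) l j) _ x := fun l =>
    (Complex.ofRealCLM.hasFDerivAt.comp x
      (hasFDerivAt_pi'.1 (hcd.hasFDerivAt.comp x hκ) l)).mul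
    ((StripFun.contDiff_real (hK.stripFun_DK l j).holo hρ).1.differentiable
      one_ne_zero x).hasFDerivAt
  have hsum : HasFDerivAt (pullbackForm c K j) _ x := HasFDerivAt.fun_sum fun l _ => hterm l
  rw [hsum.fderiv, _root_.sum_apply]
  refine Finset.sum_congr rfl fun l _ => ?_
  have h1 : ∑ m, (jac ℝ c (realTorus K x) l m : ℂ) * DK K (toC x) m i =
      ((fderiv ℝ c (realTorus K x) (fderiv ℝ (realTorus K) x (Pi.single i 1)) l : ℝ) : ℂ) := by
    conv_rhs => rw [pi_eq_sum_univ' (fderiv ℝ (realTorus K) x (Pi.single i 1)), map_sum]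
    simp only [Finset.sum_apply, Complex.ofReal_sum]
    refine Finset.sum_congr rfl fun m _ => ?_
    rw [map_smul, Pi.smul_apply, smul_eq_mul, Complex.ofReal_mul,
      hK.fderiv_realTorus hρ, mul_comm]
    rfl
  rw [h1]
  have h2 := (StripFun.contDiff_real (hK.stripFun_DK l j).holo hρ).2 x (Pi.single i 1)
  rw [toC_single] at h2
  simp only [_root_.add_apply, _root_.smul_apply, smul_eq_mul, h2,
    ContinuousLinearMap.comp_apply, ContinuousLinearMap.proj_apply]
  simp only [Complex.ofRealCLM_apply, Function.comp_apply]
  ring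

/-- The pull-back of the exact form `Ω = dα` to the real torus is `d(K^*α)`. -/
theorem NondegenerateTorus.matL_eq_d_pullbackForm (hK : NondegenerateTorus X ρ K) (hρ : 0 < ρ)
    (hc : ContDiffOn ℝ (⊤ : ℕ∞) c S.dom)
    (hex : ∀ x ∈ S.dom, (S.B x)⁻¹ = (jac ℝ c x)ᵀ - jac ℝ c x) (i j : Fin n) (x : Fin n → ℝ) :
    matL X.B K (toC x) i j = fderiv ℝ (pullbackForm c K j) x (Pi.single i 1) -
      fderiv ℝ (pullbackForm c K i) x (Pi.single j 1) := by
  have hx := toC_mem_strip hρ x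
  rw [hK.fderiv_pullbackForm hρ hc, hK.fderiv_pullbackForm hρ hc, ← Finset.sum_sub_distrib]
  simp only [hK.fderiv_DK_comm hx _ i j]
  have hinv : ∀ m l, (X.B (K (toC x)))⁻¹ m l =
      (jac ℝ c (realTorus K x) l m : ℂ) - jac ℝ c (realTorus K x) m l := by
    intro m l
    have h1 : (X.B (K (toC x)))⁻¹ = ((S.B (realTorus K x))⁻¹).map (fun t : ℝ => (t : ℂ)) := by
      refine Matrix.inv_eq_right_inv ?_
      have h2 := Matrix.mul_nonsing_inv (S.B (realTorus K x))
        ((Matrix.isUnit_iff_isUnit_det _).1 (S.invertible _ (hK.realTorus_mem x)))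
      rw [hK.B_real hρ]
      have h3 := congrArg (fun A => A.map Complex.ofRealHom) h2
      simp only [Matrix.map_mul] at h3
      rw [Matrix.map_one _ (map_zero _) (map_one _)] at h3
      exact h3
    rw [h1, hex _ (hK.realTorus_mem x)]
    simp
  have hsw : ∑ l, (∑ m, (jac ℝ c (realTorus K x) l m : ℂ) * DK K (toC x) m j) *
      DK K (toC x) l i = ∑ l, ∑ m, (jac ℝ c (realTorus K x) m l : ℂ) * DK K (toC x) l j *
        DK K (toC x) m i := by
    simp only [Finset.sum_mul]
    exact Finset.sum_comm
  simp only [matL, Matrix.mul_apply, Matrix.transpose_apply, hinv, add_sub_add_right_eq_sub]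
  rw [Finset.sum_sub_distrib, hsw, ← Finset.sum_sub_distrib]
  refine Finset.sum_congr rfl fun l _ => ?_
  rw [Finset.sum_mul, Finset.sum_mul, ← Finset.sum_sub_distrib]
  exact Finset.sum_congr rfl fun m _ => by ring

/-- Contraction of `K^*Ω` with `ω`, up to sign: `L ω = ∇(H ∘ K) + p_y`. -/
theorem NondegenerateTorus.matL_mulVec (hK : NondegenerateTorus X ρ K) {θ : Fin n → ℂ}
    (hθ : θ ∈ strip n ρ) (ω : Fin n → ℝ) (i : Fin n) :
    ∑ j, matL X.B K θ i j * toC ω j =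
      fderiv ℂ (fun τ => X.H (K τ)) θ (Pi.single i 1) + py X.B X.H ω K θ i := by
  have hu := (Matrix.isUnit_iff_isUnit_det _).1 (X.invertible _ (hK.mapsTo_strip hθ))
  have h1 : matL X.B K θ *ᵥ toC ω = (DK K θ)ᵀ *ᵥ grad X.H (K θ) + py X.B X.H ω K θ := by
    have h2 : DK K θ *ᵥ toC ω = X.B (K θ) *ᵥ grad X.H (K θ) - err X.B X.H ω K θ := by
      rw [hK.err_eq hθ, sub_sub_cancel]
    rw [matL, ← Matrix.mulVec_mulVec, h2, Matrix.mulVec_sub, Matrix.mulVec_mulVec,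
      Matrix.mul_assoc, Matrix.nonsing_inv_mul _ hu, Matrix.mul_one, py, sub_eq_add_neg]
  have h3 : fderiv ℂ (fun τ => X.H (K τ)) θ (Pi.single i 1) =
      ((DK K θ)ᵀ *ᵥ grad X.H (K θ)) i := by
    have h4 : HasFDerivAt (fun τ => X.H (K τ)) _ θ :=
      ((phaseFun_H X).differentiableAt X.isOpen (hK.mapsTo_strip hθ)).hasFDerivAt.comp θ
        (hK.differentiableAt hθ).hasFDerivAt
    rw [h4.fderiv, ContinuousLinearMap.comp_apply, fderiv_eq_sum_partialD]
    exact Finset.sum_congr rfl fun l _ => mul_comm _ _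
  rw [h3]
  exact congrFun h1 i

theorem kdot_single (k : Fin n → ℤ) (i : Fin n) : kdot k (Pi.single i 1) = k i := by
  simp [kdot, Pi.single_apply]

theorem StripFun.fc_fderiv {f : (Fin n → ℂ) → ℂ} (hf : StripFun n ρ f) (hρ : 0 < ρ)
    (v : Fin n → ℝ) (k : Fin n → ℤ) :
    fc (fun x => fderiv ℂ f (toC x) (toC v)) k =
      2 * Real.pi * Complex.I * kdot k (toC v) * fc (fun x => f (toC x)) k := by
  obtain ⟨h1, h2⟩ := StripFun.contDiff_real hf.holo hρ
  rw [← KAM.fc_fderiv h1 (StripFun.isZPeriodic_real hf hρ)]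
  simp only [h2]

/-- Fourier coefficients of `K^*Ω = da`. -/
theorem NondegenerateTorus.exists_fc_matL (hK : NondegenerateTorus X ρ K) (hρ : 0 < ρ) :
    ∃ a : Fin n → (Fin n → ℤ) → ℂ, ∀ i j k, fc (fun x => matL X.B K (toC x) i j) k =
      2 * Real.pi * Complex.I * (k i * a j k - k j * a i k) := by
  obtain ⟨c, hc, hcp, hex⟩ := S.exact
  refine ⟨fun j k => fc (pullbackForm c K j) k, fun i j k => ?_⟩
  have hcd := fun j => hK.pullbackForm_contDiff hρ hc j
  have hcont : ∀ i j, Continuous fun x => fderiv ℝ (pullbackForm c K j) x (Pi.single i 1) :=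
    fun i j => ((hcd j).continuous_fderiv one_ne_zero).clm_apply continuous_const
  simp only [hK.matL_eq_d_pullbackForm hρ hc hex]
  rw [fc_sub (hcont i j) (hcont j i), fc_fderiv (hcd j) (hK.isZPeriodic_pullbackForm hρ hcp j),
    fc_fderiv (hcd i) (hK.isZPeriodic_pullbackForm hρ hcp i)]
  simp only [toC_single, kdot_single]
  ring

theorem NondegenerateTorus.sum_fc_matL (hK : NondegenerateTorus X ρ K) (hρ : 0 < ρ)
    (ω : Fin n → ℝ) (i : Fin n) (k : Fin n → ℤ) :
    ∑ j, fc (fun x => matL X.B K (toC x) i j) k * toC ω j =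
      2 * Real.pi * Complex.I * k i * fc (fun x => X.H (K (toC x))) k +
        fc (fun x => py X.B X.H ω K (toC x) i) k := by
  have hLc := fun j => StripFun.continuous_real (hK.stripFun_matL hρ i j) hρ
  have hLc' : ∀ j, Continuous fun x => toC ω j * matL X.B K (toC x) i j := fun j =>
    continuous_const.mul (hLc j)
  have hsc : Continuous fun x => ∑ j, toC ω j * matL X.B K (toC x) i j :=
    continuous_finsetSum _ fun j _ => hLc' j
  have hH := hK.comp hρ (phaseFun_H X)
  have h1 : fc (fun x => ∑ j, toC ω j * matL X.B K (toC x) i j) k =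
      ∑ j, fc (fun x => matL X.B K (toC x) i j) k * toC ω j := by
    rw [fc_sum Finset.univ fun j _ => hLc' j]
    exact Finset.sum_congr rfl fun j _ => by rw [fc_const_mul, mul_comm]
  have h2 := StripFun.fc_fderiv hH hρ (Pi.single i 1) k
  simp only [toC_single, kdot_single] at h2
  rw [← h1, ← h2, ← sub_eq_iff_eq_add,
    ← fc_sub hsc
      (StripFun.continuous_real (hK.stripFun_py hρ ω i) hρ)]
  congr 1
  funext x
  rw [sub_eq_iff_eq_add, ← hK.matL_mulVec (toC_mem_strip hρ x)]
  exact Finset.sum_congr rfl fun j _ => mul_comm _ _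

/-- The average of `p_y` vanishes, because `K^*Ω` and `d(H ∘ K)` are exact. -/
theorem NondegenerateTorus.fc_py_zero (hK : NondegenerateTorus X ρ K) (hρ : 0 < ρ)
    (ω : Fin n → ℝ) (i : Fin n) : fc (fun x => py X.B X.H ω K (toC x) i) 0 = 0 := by
  obtain ⟨a, ha⟩ := hK.exists_fc_matL hρ
  have h := hK.sum_fc_matL hρ ω i 0
  simp only [ha] at h
  simpa using h.symm

variable {γ σ : ℝ} {ω : Fin n → ℝ}

/-- If `∂_ω u = -p_y`, then `L_{ij} = ∂_i u_j - ∂_j u_i`.  So `L` is controlled by the error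
through one small divisor equation and one derivative, and no derivative of `B` is involved. -/
theorem NondegenerateTorus.matL_eq_of_fderiv_eq (hK : NondegenerateTorus X ρ K) (hρ : 0 < ρ)
    (hγ : 0 < γ) (hω : IsDiophantine γ σ ω) {u : Fin n → (Fin n → ℂ) → ℂ}
    (hu : ∀ j, StripFun n ρ (u j))
    (hueq : ∀ j, ∀ θ ∈ strip n ρ, fderiv ℂ (u j) θ (toC ω) = -py X.B X.H ω K θ j)
    {θ : Fin n → ℂ} (hθ : θ ∈ strip n ρ) (i j : Fin n) :
    matL X.B K θ i j =
      fderiv ℂ (u j) θ (Pi.single i 1) - fderiv ℂ (u i) θ (Pi.single j 1) := by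
  have hdu : ∀ i j, StripFun n ρ fun θ => fderiv ℂ (u j) θ (Pi.single i 1) := fun i j => by
    rw [← toC_single]
    exact (hu j).fderiv_apply isOpen_strip isOpen_univ _
  have hduc := fun i j => StripFun.continuous_real (hdu i j) hρ
  have hdu' := (hdu i j).sub (hdu j i)
  refine eqOn_strip_of_real (hK.stripFun_matL hρ i j).holo hdu'.holo (fun x => ?_) hθ
  refine eq_of_fc_eq (StripFun.continuous_real (hK.stripFun_matL hρ i j) hρ)
    (StripFun.continuous_real hdu' hρ) (StripFun.isZPeriodic_real (hK.stripFun_matL hρ i j) hρ)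
    (StripFun.isZPeriodic_real hdu' hρ) (fun k => ?_) x
  obtain ⟨a, ha⟩ := hK.exists_fc_matL hρ
  have hfu : ∀ i j, fc (fun x => fderiv ℂ (u j) (toC x) (Pi.single i 1)) k =
      2 * Real.pi * Complex.I * k i * fc (fun x => u j (toC x)) k := fun i j => by
    have := StripFun.fc_fderiv (hu j) hρ (Pi.single i 1) k
    simpa only [toC_single, kdot_single] using this
  rw [fc_sub (hduc i j) (hduc j i), hfu, hfu, ha]
  rcases eq_or_ne k 0 with rfl | hk
  · simp
  have hs : (2 * Real.pi * Complex.I : ℂ) ≠ 0 := Complex.two_pi_I_ne_zero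
  have hd : (divisor ω k : ℂ) ≠ 0 := Complex.ofReal_ne_zero.2 (divisor_ne_zero hω hγ hk)
  have hU : ∀ j, 2 * Real.pi * Complex.I * divisor ω k * fc (fun x => u j (toC x)) k =
      -fc (fun x => py X.B X.H ω K (toC x) j) k := fun j => by
    have h1 := StripFun.fc_fderiv (hu j) hρ ω k
    rw [kdot_toC] at h1
    rw [← h1, ← neg_one_mul, ← fc_const_mul]
    congr 1
    funext x
    rw [hueq j _ (toC_mem_strip hρ x), neg_one_mul]
  have hE : ∀ i, 2 * Real.pi * Complex.I *
      (k i * (∑ j, a j k * toC ω j) - divisor ω k * a i k) =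
      2 * Real.pi * Complex.I * k i * fc (fun x => X.H (K (toC x))) k +
        fc (fun x => py X.B X.H ω K (toC x) i) k := fun i => by
    rw [← hK.sum_fc_matL hρ]
    simp only [ha]
    rw [← kdot_toC, kdot, Finset.mul_sum, Finset.sum_mul, ← Finset.sum_sub_distrib,
      Finset.mul_sum]
    exact Finset.sum_congr rfl fun j _ => by ring
  refine mul_left_cancel₀ (mul_ne_zero hs hd) ?_
  linear_combination 2 * Real.pi * Complex.I * k j * (hU i + hE i) -
    2 * Real.pi * Complex.I * k i * (hU j + hE j)

end Pullback

/-! ### The frame and its inverse -/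

section Algebra

variable {n : ℕ} {S : GenHamSystem n} {D : Set (Idx n → ℂ)} {X : HolomorphicExtension S D}
  {ρ : ℝ} {K : (Fin n → ℂ) → Idx n → ℂ} {θ : Fin n → ℂ}

/-- The block `Q = Nᵀ DKᵀ B DK N` of `V`. -/
noncomputable def matQ (B : (Idx n → ℂ) → Matrix (Idx n) (Idx n) ℂ)
    (K : (Fin n → ℂ) → Idx n → ℂ) (θ : Fin n → ℂ) : Matrix (Fin n) (Fin n) ℂ :=
  (matN K θ)ᵀ * (DK K θ)ᵀ * B (K θ) * DK K θ * matN K θ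

theorem matV_mul (B : (Idx n → ℂ) → Matrix (Idx n) (Idx n) ℂ)
    (K : (Fin n → ℂ) → Idx n → ℂ) (θ : Fin n → ℂ) :
    matV B K θ * Matrix.fromBlocks (-matQ B K θ) (-1) 1 0 = 1 := by
  rw [matV, Matrix.fromBlocks_multiply]
  simp [matQ]

theorem matV_inv (B : (Idx n → ℂ) → Matrix (Idx n) (Idx n) ℂ)
    (K : (Fin n → ℂ) → Idx n → ℂ) (θ : Fin n → ℂ) :
    (matV B K θ)⁻¹ = Matrix.fromBlocks (-matQ B K θ) (-1) 1 0 :=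
  Matrix.inv_eq_right_inv (matV_mul B K θ)

theorem matV_mul_inv (B : (Idx n → ℂ) → Matrix (Idx n) (Idx n) ℂ)
    (K : (Fin n → ℂ) → Idx n → ℂ) (θ : Fin n → ℂ) : matV B K θ * (matV B K θ)⁻¹ = 1 := by
  rw [matV_inv, matV_mul]

theorem matN_transpose (K : (Fin n → ℂ) → Idx n → ℂ) (θ : Fin n → ℂ) :
    (matN K θ)ᵀ = matN K θ := by
  rw [matN, Matrix.transpose_nonsing_inv, Matrix.transpose_mul, Matrix.transpose_transpose]

theorem NondegenerateTorus.gram_mul_matN (hK : NondegenerateTorus X ρ K)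
    (hθ : θ ∈ strip n ρ) : (DK K θ)ᵀ * DK K θ * matN K θ = 1 :=
  Matrix.mul_nonsing_inv _ ((Matrix.isUnit_iff_isUnit_det _).1 (hK.nd1 θ hθ))

theorem NondegenerateTorus.matN_mul_gram (hK : NondegenerateTorus X ρ K)
    (hθ : θ ∈ strip n ρ) : matN K θ * ((DK K θ)ᵀ * DK K θ) = 1 :=
  Matrix.nonsing_inv_mul _ ((Matrix.isUnit_iff_isUnit_det _).1 (hK.nd1 θ hθ))

theorem NondegenerateTorus.B_mul_inv (hK : NondegenerateTorus X ρ K)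
    (hθ : θ ∈ strip n ρ) : X.B (K θ) * (X.B (K θ))⁻¹ = 1 :=
  Matrix.mul_nonsing_inv _
    ((Matrix.isUnit_iff_isUnit_det _).1 (X.invertible _ (hK.mapsTo_strip hθ)))

theorem NondegenerateTorus.inv_mul_B (hK : NondegenerateTorus X ρ K)
    (hθ : θ ∈ strip n ρ) : (X.B (K θ))⁻¹ * X.B (K θ) = 1 :=
  Matrix.nonsing_inv_mul _
    ((Matrix.isUnit_iff_isUnit_det _).1 (X.invertible _ (hK.mapsTo_strip hθ)))

/-- The two block rows of `Mᵀ B⁻¹`. -/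
theorem NondegenerateTorus.matM_transpose_mul (hK : NondegenerateTorus X ρ K) (hρ : 0 < ρ)
    (hθ : θ ∈ strip n ρ) : (matM X.B K θ)ᵀ * (X.B (K θ))⁻¹ =
      Matrix.fromRows ((DK K θ)ᵀ * (X.B (K θ))⁻¹) (-(matN K θ * (DK K θ)ᵀ)) := by
  rw [matM, Matrix.transpose_fromCols, Matrix.fromRows_mul, Matrix.transpose_mul,
    Matrix.transpose_mul, hK.B_transpose hρ hθ, matN_transpose]
  congr 1
  rw [Matrix.mul_neg, Matrix.mul_neg, Matrix.neg_mul, Matrix.mul_assoc, Matrix.mul_assoc,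
    hK.B_mul_inv hθ, Matrix.mul_one]

/-- The matrix of `Ω` in the frame `M` is `V + R`. -/
theorem NondegenerateTorus.matM_transpose_mul_mul (hK : NondegenerateTorus X ρ K) (hρ : 0 < ρ)
    (hθ : θ ∈ strip n ρ) : (matM X.B K θ)ᵀ * (X.B (K θ))⁻¹ * matM X.B K θ =
      matV X.B K θ + matR X.B K θ := by
  rw [hK.matM_transpose_mul hρ hθ, matM, Matrix.fromRows_mul_fromCols, matV, matR,
    Matrix.fromBlocks_add]
  congr 1
  · rw [matL, zero_add]
  · rw [add_zero, ← Matrix.mul_assoc, ← Matrix.mul_assoc, Matrix.mul_assoc _ _ (X.B (K θ)),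
      hK.inv_mul_B hθ, Matrix.mul_one, hK.gram_mul_matN hθ]
  · rw [add_zero, Matrix.neg_mul, Matrix.mul_assoc, hK.matN_mul_gram hθ]
  · rw [add_zero, matN_transpose, Matrix.neg_mul]
    simp only [Matrix.mul_assoc]

/-- If `I + V⁻¹R` is invertible, then so is `M`, with `M⁻¹ = V⁻¹MᵀB⁻¹ + M_e`. -/
theorem NondegenerateTorus.matM_inv (hK : NondegenerateTorus X ρ K) (hρ : 0 < ρ)
    (hθ : θ ∈ strip n ρ) (hu : IsUnit (1 + (matV X.B K θ)⁻¹ * matR X.B K θ)) :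
    IsUnit (matM X.B K θ) ∧ (matM X.B K θ)⁻¹ =
      (1 + (matV X.B K θ)⁻¹ * matR X.B K θ)⁻¹ *
        ((matV X.B K θ)⁻¹ * ((matM X.B K θ)ᵀ * (X.B (K θ))⁻¹)) ∧
      (matM X.B K θ)⁻¹ =
        (matV X.B K θ)⁻¹ * ((matM X.B K θ)ᵀ * (X.B (K θ))⁻¹) + matMe X.B K θ := by
  set W := 1 + (matV X.B K θ)⁻¹ * matR X.B K θ with hW
  have hWinv : W⁻¹ * W = 1 := Matrix.nonsing_inv_mul _ ((Matrix.isUnit_iff_isUnit_det _).1 hu)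
  have hVV : (matV X.B K θ)⁻¹ * matV X.B K θ = 1 :=
    mul_eq_one_comm.1 (matV_mul_inv X.B K θ)
  have h1 : (W⁻¹ * ((matV X.B K θ)⁻¹ * ((matM X.B K θ)ᵀ * (X.B (K θ))⁻¹))) * matM X.B K θ
      = 1 := by
    rw [Matrix.mul_assoc, Matrix.mul_assoc, hK.matM_transpose_mul_mul hρ hθ, Matrix.mul_add,
      hVV, ← hW, hWinv]
  have h2 := Matrix.inv_eq_left_inv h1
  refine ⟨(Matrix.isUnit_iff_isUnit_det _).2 (Matrix.isUnit_det_of_left_inverse h1), h2, ?_⟩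
  rw [h2]
  have h3 : W⁻¹ = 1 - W⁻¹ * ((matV X.B K θ)⁻¹ * matR X.B K θ) := by
    have h4 : W⁻¹ * (W - (matV X.B K θ)⁻¹ * matR X.B K θ) = W⁻¹ := by
      rw [hW, add_sub_cancel_right, Matrix.mul_one]
    rw [Matrix.mul_sub, hWinv] at h4
    exact h4.symm
  conv_lhs => rw [h3]
  rw [matMe, ← hW, Matrix.sub_mul, Matrix.one_mul, sub_eq_add_neg]
  simp only [Matrix.mul_assoc]

theorem NondegenerateTorus.vecP_eq (hK : NondegenerateTorus X ρ K) (hρ : 0 < ρ)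
    (hθ : θ ∈ strip n ρ) (ω : Fin n → ℝ) : vecP X.B X.H ω K θ =
      -(((matV X.B K θ)⁻¹ * ((matM X.B K θ)ᵀ * (X.B (K θ))⁻¹)) *ᵥ err X.B X.H ω K θ) := by
  rw [hK.matM_transpose_mul hρ hθ, matV_inv, Matrix.fromBlocks_mul_fromRows,
    Matrix.fromRows_mulVec]
  funext i
  rcases i with i | i
  · simp only [vecP, Sum.elim_inl, px, Pi.neg_apply]
    congr 2
    rw [matQ, matN_transpose]
    simp only [Matrix.mul_sub, Matrix.mul_one, Matrix.neg_mul, Matrix.one_mul, Matrix.mul_assoc,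
      neg_neg]
    abel
  · simp only [vecP, Sum.elim_inr, py, Pi.neg_apply]
    congr 2
    simp

theorem NondegenerateTorus.vecP_add_vecW (hK : NondegenerateTorus X ρ K) (hρ : 0 < ρ)
    (hθ : θ ∈ strip n ρ) (hu : IsUnit (1 + (matV X.B K θ)⁻¹ * matR X.B K θ))
    (ω : Fin n → ℝ) : vecP X.B X.H ω K θ + vecW X.B X.H ω K θ =
      -((matM X.B K θ)⁻¹ *ᵥ err X.B X.H ω K θ) := by
  rw [hK.vecP_eq hρ hθ, vecW, (hK.matM_inv hρ hθ hu).2.2, Matrix.add_mulVec]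
  abel

theorem NondegenerateTorus.differentiableAt_matM (hK : NondegenerateTorus X ρ K) (hρ : 0 < ρ)
    (hθ : θ ∈ strip n ρ) (i j : Idx n) : DifferentiableAt ℂ (fun τ => matM X.B K τ i j) θ := by
  rcases j with j | j
  · exact (hK.stripFun_DK i j).differentiableAt isOpen_strip hθ
  · exact (hK.stripFun_BDKN hρ i j).differentiableAt isOpen_strip hθ

section ProductRule

variable {κ κ' κ'' : Type*} (ω : Fin n → ℝ)

theorem dOmegaMat_mul [Fintype κ'] {F : (Fin n → ℂ) → Matrix κ κ' ℂ}
    {G : (Fin n → ℂ) → Matrix κ' κ'' ℂ}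
    (hF : ∀ i j, DifferentiableAt ℂ (fun τ => F τ i j) θ)
    (hG : ∀ i j, DifferentiableAt ℂ (fun τ => G τ i j) θ) :
    dOmegaMat ω (fun τ => F τ * G τ) θ = dOmegaMat ω F θ * G θ + F θ * dOmegaMat ω G θ := by
  ext i j
  have h : HasFDerivAt (fun τ => ∑ l, F τ i l * G τ l j) _ θ :=
    HasFDerivAt.fun_sum fun l _ => (hF i l).hasFDerivAt.mul (hG l j).hasFDerivAt
  simp only [dOmegaMat, dOmega, Matrix.of_apply, Matrix.mul_apply, Matrix.add_apply]
  rw [h.fderiv, _root_.sum_apply, ← Finset.sum_add_distrib]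
  refine Finset.sum_congr rfl fun l _ => ?_
  simp only [_root_.add_apply, _root_.smul_apply, smul_eq_mul]
  ring

theorem dOmega_mulVec [Fintype κ] [Fintype κ'] {F : (Fin n → ℂ) → Matrix κ κ' ℂ}
    {ξ : (Fin n → ℂ) → κ' → ℂ}
    (hF : ∀ i j, DifferentiableAt ℂ (fun τ => F τ i j) θ) (hξ : DifferentiableAt ℂ ξ θ) :
    dOmega ω (fun τ => F τ *ᵥ ξ τ) θ = dOmegaMat ω F θ *ᵥ ξ θ + F θ *ᵥ dOmega ω ξ θ := by
  have hξi := hasFDerivAt_pi'.1 hξ.hasFDerivAt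
  have h : HasFDerivAt (fun τ i => ∑ l, F τ i l * ξ τ l) _ θ :=
    hasFDerivAt_pi.2 fun i => HasFDerivAt.fun_sum fun l _ => (hF i l).hasFDerivAt.mul (hξi l)
  funext i
  change fderiv ℂ (fun τ i => ∑ l, F τ i l * ξ τ l) θ (toC ω) i = _
  rw [h.fderiv]
  simp only [ContinuousLinearMap.coe_pi', _root_.sum_apply, Pi.add_apply, Matrix.mulVec,
    dotProduct, ← Finset.sum_add_distrib]
  refine Finset.sum_congr rfl fun l _ => ?_
  simp only [_root_.add_apply, _root_.smul_apply, smul_eq_mul, dOmegaMat, dOmega,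
    Matrix.of_apply, ContinuousLinearMap.comp_apply, ContinuousLinearMap.proj_apply]
  ring

end ProductRule

/-- Substituting `Δ = Mξ` gives `M` times the transformed equation, by the product rule. -/
theorem NondegenerateTorus.linearizedAt_iff (hK : NondegenerateTorus X ρ K) (hρ : 0 < ρ)
    (hθ : θ ∈ strip n ρ) (hu : IsUnit (1 + (matV X.B K θ)⁻¹ * matR X.B K θ))
    (ω : Fin n → ℝ) {ξ : (Fin n → ℂ) → Idx n → ℂ} (hξ : DifferentiableAt ℂ ξ θ) :
    LinearizedAt X.B X.H ω K (fun τ => matM X.B K τ *ᵥ ξ τ) θ ↔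
      TransformedAt X.B X.H ω K ξ θ := by
  have hM := (Matrix.isUnit_iff_isUnit_det _).1 (hK.matM_inv hρ hθ hu).1
  have h1 := Matrix.nonsing_inv_mul _ hM
  have h2 := Matrix.mul_nonsing_inv _ hM
  rw [LinearizedAt, TransformedAt, hK.vecP_add_vecW hρ hθ hu,
    dOmega_mulVec ω (hK.differentiableAt_matM hρ hθ) hξ]
  have key : (triS0 X.B X.H K θ + matC X.B X.H ω K θ) *ᵥ ξ θ - dOmega ω ξ θ =
      (matM X.B K θ)⁻¹ *ᵥ (matA X.B X.H K θ *ᵥ (matM X.B K θ *ᵥ ξ θ) -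
        (dOmegaMat ω (matM X.B K) θ *ᵥ ξ θ + matM X.B K θ *ᵥ dOmega ω ξ θ)) := by
    have h3 : triS0 X.B X.H K θ + matC X.B X.H ω K θ = (matM X.B K θ)⁻¹ *
        (matA X.B X.H K θ * matM X.B K θ - dOmegaMat ω (matM X.B K) θ) := by
      rw [matC, matE, Matrix.mul_sub _ _ (matM X.B K θ * _), ← Matrix.mul_assoc _ (matM X.B K θ)
        (triS0 X.B X.H K θ), h1, Matrix.one_mul]
      abel
    rw [h3, ← Matrix.mulVec_mulVec, Matrix.sub_mulVec, ← Matrix.mulVec_mulVec, ← sub_sub,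
      Matrix.mulVec_sub _ _ (matM X.B K θ *ᵥ dOmega ω ξ θ),
      Matrix.mulVec_mulVec (dOmega ω ξ θ), h1, Matrix.one_mulVec]
  rw [key]
  constructor
  · intro h
    rw [h, Matrix.mulVec_neg]
  · intro h
    have h4 := congrArg (fun v => matM X.B K θ *ᵥ v) h
    simpa only [Matrix.mulVec_neg, Matrix.mulVec_mulVec _ (matM X.B K θ) (matM X.B K θ)⁻¹, h2,
      Matrix.one_mulVec] using h4

end Algebra

/-! ### The error matrix -/

section ErrorMatrix

variable {n : ℕ} {S : GenHamSystem n} {D : Set (Idx n → ℂ)} {X : HolomorphicExtension S D}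
  {ρ : ℝ} {K : (Fin n → ℂ) → Idx n → ℂ} {θ : Fin n → ℂ}

/-- The Jacobian matrix `De` of the error. -/
noncomputable def derr (X : HolomorphicExtension S D) (ω : Fin n → ℝ)
    (K : (Fin n → ℂ) → Idx n → ℂ) (θ : Fin n → ℂ) : Matrix (Idx n) (Fin n) ℂ :=
  Matrix.of fun l j => fderiv ℂ (fun τ => err X.B X.H ω K τ l) θ (Pi.single j 1)

theorem NondegenerateTorus.fderiv_vf (hK : NondegenerateTorus X ρ K)
    (hθ : θ ∈ strip n ρ) (l : Idx n) (j : Fin n) :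
    fderiv ℂ (fun τ => (X.B (K τ) *ᵥ grad X.H (K τ)) l) θ (Pi.single j 1) =
      (matA X.B X.H K θ * DK K θ) l j := by
  have hz := hK.mapsTo_strip hθ
  have h1 : HasFDerivAt (fun z => ∑ m, X.B z l m * grad X.H z m) _ (K θ) :=
    HasFDerivAt.fun_sum fun m _ => ((phaseFun_B X l m).differentiableAt X.isOpen hz).hasFDerivAt.mul
      ((phaseFun_grad X m).differentiableAt X.isOpen hz).hasFDerivAt
  have h2 : HasFDerivAt (fun τ => ∑ m, X.B (K τ) l m * grad X.H (K τ) m) _ θ :=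
    h1.comp θ (hK.differentiableAt hθ).hasFDerivAt
  change fderiv ℂ (fun τ => ∑ m, X.B (K τ) l m * grad X.H (K τ) m) θ (Pi.single j 1) = _
  have h3 : ∀ k, DK K θ k j = fderiv ℂ K θ (Pi.single j 1) k := fun _ => rfl
  rw [h2.fderiv]
  simp only [ContinuousLinearMap.comp_apply, _root_.sum_apply, _root_.add_apply,
    _root_.smul_apply, smul_eq_mul, fderiv_eq_sum_partialD, matA, Matrix.mul_apply,
    Matrix.add_apply, Psi_apply X hz, Phi, Matrix.of_apply, ← h3]
  simp only [Finset.mul_sum, add_mul, Finset.sum_mul, ← Finset.sum_add_distrib]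
  rw [Finset.sum_comm]
  refine Finset.sum_congr rfl fun k _ => Finset.sum_congr rfl fun m _ => ?_
  ring

/-- Differentiating the definition of the error: `∂_ω DK = A DK - De`. -/
theorem NondegenerateTorus.dOmegaMat_DK (hK : NondegenerateTorus X ρ K) (hρ : 0 < ρ)
    (hθ : θ ∈ strip n ρ) (ω : Fin n → ℝ) :
    dOmegaMat ω (DK K) θ = matA X.B X.H K θ * DK K θ - derr X ω K θ := by
  ext l j
  rw [Matrix.sub_apply, ← hK.fderiv_vf hθ]
  simp only [dOmegaMat, dOmega, Matrix.of_apply, derr]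
  have hvf := ((hK.stripFun_vf hρ l).differentiableAt isOpen_strip hθ).hasFDerivAt
  have herr := ((hK.stripFun_err hρ ω l).differentiableAt isOpen_strip hθ).hasFDerivAt
  rw [fderiv_eq_sum_partialD]
  have h1 : HasFDerivAt (fun τ => ∑ i, DK K τ l i * toC ω i) _ θ :=
    HasFDerivAt.fun_sum fun i _ =>
      ((hK.stripFun_DK l i).differentiableAt isOpen_strip hθ).hasFDerivAt.mul_const (toC ω i)
  have h2 : (fun τ => ∑ i, DK K τ l i * toC ω i) =ᶠ[𝓝 θ]
      fun τ => (X.B (K τ) *ᵥ grad X.H (K τ)) l - err X.B X.H ω K τ l := by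
    filter_upwards [isOpen_strip.mem_nhds hθ] with τ hτ
    rw [hK.err_eq hτ, Pi.sub_apply, sub_sub_cancel]
    rfl
  have h3 := h2.fderiv_eq (𝕜 := ℂ)
  have hsub : HasFDerivAt
      (fun τ => (X.B (K τ) *ᵥ grad X.H (K τ)) l - err X.B X.H ω K τ l) _ θ := hvf.sub herr
  rw [h1.fderiv, hsub.fderiv] at h3
  have h4 := congrArg (fun T => T (Pi.single j 1)) h3
  simp only [_root_.sum_apply, _root_.smul_apply, smul_eq_mul, _root_.sub_apply] at h4
  rw [← h4]
  refine Finset.sum_congr rfl fun i _ => ?_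
  rw [partialD, hK.fderiv_DK_comm hθ, mul_comm]

theorem dirB_sub (B : (Idx n → ℂ) → Matrix (Idx n) (Idx n) ℂ) (z h h' : Idx n → ℂ) :
    dirB B z (h - h') = dirB B z h - dirB B z h' := by
  ext i j
  simp [dirB]

theorem NondegenerateTorus.dOmegaMat_B (hK : NondegenerateTorus X ρ K)
    (hθ : θ ∈ strip n ρ) (ω : Fin n → ℝ) :
    dOmegaMat ω (fun τ => X.B (K τ)) θ =
      dirB X.B (K θ) (X.B (K θ) *ᵥ grad X.H (K θ)) -
        dirB X.B (K θ) (err X.B X.H ω K θ) := by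
  rw [← dirB_sub]
  ext i j
  have h1 : HasFDerivAt (fun τ => X.B (K τ) i j) _ θ :=
    ((phaseFun_B X i j).differentiableAt X.isOpen (hK.mapsTo_strip hθ)).hasFDerivAt.comp θ
      (hK.differentiableAt hθ).hasFDerivAt
  have h2 : X.B (K θ) *ᵥ grad X.H (K θ) - err X.B X.H ω K θ = fderiv ℂ K θ (toC ω) := by
    rw [err, sub_sub_cancel]; rfl
  simp only [dOmegaMat, dOmega, Matrix.of_apply, dirB, h2]
  rw [h1.fderiv]
  rfl

theorem NondegenerateTorus.dOmegaMat_matN (hK : NondegenerateTorus X ρ K)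
    (hθ : θ ∈ strip n ρ) (ω : Fin n → ℝ) :
    dOmegaMat ω (matN K) θ = -(matN K θ *
      ((dOmegaMat ω (DK K) θ)ᵀ * DK K θ + (DK K θ)ᵀ * dOmegaMat ω (DK K) θ) * matN K θ) := by
  have hd : ∀ i j, DifferentiableAt ℂ (fun τ => DK K τ i j) θ := fun i j =>
    (hK.stripFun_DK i j).differentiableAt isOpen_strip hθ
  have hN : ∀ i j, DifferentiableAt ℂ (fun τ => matN K τ i j) θ := fun i j =>
    (hK.stripFun_matN i j).differentiableAt isOpen_strip hθ
  have hG := dOmegaMat_mul ω (F := fun τ => (DK K τ)ᵀ) (G := DK K) (fun i j => hd j i) hd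
  have hGd : ∀ i j, DifferentiableAt ℂ (fun τ => ((DK K τ)ᵀ * DK K τ) i j) θ := fun i j =>
    ((RealPeriodic.matrix_mul (fun a b => hK.stripFun_DK b a)
      hK.stripFun_DK) i j).differentiableAt isOpen_strip hθ
  have h1 := dOmegaMat_mul ω (G := fun τ => (DK K τ)ᵀ * DK K τ) hN hGd
  have h2 : dOmegaMat ω (fun τ => matN K τ * ((DK K τ)ᵀ * DK K τ)) θ = 0 := by
    ext i j
    have h3 : (fun τ => (matN K τ * ((DK K τ)ᵀ * DK K τ)) i j) =ᶠ[𝓝 θ]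
        fun _ => (1 : Matrix (Fin n) (Fin n) ℂ) i j := by
      filter_upwards [isOpen_strip.mem_nhds hθ] with τ hτ
      rw [hK.matN_mul_gram hτ]
    simp only [dOmegaMat, dOmega, Matrix.of_apply, Matrix.zero_apply]
    rw [h3.fderiv_eq, fderiv_const_apply]
    rfl
  rw [h2] at h1
  have h4 := congrArg (fun T => T * matN K θ) h1
  simp only [Matrix.zero_mul, Matrix.add_mul] at h4
  rw [Matrix.mul_assoc _ _ (matN K θ), hK.gram_mul_matN hθ, Matrix.mul_one, hG] at h4
  exact eq_neg_of_add_eq_zero_left h4.symm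

/-- The part of the error matrix `E` that is linear in `e` and `De`. -/
noncomputable def errorPart (X : HolomorphicExtension S D) (ω : Fin n → ℝ)
    (K : (Fin n → ℂ) → Idx n → ℂ) (θ : Fin n → ℂ) : Matrix (Idx n) (Idx n) ℂ :=
  Matrix.fromCols (derr X ω K θ)
    (dirB X.B (K θ) (err X.B X.H ω K θ) * DK K θ * matN K θ +
      X.B (K θ) * derr X ω K θ * matN K θ -
      X.B (K θ) * DK K θ * matN K θ *
        ((derr X ω K θ)ᵀ * DK K θ + (DK K θ)ᵀ * derr X ω K θ) * matN K θ)

theorem NondegenerateTorus.matE_eq (hK : NondegenerateTorus X ρ K) (hρ : 0 < ρ)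
    (hθ : θ ∈ strip n ρ) (ω : Fin n → ℝ) :
    matE X.B X.H ω K θ = errorPart X ω K θ +
      Matrix.fromCols 0 (torsionCore X K θ * DK K θ * matN K θ -
        DK K θ * matS0 X.B X.H K θ) := by
  have hd : ∀ i j, DifferentiableAt ℂ (fun τ => DK K τ i j) θ := fun i j =>
    (hK.stripFun_DK i j).differentiableAt isOpen_strip hθ
  have hN : ∀ i j, DifferentiableAt ℂ (fun τ => matN K τ i j) θ := fun i j =>
    (hK.stripFun_matN i j).differentiableAt isOpen_strip hθ
  have hB : ∀ i j, DifferentiableAt ℂ (fun τ => X.B (K τ) i j) θ := fun i j =>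
    (hK.stripFun_B hρ i j).differentiableAt isOpen_strip hθ
  have hBd : ∀ i j, DifferentiableAt ℂ (fun τ => (X.B (K τ) * DK K τ) i j) θ := fun i j =>
    ((RealPeriodic.matrix_mul (hK.stripFun_B hρ)
      hK.stripFun_DK) i j).differentiableAt isOpen_strip hθ
  have hM : dOmegaMat ω (matM X.B K) θ = Matrix.fromCols (dOmegaMat ω (DK K) θ)
      (dOmegaMat ω (fun τ => X.B (K τ) * DK K τ * matN K τ) θ) := by
    ext i j
    rcases j with j | j <;> rfl
  have h1 := dOmegaMat_mul ω (F := fun τ => X.B (K τ) * DK K τ) (G := matN K) hBd hN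
  have h2 := dOmegaMat_mul ω (F := fun τ => X.B (K τ)) (G := DK K) hB hd
  have htri : matM X.B K θ * triS0 X.B X.H K θ =
      Matrix.fromCols 0 (DK K θ * matS0 X.B X.H K θ) := by
    rw [matM, triS0, Matrix.fromCols_mul_fromBlocks]
    simp
  have hsub : ∀ (a c : Matrix (Idx n) (Fin n) ℂ) (a' c' : Matrix (Idx n) (Fin n) ℂ),
      Matrix.fromCols a c - Matrix.fromCols a' c' = Matrix.fromCols (a - a') (c - c') := by
    intro a c a' c'
    ext i j
    rcases j with j | j <;> rfl
  have hadd : ∀ (a c : Matrix (Idx n) (Fin n) ℂ) (a' c' : Matrix (Idx n) (Fin n) ℂ),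
      Matrix.fromCols a c + Matrix.fromCols a' c' = Matrix.fromCols (a + a') (c + c') := by
    intro a c a' c'
    ext i j
    rcases j with j | j <;> rfl
  have hGN := hK.gram_mul_matN hθ
  have hNG := hK.matN_mul_gram hθ
  rw [matE, hM, htri, matM, Matrix.mul_fromCols, hsub, hsub, errorPart, hadd]
  congr 1
  · rw [hK.dOmegaMat_DK hρ hθ]
    abel
  · rw [h1, h2, hK.dOmegaMat_matN hθ, hK.dOmegaMat_B hθ, hK.dOmegaMat_DK hρ hθ, torsionCore]
    simp only [Matrix.transpose_sub, Matrix.transpose_mul, Matrix.add_mul, Matrix.mul_add,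
      Matrix.sub_mul, Matrix.mul_sub, Matrix.mul_neg, Matrix.mul_assoc]
    abel

/-- `DKᵀ B⁻¹` annihilates the matrix in braces in `S⁰` exactly, by the invariance of the Poisson
structure. -/
theorem NondegenerateTorus.DK_transpose_mul_torsionCore (hK : NondegenerateTorus X ρ K)
    (hρ : 0 < ρ) (hθ : θ ∈ strip n ρ) :
    (DK K θ)ᵀ * (X.B (K θ))⁻¹ * torsionCore X K θ = 0 := by
  set A := matA X.B X.H K θ
  have h1 : torsionCore X K θ = X.B (K θ) *
      (DK K θ * matN K θ * (DK K θ)ᵀ * (A + Aᵀ) - (A + Aᵀ)) := by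
    rw [torsionCore, ← hK.matA_mul_B_add hρ hθ]
    simp only [Matrix.mul_sub, Matrix.mul_add, Matrix.mul_assoc]
    abel
  rw [h1, Matrix.mul_assoc, ← Matrix.mul_assoc _ (X.B (K θ)), hK.inv_mul_B hθ, Matrix.one_mul,
    Matrix.mul_sub, sub_eq_zero]
  simp only [← Matrix.mul_assoc]
  rw [hK.gram_mul_matN hθ, Matrix.one_mul]

/-- The matrix `C` is the sum of a part linear in `e` and `De` and a part proportional to `M_e`. -/
theorem NondegenerateTorus.matC_eq (hK : NondegenerateTorus X ρ K) (hρ : 0 < ρ)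
    (hθ : θ ∈ strip n ρ) (hu : IsUnit (1 + (matV X.B K θ)⁻¹ * matR X.B K θ))
    (ω : Fin n → ℝ) :
    matC X.B X.H ω K θ = (matM X.B K θ)⁻¹ * errorPart X ω K θ +
      Matrix.fromCols 0 (matMe X.B K θ * (torsionCore X K θ * DK K θ * matN K θ)) := by
  obtain ⟨hM, -, hinv⟩ := hK.matM_inv hρ hθ hu
  have h1 := Matrix.nonsing_inv_mul _ ((Matrix.isUnit_iff_isUnit_det _).1 hM)
  rw [matC, hK.matE_eq hρ hθ, Matrix.mul_add, Matrix.mul_fromCols, Matrix.mul_zero]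
  congr 2
  have h2 : (matM X.B K θ)⁻¹ * (DK K θ * matS0 X.B X.H K θ) =
      (Matrix.fromRows (matS0 X.B X.H K θ) 0 : Matrix (Idx n) (Fin n) ℂ) := by
    have h3 : DK K θ * matS0 X.B X.H K θ =
        matM X.B K θ * (Matrix.fromRows (matS0 X.B X.H K θ) 0 : Matrix (Idx n) (Fin n) ℂ) := by
      rw [matM, Matrix.fromCols_mul_fromRows, Matrix.mul_zero, add_zero]
    rw [h3, ← Matrix.mul_assoc, h1, Matrix.one_mul]
  have h4 : (matV X.B K θ)⁻¹ * ((matM X.B K θ)ᵀ * (X.B (K θ))⁻¹) *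
      (torsionCore X K θ * DK K θ * matN K θ) = Matrix.fromRows (matS0 X.B X.H K θ) 0 := by
    rw [hK.matM_transpose_mul hρ hθ, Matrix.mul_assoc, Matrix.fromRows_mul, ← Matrix.mul_assoc _
      (torsionCore X K θ * DK K θ), ← Matrix.mul_assoc _ (torsionCore X K θ),
      hK.DK_transpose_mul_torsionCore hρ hθ, Matrix.zero_mul, Matrix.zero_mul, matV_inv,
      Matrix.fromBlocks_mul_fromRows, matS0_eq]
    simp [Matrix.mul_assoc]
  rw [Matrix.mul_sub, h2, ← h4]
  conv_lhs => rw [hinv]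
  rw [Matrix.add_mul, add_sub_cancel_left]

end ErrorMatrix

/-! ### Operator norms of matrices -/

section MatrixNorm

variable {κ κ' ι ι' : Type*} [Fintype κ] [Fintype κ'] [Fintype ι] [Fintype ι']

theorem opNorm_le_iff {A : Matrix κ κ' ℂ} {C : ℝ} (hC : 0 ≤ C) :
    ‖A‖ ≤ C ↔ ∀ i, ∑ j, ‖A i j‖ ≤ C := by
  lift C to NNReal using hC
  rw [← coe_nnnorm, NNReal.coe_le_coe, Matrix.linfty_opNNNorm_def, Finset.sup_le_iff]
  simp only [Finset.mem_univ, true_imp_iff, ← NNReal.coe_le_coe, NNReal.coe_sum, coe_nnnorm]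

theorem row_sum_le_opNorm (A : Matrix κ κ' ℂ) (i : κ) : ∑ j, ‖A i j‖ ≤ ‖A‖ :=
  (opNorm_le_iff (norm_nonneg A)).1 le_rfl i

theorem norm_entry_le_opNorm (A : Matrix κ κ' ℂ) (i : κ) (j : κ') : ‖A i j‖ ≤ ‖A‖ :=
  (Finset.single_le_sum (f := fun j => ‖A i j‖) (fun _ _ => norm_nonneg _)
    (Finset.mem_univ j)).trans (row_sum_le_opNorm A i)

theorem opNorm_le_of_entries {A : Matrix κ κ' ℂ} {C : ℝ} (hC : 0 ≤ C)
    (h : ∀ i j, ‖A i j‖ ≤ C) : ‖A‖ ≤ Fintype.card κ' * C := by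
  refine (opNorm_le_iff (by positivity)).2 fun i => ?_
  calc ∑ j, ‖A i j‖ ≤ ∑ _j : κ', C := Finset.sum_le_sum fun j _ => h i j
    _ = Fintype.card κ' * C := by simp

theorem opNorm_transpose_le (A : Matrix κ κ' ℂ) : ‖Aᵀ‖ ≤ Fintype.card κ * ‖A‖ :=
  opNorm_le_of_entries (norm_nonneg A) fun i j => norm_entry_le_opNorm A j i

theorem opNorm_one_le [DecidableEq κ] : ‖(1 : Matrix κ κ ℂ)‖ ≤ 1 := by
  rw [← Matrix.diagonal_one, Matrix.linfty_opNorm_diagonal]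
  exact (pi_norm_le_iff_of_nonneg zero_le_one).2 fun _ => by simp

theorem opNorm_fromCols_le (A : Matrix κ ι ℂ) (C : Matrix κ ι' ℂ) :
    ‖Matrix.fromCols A C‖ ≤ ‖A‖ + ‖C‖ := by
  refine (opNorm_le_iff (by positivity)).2 fun i => ?_
  rw [Fintype.sum_sum_type]
  exact add_le_add (row_sum_le_opNorm A i) (row_sum_le_opNorm C i)

theorem opNorm_fromBlocks_le {A : Matrix κ ι ℂ} {B : Matrix κ ι' ℂ} {C : Matrix κ' ι ℂ}
    {D : Matrix κ' ι' ℂ} {c : ℝ} (h : ‖A‖ + ‖B‖ ≤ c) (h' : ‖C‖ + ‖D‖ ≤ c) :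
    ‖Matrix.fromBlocks A B C D‖ ≤ c := by
  refine (opNorm_le_iff ((by positivity : 0 ≤ ‖A‖ + ‖B‖).trans h)).2 fun i => ?_
  rw [Fintype.sum_sum_type]
  rcases i with i | i
  · exact (add_le_add (row_sum_le_opNorm A i) (row_sum_le_opNorm B i)).trans h
  · exact (add_le_add (row_sum_le_opNorm C i) (row_sum_le_opNorm D i)).trans h'

/-- Neumann series bound for `(1 + Y)⁻¹` when `‖Y‖ ≤ 1/2`. -/
theorem isUnit_one_add_of_opNorm_le [DecidableEq κ] {Y : Matrix κ κ ℂ} (hY : ‖Y‖ ≤ 1 / 2) :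
    IsUnit (1 + Y) ∧ ‖(1 + Y)⁻¹‖ ≤ 2 := by
  have hu : IsUnit (1 + Y) := by
    have h : IsUnit (1 - -Y) :=
      isUnit_one_sub_of_norm_lt_one (by rw [norm_neg]; linarith)
    rwa [sub_neg_eq_add] at h
  refine ⟨hu, ?_⟩
  have h1 : (1 + Y)⁻¹ = 1 - (1 + Y)⁻¹ * Y := by
    have h2 := Matrix.nonsing_inv_mul _ ((Matrix.isUnit_iff_isUnit_det _).1 hu)
    rw [Matrix.mul_add, Matrix.mul_one] at h2
    exact eq_sub_of_add_eq h2
  have h3 : ‖(1 + Y)⁻¹‖ ≤ 1 + ‖(1 + Y)⁻¹‖ * (1 / 2) := by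
    conv_lhs => rw [h1]
    refine (norm_sub_le _ _).trans (add_le_add opNorm_one_le ?_)
    exact (Matrix.linfty_opNorm_mul _ _).trans (mul_le_mul_of_nonneg_left hY (norm_nonneg _))
  linarith

end MatrixNorm

/-! ### Bounds by powers of a single number -/

section PowerBounds

variable {κ κ' ι : Type*} [Fintype κ] [Fintype κ'] [Fintype ι]
  {A : Matrix κ κ' ℂ} {C : Matrix κ' ι ℂ} {T s a b : ℝ} {j k m : ℕ}

theorem opNorm_mul_le_pow (hA : ‖A‖ ≤ T ^ j) (hC : ‖C‖ ≤ T ^ k) :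
    ‖A * C‖ ≤ T ^ (j + k) := by
  rw [pow_add]
  exact (Matrix.linfty_opNorm_mul _ _).trans
    (mul_le_mul hA hC (norm_nonneg _) ((norm_nonneg _).trans hA))

theorem opNorm_mul_le_pow_mul (hA : ‖A‖ ≤ T ^ j) (hC : ‖C‖ ≤ T ^ k * s) :
    ‖A * C‖ ≤ T ^ (j + k) * s := by
  rw [pow_add, mul_assoc]
  exact (Matrix.linfty_opNorm_mul _ _).trans
    (mul_le_mul hA hC (norm_nonneg _) ((norm_nonneg _).trans hA))

theorem opNorm_mul_le_mul_pow (hA : ‖A‖ ≤ T ^ j * s) (hC : ‖C‖ ≤ T ^ k) :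
    ‖A * C‖ ≤ T ^ (j + k) * s := by
  rw [pow_add, mul_right_comm]
  exact (Matrix.linfty_opNorm_mul _ _).trans
    (mul_le_mul hA hC (norm_nonneg _) ((norm_nonneg _).trans hA))

theorem norm_mulVec_le_pow_mul {v : κ' → ℂ} (hA : ‖A‖ ≤ T ^ j) (hv : ‖v‖ ≤ T ^ k * s) :
    ‖A *ᵥ v‖ ≤ T ^ (j + k) * s := by
  rw [pow_add, mul_assoc]
  exact (Matrix.linfty_opNorm_mulVec _ _).trans
    (mul_le_mul hA hv (norm_nonneg _) ((norm_nonneg _).trans hA))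

theorem opNorm_transpose_le_pow_mul (hT : (Fintype.card κ : ℝ) ≤ T) (hA : ‖A‖ ≤ T ^ j * s) :
    ‖Aᵀ‖ ≤ T ^ (j + 1) * s := by
  rw [pow_succ', mul_assoc]
  exact (opNorm_transpose_le A).trans
    (mul_le_mul hT hA (norm_nonneg _) ((Nat.cast_nonneg _).trans hT))

theorem opNorm_transpose_le_pow (hT : (Fintype.card κ : ℝ) ≤ T) (hA : ‖A‖ ≤ T ^ j) :
    ‖Aᵀ‖ ≤ T ^ (j + 1) := by
  simpa using opNorm_transpose_le_pow_mul (s := 1) hT (by simpa using hA)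

theorem le_pow_mul_of_le (hT : 2 ≤ T) (hs : 0 ≤ s) (ha : a ≤ T ^ j * s) (hj : j ≤ m) :
    a ≤ T ^ m * s :=
  ha.trans (mul_le_mul_of_nonneg_right (pow_le_pow_right₀ (by linarith) hj) hs)

theorem add_le_pow_mul (hT : 2 ≤ T) (hs : 0 ≤ s) (ha : a ≤ T ^ j * s) (hb : b ≤ T ^ k * s)
    (hj : j ≤ m) (hk : k ≤ m) : a + b ≤ T ^ (m + 1) * s := by
  have h1 := le_pow_mul_of_le hT hs ha hj
  have h2 := le_pow_mul_of_le hT hs hb hk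
  have h3 : 0 ≤ T ^ m * s := by positivity
  rw [pow_succ', mul_assoc]
  nlinarith

theorem add_le_pow (hT : 2 ≤ T) (ha : a ≤ T ^ j) (hb : b ≤ T ^ k)
    (hj : j ≤ m) (hk : k ≤ m) : a + b ≤ T ^ (m + 1) := by
  simpa using add_le_pow_mul (s := 1) hT zero_le_one (by simpa using ha) (by simpa using hb) hj hk

end PowerBounds

/-! ### Pointwise bounds of the coefficients -/

section Pointwise

variable {n : ℕ} {S : GenHamSystem n} {D : Set (Idx n → ℂ)} {X : HolomorphicExtension S D}
  {ρ : ℝ} {K : (Fin n → ℂ) → Idx n → ℂ} {θ : Fin n → ℂ} {T : ℝ}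

/-- A single number `T` that bounds, at the point `θ`, the norms of the matrices from which the
frame `M` is built.  Taking `T` larger than the dimension and than `4` lets every estimate be put
into the form of a power of `T`. -/
structure FrameBound (X : HolomorphicExtension S D) (K : (Fin n → ℂ) → Idx n → ℂ) (T : ℝ)
    (θ : Fin n → ℂ) : Prop where
  four_le : 4 ≤ T
  dim_le : (2 * n : ℝ) ≤ T
  norm_DK : ‖DK K θ‖ ≤ T
  norm_N : ‖matN K θ‖ ≤ T
  norm_B : ‖X.B (K θ)‖ ≤ T
  norm_Binv : ‖(X.B (K θ))⁻¹‖ ≤ T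

/-- A single number `T` that bounds, at the point `θ`, the quantities of `FrameBound` and the
first derivatives of `B` and the first two derivatives of `H`. -/
structure FieldBound (X : HolomorphicExtension S D) (K : (Fin n → ℂ) → Idx n → ℂ) (T : ℝ)
    (θ : Fin n → ℂ) : Prop extends FrameBound X K T θ where
  norm_grad : ‖grad X.H (K θ)‖ ≤ T
  norm_dirB : ∀ h, ‖dirB X.B (K θ) h‖ ≤ T * ‖h‖
  norm_Psi : ∀ i j, ‖Psi X.H (K θ) i j‖ ≤ T

namespace FrameBound

theorem two_le (h : FrameBound X K T θ) : 2 ≤ T := by linarith [h.four_le]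

theorem card_le (h : FrameBound X K T θ) : (Fintype.card (Idx n) : ℝ) ≤ T := by
  have := h.dim_le
  simp only [Fintype.card_sum, Fintype.card_fin]
  push_cast
  linarith

theorem card_le' (h : FrameBound X K T θ) : (Fintype.card (Fin n) : ℝ) ≤ T := by
  have := h.dim_le
  have h2 : (0 : ℝ) ≤ n := Nat.cast_nonneg n
  simp only [Fintype.card_fin]
  linarith

theorem norm_DK_pow (h : FrameBound X K T θ) : ‖DK K θ‖ ≤ T ^ 1 := by simpa using h.norm_DK

theorem norm_N_pow (h : FrameBound X K T θ) : ‖matN K θ‖ ≤ T ^ 1 := by simpa using h.norm_N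

theorem norm_B_pow (h : FrameBound X K T θ) : ‖X.B (K θ)‖ ≤ T ^ 1 := by simpa using h.norm_B

theorem norm_Binv_pow (h : FrameBound X K T θ) : ‖(X.B (K θ))⁻¹‖ ≤ T ^ 1 := by
  simpa using h.norm_Binv

theorem norm_DK_transpose (h : FrameBound X K T θ) : ‖(DK K θ)ᵀ‖ ≤ T ^ 2 :=
  opNorm_transpose_le_pow h.card_le h.norm_DK_pow

theorem norm_BDKN (h : FrameBound X K T θ) :
    ‖X.B (K θ) * DK K θ * matN K θ‖ ≤ T ^ 3 :=
  opNorm_mul_le_pow (opNorm_mul_le_pow h.norm_B_pow h.norm_DK_pow) h.norm_N_pow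

theorem norm_matQ (h : FrameBound X K T θ) : ‖matQ X.B K θ‖ ≤ T ^ 6 := by
  rw [matQ, matN_transpose]
  exact opNorm_mul_le_pow (opNorm_mul_le_pow (opNorm_mul_le_pow
    (opNorm_mul_le_pow h.norm_N_pow h.norm_DK_transpose) h.norm_B_pow) h.norm_DK_pow) h.norm_N_pow

theorem norm_matV_inv (h : FrameBound X K T θ) : ‖(matV X.B K θ)⁻¹‖ ≤ T ^ 7 := by
  have hT := h.two_le
  have h1 : (1 : ℝ) ≤ T ^ 0 := by simp
  rw [matV_inv]
  refine opNorm_fromBlocks_le ?_ ?_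
  · rw [norm_neg, norm_neg]
    exact add_le_pow hT h.norm_matQ (opNorm_one_le.trans h1) le_rfl (by norm_num)
  · rw [norm_zero, add_zero]
    exact opNorm_one_le.trans (one_le_pow₀ (by linarith))

theorem norm_matM (h : FrameBound X K T θ) : ‖matM X.B K θ‖ ≤ T ^ 4 :=
  (opNorm_fromCols_le _ _).trans
    (add_le_pow h.two_le h.norm_DK_pow h.norm_BDKN (by norm_num) le_rfl)

theorem norm_frame (h : FrameBound X K T θ) :
    ‖(matV X.B K θ)⁻¹ * ((matM X.B K θ)ᵀ * (X.B (K θ))⁻¹)‖ ≤ T ^ 13 :=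
  opNorm_mul_le_pow h.norm_matV_inv (opNorm_mul_le_pow
    (opNorm_transpose_le_pow h.card_le h.norm_matM) h.norm_Binv_pow)

theorem norm_py (h : FrameBound X K T θ) (ω : Fin n → ℝ) :
    ‖py X.B X.H ω K θ‖ ≤ T ^ 3 * ‖err X.B X.H ω K θ‖ := by
  rw [py, norm_neg]
  exact norm_mulVec_le_pow_mul (k := 0)
    (opNorm_mul_le_pow h.norm_DK_transpose h.norm_Binv_pow) (by simp)

theorem norm_px (h : FrameBound X K T θ) (ω : Fin n → ℝ) :
    ‖px X.B X.H ω K θ‖ ≤ T ^ 10 * ‖err X.B X.H ω K θ‖ := by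
  rw [px, norm_neg, matN_transpose]
  have h1 : ‖(1 : Matrix (Idx n) (Idx n) ℂ) -
      X.B (K θ) * DK K θ * matN K θ * (DK K θ)ᵀ * (X.B (K θ))⁻¹‖ ≤ T ^ 7 :=
    (norm_sub_le _ _).trans (add_le_pow h.two_le (j := 0) (by simpa using opNorm_one_le)
      (opNorm_mul_le_pow (opNorm_mul_le_pow h.norm_BDKN h.norm_DK_transpose) h.norm_Binv_pow)
      (by norm_num) le_rfl)
  exact norm_mulVec_le_pow_mul (k := 0) (opNorm_mul_le_pow
    (opNorm_mul_le_pow h.norm_N_pow h.norm_DK_transpose) h1) (by simp)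

end FrameBound

namespace FieldBound

theorem norm_Phi (h : FieldBound X K T θ) : ‖Phi X.B X.H (K θ)‖ ≤ T ^ 3 := by
  have hT := h.four_le
  have h1 : ∀ i k, ‖Phi X.B X.H (K θ) i k‖ ≤ T ^ 2 := fun i k => by
    have h2 : Phi X.B X.H (K θ) i k =
        (dirB X.B (K θ) (Pi.single k 1) *ᵥ grad X.H (K θ)) i := rfl
    rw [h2]
    refine (norm_le_pi_norm _ i).trans ((Matrix.linfty_opNorm_mulVec _ _).trans ?_)
    have h3 := h.norm_dirB (Pi.single k 1)
    rw [Pi.norm_single, norm_one, mul_one] at h3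
    rw [sq]
    exact mul_le_mul h3 h.norm_grad (norm_nonneg _) (by linarith)
  refine (opNorm_le_of_entries (by positivity) h1).trans ?_
  rw [pow_succ' T 2]
  exact mul_le_mul_of_nonneg_right h.card_le (by positivity)

theorem norm_matA (h : FieldBound X K T θ) : ‖matA X.B X.H K θ‖ ≤ T ^ 4 := by
  have hT := h.four_le
  have h1 : ‖Psi X.H (K θ)‖ ≤ T ^ 2 := by
    refine (opNorm_le_of_entries (by linarith) h.norm_Psi).trans ?_
    rw [sq]
    exact mul_le_mul_of_nonneg_right h.card_le (by linarith)
  exact (norm_add_le _ _).trans (add_le_pow h.two_le h.norm_Phi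
    (opNorm_mul_le_pow h.norm_B_pow h1) le_rfl le_rfl)

theorem norm_torsionCore (h : FieldBound X K T θ) : ‖torsionCore X K θ‖ ≤ T ^ 13 := by
  have hT := h.two_le
  have hA := h.norm_matA
  have hAt := opNorm_transpose_le_pow h.card_le hA
  have h1 : ‖matA X.B X.H K θ * X.B (K θ) - X.B (K θ) * matA X.B X.H K θ‖ ≤ T ^ 6 :=
    (norm_sub_le _ _).trans (add_le_pow hT (opNorm_mul_le_pow hA h.norm_B_pow)
      (opNorm_mul_le_pow h.norm_B_pow hA) le_rfl le_rfl)
  have h2 : ‖dirB X.B (K θ) (X.B (K θ) *ᵥ grad X.H (K θ))‖ ≤ T ^ 3 := by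
    refine (h.norm_dirB _).trans ?_
    rw [pow_succ' T 2]
    refine mul_le_mul_of_nonneg_left ?_ (by linarith)
    rw [sq]
    exact (Matrix.linfty_opNorm_mulVec _ _).trans
      (mul_le_mul h.norm_B h.norm_grad (norm_nonneg _) (by linarith))
  have h3 : ‖X.B (K θ) * DK K θ * matN K θ * (DK K θ)ᵀ *
      (matA X.B X.H K θ + (matA X.B X.H K θ)ᵀ)‖ ≤ T ^ 11 :=
    opNorm_mul_le_pow (opNorm_mul_le_pow h.norm_BDKN h.norm_DK_transpose)
      ((norm_add_le _ _).trans (add_le_pow hT hA hAt (by norm_num) le_rfl))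
  have h4 := (norm_sub_le _ _).trans (add_le_pow hT h1 h2 (m := 6) le_rfl (by norm_num))
  exact (norm_add_le _ _).trans (add_le_pow hT h4 h3 (m := 12) (by norm_num) (by norm_num))

theorem norm_torsionCore_mul (h : FieldBound X K T θ) :
    ‖torsionCore X K θ * DK K θ * matN K θ‖ ≤ T ^ 15 :=
  opNorm_mul_le_pow (opNorm_mul_le_pow h.norm_torsionCore h.norm_DK_pow) h.norm_N_pow

theorem norm_matS0 (h : FieldBound X K T θ) : ‖matS0 X.B X.H K θ‖ ≤ T ^ 18 := by
  rw [matS0_eq]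
  exact opNorm_mul_le_pow (opNorm_mul_le_pow (opNorm_mul_le_pow
    (opNorm_mul_le_pow h.norm_N_pow h.norm_DK_transpose) h.norm_torsionCore)
    h.norm_DK_pow) h.norm_N_pow

theorem norm_errorPart (h : FieldBound X K T θ) {ω : Fin n → ℝ} {s : ℝ}
    (he : ‖err X.B X.H ω K θ‖ ≤ s) (hde : ‖derr X ω K θ‖ ≤ T * s) :
    ‖errorPart X ω K θ‖ ≤ T ^ 12 * s := by
  have hT := h.two_le
  have hs : 0 ≤ s := (norm_nonneg _).trans he
  have hde' : ‖derr X ω K θ‖ ≤ T ^ 1 * s := by simpa using hde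
  have h1 : ‖dirB X.B (K θ) (err X.B X.H ω K θ)‖ ≤ T ^ 1 * s := by
    rw [pow_one]
    exact (h.norm_dirB _).trans (mul_le_mul_of_nonneg_left he (by linarith))
  have h2 := opNorm_mul_le_mul_pow (opNorm_mul_le_mul_pow h1 h.norm_DK_pow) h.norm_N_pow
  have h3 := opNorm_mul_le_mul_pow (opNorm_mul_le_pow_mul h.norm_B_pow hde') h.norm_N_pow
  have h4 := (norm_add_le _ _).trans (add_le_pow_mul hT hs
    (opNorm_mul_le_mul_pow (opNorm_transpose_le_pow_mul h.card_le hde') h.norm_DK_pow)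
    (opNorm_mul_le_pow_mul h.norm_DK_transpose hde') (m := 3) le_rfl le_rfl)
  have h5 := opNorm_mul_le_mul_pow (opNorm_mul_le_pow_mul h.norm_BDKN h4) h.norm_N_pow
  have h6 := (norm_add_le _ _).trans (add_le_pow_mul hT hs h2 h3 (m := 3) le_rfl le_rfl)
  have h7 := (norm_sub_le _ _).trans
    (add_le_pow_mul hT hs h6 h5 (m := 8) (by norm_num) (by norm_num))
  exact le_pow_mul_of_le hT hs ((opNorm_fromCols_le _ _).trans
    (add_le_pow_mul hT hs hde' h7 (m := 9) (by norm_num) (by norm_num))) (by norm_num)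

end FieldBound

end Pointwise

/-! ### Supremum norms -/

section SupNorms

theorem le_supNorm {Y E : Type*} [Norm E] {s : Set Y} {f : Y → E} (hf : BddOn s f) {x : Y}
    (hx : x ∈ s) : ‖f x‖ ≤ supNorm s f :=
  le_ciSup (f := fun x : s => ‖f x‖) hf ⟨x, hx⟩

theorem supNorm_nonneg {Y E : Type*} [SeminormedAddGroup E] (s : Set Y) (f : Y → E) :
    0 ≤ supNorm s f :=
  Real.iSup_nonneg fun _ => norm_nonneg _

variable {n : ℕ} {S : GenHamSystem n} {D : Set (Idx n → ℂ)} {X : HolomorphicExtension S D}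
  {ρ : ℝ} {K : (Fin n → ℂ) → Idx n → ℂ} {θ : Fin n → ℂ} {T : ℝ}

theorem norm_iteratedFDeriv_le_ckNorm (X : HolomorphicExtension S D) {z : Idx n → ℂ}
    (hz : z ∈ D) (p : Fin 3) : ‖iteratedFDeriv ℂ (p : ℕ) X.H z‖ ≤ ckNorm 2 D X.H :=
  le_ciSup (f := fun p : Fin (2 + 1) × D => ‖iteratedFDeriv ℂ (p.1 : ℕ) X.H (p.2 : Idx n → ℂ)‖)
    X.H_bdd (p, ⟨z, hz⟩)

theorem ckNorm_nonneg (X : HolomorphicExtension S D) : 0 ≤ ckNorm 2 D X.H :=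
  Real.iSup_nonneg fun _ => norm_nonneg _

theorem norm_grad_le (X : HolomorphicExtension S D) {z : Idx n → ℂ} (hz : z ∈ D) :
    ‖grad X.H z‖ ≤ ckNorm 2 D X.H := by
  refine (pi_norm_le_iff_of_nonneg (ckNorm_nonneg X)).2 fun j => ?_
  have h1 := norm_iteratedFDeriv_le_ckNorm X hz 1
  have h2 := (iteratedFDeriv ℂ 1 X.H z).le_opNorm fun _ => Pi.single j 1
  rw [iteratedFDeriv_one_apply] at h2
  simp only [Pi.norm_single, norm_one, Finset.prod_const_one, mul_one] at h2
  exact h2.trans h1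

theorem norm_Psi_le (X : HolomorphicExtension S D) {z : Idx n → ℂ} (hz : z ∈ D) (i j : Idx n) :
    ‖Psi X.H z i j‖ ≤ ckNorm 2 D X.H := by
  have h1 := norm_iteratedFDeriv_le_ckNorm X hz 2
  have h2 := (iteratedFDeriv ℂ 2 X.H z).le_opNorm ![Pi.single j 1, Pi.single i 1]
  rw [iteratedFDeriv_two_apply] at h2
  simp only [Fin.prod_univ_two, Matrix.cons_val_zero, Matrix.cons_val_one, Pi.norm_single,
    norm_one, mul_one] at h2
  refine le_trans (le_of_eq ?_) (h2.trans h1)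
  rw [Psi_apply X hz]
  have hd : DifferentiableAt ℂ (fderiv ℂ X.H) z :=
    (differentiableOn_fderiv X.isOpen X.H_holo).differentiableAt (X.isOpen.mem_nhds hz)
  simp only [partialD, grad]
  have h3 : HasFDerivAt (fun y => fderiv ℂ X.H y (Pi.single i 1)) _ z :=
    hd.hasFDerivAt.clm_apply (hasFDerivAt_const (Pi.single i 1) z)
  rw [h3.fderiv]
  simp

theorem norm_dirB_le (X : HolomorphicExtension S D) {z : Idx n → ℂ} (hz : z ∈ D)
    (h : Idx n → ℂ) : ‖dirB X.B z h‖ ≤ c1NormMat D X.B * ‖h‖ := by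
  have hsmul : ∀ (c : ℂ) (v : Idx n → ℂ), dirB X.B z (c • v) = c • dirB X.B z v := by
    intro c v
    ext i j
    simp [dirB]
  by_cases hh : h = 0
  · have h0 : dirB X.B z 0 = 0 := by simpa using hsmul 0 0
    rw [hh, h0]
    simp
  have hh' : ‖h‖ ≠ 0 := norm_ne_zero_iff.2 hh
  have hn : ‖((‖h‖⁻¹ : ℝ) : ℂ) • h‖ ≤ 1 := by
    rw [norm_smul, Complex.norm_real, norm_inv, norm_norm, inv_mul_cancel₀ hh']
  have h1 : ‖dirB X.B z (((‖h‖⁻¹ : ℝ) : ℂ) • h)‖ ≤ c1NormMat D X.B :=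
    (le_supNorm (f := fun p : (Idx n → ℂ) × (Idx n → ℂ) => dirB X.B p.1 p.2) X.B_bdd.2
      (x := (z, _)) ⟨hz, mem_closedBall_zero_iff.2 hn⟩).trans (le_max_right _ _)
  rw [hsmul, norm_smul, Complex.norm_real, norm_inv, norm_norm, inv_mul_le_iff₀ (by positivity)]
    at h1
  rwa [mul_comm]

theorem supNorm_le_c1NormMat (B : (Idx n → ℂ) → Matrix (Idx n) (Idx n) ℂ) (D : Set (Idx n → ℂ)) :
    supNorm D B ≤ c1NormMat D B := le_max_left _ _

theorem NondegenerateTorus.frameBound (hK : NondegenerateTorus X ρ K) (hθ : θ ∈ strip n ρ)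
    (h4 : 4 ≤ T) (hn : (2 * n : ℝ) ≤ T) (hDK : supNorm (strip n ρ) (DK K) ≤ T)
    (hN : supNorm (strip n ρ) (matN K) ≤ T) (hB : supNorm D X.B ≤ T)
    (hBinv : supNorm D (fun z => (X.B z)⁻¹) ≤ T) : FrameBound X K T θ where
  four_le := h4
  dim_le := hn
  norm_DK := (le_supNorm hK.DK_bdd hθ).trans hDK
  norm_N := (le_supNorm hK.N_bdd hθ).trans hN
  norm_B := (le_supNorm X.B_bdd.1 (hK.mapsTo_strip hθ)).trans hB
  norm_Binv := (le_supNorm X.Binv_bdd (hK.mapsTo_strip hθ)).trans hBinv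

theorem FrameBound.fieldBound (h : FrameBound X K T θ) (hz : K θ ∈ D)
    (hB1 : c1NormMat D X.B ≤ T) (hH : ckNorm 2 D X.H ≤ T) : FieldBound X K T θ where
  toFrameBound := h
  norm_grad := (norm_grad_le X hz).trans hH
  norm_dirB v := (norm_dirB_le X hz v).trans (mul_le_mul_of_nonneg_right hB1 (norm_nonneg _))
  norm_Psi i j := (norm_Psi_le X hz i j).trans hH

theorem NondegenerateTorus.err_bddOn (hK : NondegenerateTorus X ρ K) (ω : Fin n → ℝ) :
    BddOn (strip n ρ) (err X.B X.H ω K) := by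
  refine ⟨supNorm D X.B * ckNorm 2 D X.H + supNorm (strip n ρ) (DK K) * ‖toC ω‖, ?_⟩
  rintro - ⟨⟨θ, hθ⟩, rfl⟩
  have hz := hK.mapsTo_strip hθ
  dsimp only
  rw [hK.err_eq hθ]
  refine (norm_sub_le _ _).trans (add_le_add ?_ ?_)
  · exact (Matrix.linfty_opNorm_mulVec _ _).trans (mul_le_mul (le_supNorm X.B_bdd.1 hz)
      (norm_grad_le X hz) (norm_nonneg _) (supNorm_nonneg _ _))
  · exact (Matrix.linfty_opNorm_mulVec _ _).trans
      (mul_le_mul_of_nonneg_right (le_supNorm hK.DK_bdd hθ) (norm_nonneg _))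

end SupNorms

/-! ### Bounds of the inverse frame -/

section InverseFrame

variable {n : ℕ} {S : GenHamSystem n} {D : Set (Idx n → ℂ)} {X : HolomorphicExtension S D}
  {ρ : ℝ} {K : (Fin n → ℂ) → Idx n → ℂ} {θ : Fin n → ℂ} {T m : ℝ}

theorem FrameBound.norm_matV_inv_mul_matR (h : FrameBound X K T θ)
    (hL : ‖matL X.B K θ‖ ≤ T ^ 6 * m) :
    ‖(matV X.B K θ)⁻¹ * matR X.B K θ‖ ≤ T ^ 13 * m := by
  have hm : 0 ≤ T ^ 6 * m := (norm_nonneg _).trans hL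
  have hR : ‖matR X.B K θ‖ ≤ T ^ 6 * m :=
    opNorm_fromBlocks_le (by rwa [norm_zero, add_zero]) (by simpa using hm)
  exact opNorm_mul_le_pow_mul h.norm_matV_inv hR

/-- The correction `M_e` is small with `L`, provided `V⁻¹R` stays in the range of the Neumann
series. -/
theorem FrameBound.norm_matMe (h : FrameBound X K T θ)
    (hL : ‖matL X.B K θ‖ ≤ T ^ 6 * m) (hR : ‖(matV X.B K θ)⁻¹ * matR X.B K θ‖ ≤ 1 / 2) :
    ‖matMe X.B K θ‖ ≤ T ^ 27 * m := by
  have h1 : ‖(1 + (matV X.B K θ)⁻¹ * matR X.B K θ)⁻¹‖ ≤ T ^ 1 := by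
    rw [pow_one]
    exact (isUnit_one_add_of_opNorm_le hR).2.trans h.two_le
  have h2 : matMe X.B K θ = -((1 + (matV X.B K θ)⁻¹ * matR X.B K θ)⁻¹ *
      ((matV X.B K θ)⁻¹ * matR X.B K θ) *
        ((matV X.B K θ)⁻¹ * ((matM X.B K θ)ᵀ * (X.B (K θ))⁻¹))) := by
    simp only [matMe, Matrix.mul_assoc]
  rw [h2, norm_neg]
  exact opNorm_mul_le_mul_pow (opNorm_mul_le_pow_mul h1 (h.norm_matV_inv_mul_matR hL)) h.norm_frame

theorem FrameBound.norm_matM_inv (h : FrameBound X K T θ) (hK : NondegenerateTorus X ρ K)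
    (hρ : 0 < ρ) (hθ : θ ∈ strip n ρ) (hR : ‖(matV X.B K θ)⁻¹ * matR X.B K θ‖ ≤ 1 / 2) :
    ‖(matM X.B K θ)⁻¹‖ ≤ T ^ 14 := by
  obtain ⟨hu, h1⟩ := isUnit_one_add_of_opNorm_le hR
  rw [(hK.matM_inv hρ hθ hu).2.1]
  exact opNorm_mul_le_pow (j := 1) (by simpa using h1.trans h.two_le) h.norm_frame

theorem FieldBound.norm_matC (h : FieldBound X K T θ) (hK : NondegenerateTorus X ρ K)
    (hρ : 0 < ρ) (hθ : θ ∈ strip n ρ) {ω : Fin n → ℝ}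
    (he : ‖err X.B X.H ω K θ‖ ≤ m) (hde : ‖derr X ω K θ‖ ≤ T * m)
    (hL : ‖matL X.B K θ‖ ≤ T ^ 6 * m) (hR : ‖(matV X.B K θ)⁻¹ * matR X.B K θ‖ ≤ 1 / 2) :
    ‖matC X.B X.H ω K θ‖ ≤ T ^ 43 * m := by
  have hm : 0 ≤ m := (norm_nonneg _).trans he
  rw [hK.matC_eq hρ hθ (isUnit_one_add_of_opNorm_le hR).1]
  have h1 := opNorm_mul_le_pow_mul (h.norm_matM_inv hK hρ hθ hR) (h.norm_errorPart he hde)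
  have h2 := opNorm_mul_le_mul_pow (h.norm_matMe hL hR) h.norm_torsionCore_mul
  have h3 := opNorm_fromCols_le (0 : Matrix (Idx n) (Fin n) ℂ)
    (matMe X.B K θ * (torsionCore X K θ * DK K θ * matN K θ))
  rw [norm_zero, zero_add] at h3
  exact (norm_add_le _ _).trans (add_le_pow_mul h.two_le hm h1 (h3.trans h2) (by norm_num) le_rfl)

end InverseFrame

/-! ### Cauchy estimates on strips -/

section Cauchy

variable {n : ℕ} {ρ r R C : ℝ} {θ : Fin n → ℂ}

theorem add_smul_single_mem_strip (hθ : θ ∈ strip n r) (i : Fin n) {ζ : ℂ} (hζ : ‖ζ‖ ≤ R) :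
    θ + ζ • Pi.single i 1 ∈ strip n (r + R) := fun j => by
  have h1 : |((ζ • (Pi.single i 1 : Fin n → ℂ)) j).im| ≤ R := by
    refine (Complex.abs_im_le_norm _).trans ((norm_le_pi_norm _ j).trans ?_)
    rw [norm_smul, Pi.norm_single, norm_one, mul_one]
    exact hζ
  rw [Pi.add_apply, Complex.add_im]
  exact (abs_add_le _ _).trans_lt (add_lt_add_of_lt_of_le (hθ j) h1)

/-- Cauchy's estimate for the partial derivatives on a narrower strip. -/
theorem StripFun.norm_fderiv_single_le {f : (Fin n → ℂ) → ℂ} (hf : StripFun n ρ f) (hR : 0 < R)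
    (hr : r + R ≤ ρ) (hC : ∀ θ ∈ strip n (r + R), ‖f θ‖ ≤ C) (hθ : θ ∈ strip n r) (i : Fin n) :
    ‖fderiv ℂ f θ (Pi.single i 1)‖ ≤ C / R :=
  norm_fderiv_apply_le hR
    (fun _ hζ => hf.differentiableAt isOpen_strip
      (strip_mono hr (add_smul_single_mem_strip hθ i hζ)))
    fun _ hζ => hC _ (add_smul_single_mem_strip hθ i hζ)

end Cauchy

/-! ### Smallness of the pull-back form -/

section SmallDivisorBounds

/-- `c` is an admissible constant in the estimate of the solution `sol ω f` of `∂_ω u = f` on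
strips. -/
def IsSolBound (n : ℕ) (σ c : ℝ) : Prop :=
  ∀ (γ : ℝ), 0 < γ → ∀ ω : Fin n → ℝ, IsDiophantine γ σ ω →
    ∀ (ρ : ℝ) (f : (Fin n → ℂ) → ℂ), StripFun n ρ f →
    ∀ r δ M : ℝ, r ≤ ρ → 0 < δ → δ < r → (∀ θ ∈ strip n r, ‖f θ‖ ≤ M) →
    ∀ θ ∈ strip n (r - δ), ‖sol ω f θ‖ ≤ c * γ⁻¹ * δ ^ (-σ) * M

variable {n : ℕ} {S : GenHamSystem n} {D : Set (Idx n → ℂ)} {X : HolomorphicExtension S D}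
  {ρ γ σ c T ε δ : ℝ} {K : (Fin n → ℂ) → Idx n → ℂ} {ω : Fin n → ℝ}

/-- The mean-zero solution of the second equation `∂_ω ξ_y = -p_y` of the reduced system. -/
noncomputable def solY (X : HolomorphicExtension S D) (ω : Fin n → ℝ)
    (K : (Fin n → ℂ) → Idx n → ℂ) (θ : Fin n → ℂ) : Fin n → ℂ := fun j =>
  sol ω (fun τ => -py X.B X.H ω K τ j) θ

theorem NondegenerateTorus.norm_neg_py_le (hF : ∀ θ ∈ strip n ρ, FrameBound X K T θ)
    (hε : ∀ θ ∈ strip n ρ, ‖err X.B X.H ω K θ‖ ≤ ε) (j : Fin n) :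
    ∀ θ ∈ strip n ρ, ‖-py X.B X.H ω K θ j‖ ≤ T ^ 3 * ε := fun θ hθ => by
  have hT := (hF θ hθ).four_le
  rw [norm_neg]
  exact (norm_le_pi_norm _ j).trans (((hF θ hθ).norm_py ω).trans
    (mul_le_mul_of_nonneg_left (hε θ hθ) (by positivity)))

theorem NondegenerateTorus.stripFun_solY (hK : NondegenerateTorus X ρ K) (hρ : 0 < ρ)
    (hσ : 0 < σ) (hγ : 0 < γ) (hω : IsDiophantine γ σ ω)
    (hF : ∀ θ ∈ strip n ρ, FrameBound X K T θ)
    (hε : ∀ θ ∈ strip n ρ, ‖err X.B X.H ω K θ‖ ≤ ε) (j : Fin n) :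
    StripFun n ρ (fun θ => solY X ω K θ j) ∧
      ∀ θ ∈ strip n ρ, fderiv ℂ (fun θ => solY X ω K θ j) θ (toC ω) = -py X.B X.H ω K θ j := by
  have h1 : StripFun n ρ fun τ => -py X.B X.H ω K τ j := (hK.stripFun_py hρ ω j).neg
  have hb : ∀ r < ρ, ∃ M, ∀ θ ∈ strip n r, ‖-py X.B X.H ω K θ j‖ ≤ M := fun r hr =>
    ⟨_, fun θ hθ => norm_neg_py_le hF hε j θ (strip_mono hr.le hθ)⟩
  have h0 : fc (fun x => -py X.B X.H ω K (toC x) j) 0 = 0 := by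
    have h2 := fc_const_mul (-1) (fun x => py X.B X.H ω K (toC x) j) 0
    simpa [hK.fc_py_zero hρ ω j] using h2
  exact ⟨stripFun_sol hσ hγ hω h1 hb hρ, fun θ hθ => fderiv_sol hσ hγ hω h1 hb hρ h0 hθ⟩

theorem NondegenerateTorus.norm_solY_le (hK : NondegenerateTorus X ρ K) (hρ : 0 < ρ)
    (hc : IsSolBound n σ c) (hγ : 0 < γ) (hω : IsDiophantine γ σ ω)
    (hF : ∀ θ ∈ strip n ρ, FrameBound X K T θ)
    (hε : ∀ θ ∈ strip n ρ, ‖err X.B X.H ω K θ‖ ≤ ε) (hδ : 0 < δ) (hδρ : δ < ρ) (j : Fin n)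
    {θ : Fin n → ℂ} (hθ : θ ∈ strip n (ρ - δ)) :
    ‖solY X ω K θ j‖ ≤ c * γ⁻¹ * δ ^ (-σ) * (T ^ 3 * ε) :=
  hc γ hγ ω hω ρ _ (hK.stripFun_py hρ ω j).neg ρ δ _ le_rfl hδ hδρ (norm_neg_py_le hF hε j) θ hθ

theorem rpow_neg_add_one (hδ : 0 < δ) (σ : ℝ) : δ ^ (-(σ + 1)) = δ ^ (-σ) * δ⁻¹ := by
  rw [neg_add, ← sub_eq_add_neg, Real.rpow_sub_one hδ.ne', div_eq_mul_inv]

/-- The pull-back of `Ω` by an approximately invariant torus is small: its coefficients are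
derivatives of the solution of a small divisor equation whose right-hand side is of the size of the
error. -/
theorem NondegenerateTorus.norm_matL_le (hK : NondegenerateTorus X ρ K) (hρ : 0 < ρ)
    (hσ : 0 < σ) (hc : IsSolBound n σ c) (hcT : c * 2 ^ σ ≤ T)
    (hγ : 0 < γ) (hω : IsDiophantine γ σ ω)
    (hF : ∀ θ ∈ strip n ρ, FrameBound X K T θ)
    (hε0 : 0 ≤ ε) (hε : ∀ θ ∈ strip n ρ, ‖err X.B X.H ω K θ‖ ≤ ε) (hδ : 0 < δ) (hδρ : δ < ρ)
    {θ : Fin n → ℂ} (hθ : θ ∈ strip n (ρ - δ)) :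
    ‖matL X.B K θ‖ ≤ T ^ 6 * (γ⁻¹ * δ ^ (-(σ + 1)) * ε) := by
  have hθ' : θ ∈ strip n ρ := strip_mono (by linarith) hθ
  have hT := (hF θ hθ').four_le
  have hpow : 0 ≤ δ ^ (-σ) := by positivity
  -- the loss `δ` of width is shared equally by the small divisors and by Cauchy's estimate
  have hsol : ∀ j, ∀ τ ∈ strip n (ρ - δ + δ / 2),
      ‖solY X ω K τ j‖ ≤ T ^ 4 * (γ⁻¹ * δ ^ (-σ) * ε) := fun j τ hτ => by
    have hτ' : τ ∈ strip n (ρ - δ / 2) := strip_mono (by linarith) hτ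
    refine (hK.norm_solY_le hρ hc hγ hω hF hε (half_pos hδ) (by linarith) j hτ').trans ?_
    have h2 : (δ / 2) ^ (-σ) = δ ^ (-σ) * 2 ^ σ := by
      rw [Real.div_rpow hδ.le zero_le_two, Real.rpow_neg zero_le_two, div_inv_eq_mul]
    rw [h2]
    calc c * γ⁻¹ * (δ ^ (-σ) * 2 ^ σ) * (T ^ 3 * ε)
        = (c * 2 ^ σ) * (T ^ 3 * (γ⁻¹ * δ ^ (-σ) * ε)) := by ring
      _ ≤ T * (T ^ 3 * (γ⁻¹ * δ ^ (-σ) * ε)) :=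
          mul_le_mul_of_nonneg_right hcT (by positivity)
      _ = _ := by ring
  have hu := hK.stripFun_solY hρ hσ hγ hω hF hε
  have hd : ∀ i j, ‖fderiv ℂ (fun τ => solY X ω K τ j) θ (Pi.single i 1)‖ ≤
      2 * (T ^ 4 * (γ⁻¹ * δ ^ (-(σ + 1)) * ε)) := fun i j => by
    refine (StripFun.norm_fderiv_single_le (hu j).1 (half_pos hδ) (by linarith) (hsol j) hθ
      i).trans (le_of_eq ?_)
    rw [rpow_neg_add_one hδ]
    field_simp
  have hentry : ∀ i j, ‖matL X.B K θ i j‖ ≤ T ^ 5 * (γ⁻¹ * δ ^ (-(σ + 1)) * ε) := fun i j => by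
    rw [hK.matL_eq_of_fderiv_eq hρ hγ hω (fun j => (hu j).1) (fun j => (hu j).2) hθ']
    refine (norm_sub_le _ _).trans ((add_le_add (hd i j) (hd j i)).trans ?_)
    rw [pow_succ' T 4, mul_assoc T]
    have : 0 ≤ T ^ 4 * (γ⁻¹ * δ ^ (-(σ + 1)) * ε) := by positivity
    nlinarith
  refine (opNorm_le_of_entries (by positivity) hentry).trans ?_
  rw [pow_succ' T 5, mul_assoc T]
  exact mul_le_mul_of_nonneg_right (hF θ hθ').card_le' (by positivity)

theorem NondegenerateTorus.norm_derr_le (hK : NondegenerateTorus X ρ K) (hρ : 0 < ρ)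
    (hF : ∀ θ ∈ strip n ρ, FrameBound X K T θ)
    (hε0 : 0 ≤ ε) (hε : ∀ θ ∈ strip n ρ, ‖err X.B X.H ω K θ‖ ≤ ε) (hδ : 0 < δ)
    {θ : Fin n → ℂ} (hθ : θ ∈ strip n (ρ - δ)) :
    ‖derr X ω K θ‖ ≤ T * (ε / δ) := by
  have h1 : ∀ l j, ‖derr X ω K θ l j‖ ≤ ε / δ := fun l j =>
    StripFun.norm_fderiv_single_le (hK.stripFun_err hρ ω l) hδ (sub_add_cancel ρ δ).le
      (fun τ hτ => (norm_le_pi_norm _ l).trans (hε τ (by rwa [sub_add_cancel] at hτ))) hθ j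
  exact (opNorm_le_of_entries (by positivity) h1).trans (mul_le_mul_of_nonneg_right
    (hF θ (strip_mono (by linarith) hθ)).card_le' (by positivity))

end SmallDivisorBounds

/-! ### Averages over the torus -/

section Averages

variable {n : ℕ} {ρ C : ℝ} {f : (Fin n → ℂ) → ℂ}

/-- The average of a function in the class is a real constant. -/
theorem StripFun.average (hf : StripFun n ρ f) (hρ : 0 < ρ) (r : ℝ) :
    StripFun n r fun _ => fc (fun x => f (toC x)) 0 := by
  have h1 : (fc (fun x => f (toC x)) 0).im = 0 := by
    rw [← Complex.conj_eq_iff_im, fc_zero_eq, ← integral_conj]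
    refine integral_congr_ae (Eventually.of_forall fun x => ?_)
    exact Complex.conj_eq_iff_im.2 (hf.real x (mem_univ x) (toC_mem_strip hρ x))
  rw [show fc (fun x => f (toC x)) 0 = ((fc (fun x => f (toC x)) 0).re : ℂ) from
    Complex.ext rfl (by simpa using h1)]
  exact RealPeriodic.const _

theorem norm_fc_zero_le (hC : ∀ x : Fin n → ℝ, ‖f (toC x)‖ ≤ C) :
    ‖fc (fun x => f (toC x)) 0‖ ≤ C := by
  have hv : volume (Icc (0 : Fin n → ℝ) 1) = 1 := by
    simp [Real.volume_Icc_pi]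
  rw [fc_zero_eq]
  have h := norm_setIntegral_le_of_norm_le_const (μ := volume) (s := Icc (0 : Fin n → ℝ) 1)
    (f := fun x => f (toC x)) (C := C) (by rw [hv]; exact ENNReal.one_lt_top) (fun x _ => hC x)
  simpa [Measure.real, hv] using h

theorem avg_apply_eq_fc {κ κ' : Type*} (F : (Fin n → ℂ) → Matrix κ κ' ℂ) (i : κ) (j : κ') :
    avg F i j = fc (fun x => F (toC x) i j) 0 := (fc_zero_eq _).symm

end Averages

/-! ### The reduced triangular system -/

section ReducedSystem

variable {n : ℕ} {S : GenHamSystem n} {D : Set (Idx n → ℂ)} {X : HolomorphicExtension S D}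
  {ρ γ σ c T ε δ : ℝ} {K : (Fin n → ℂ) → Idx n → ℂ} {ω : Fin n → ℝ}

theorem dOmega_pi {m : Type*} [Fintype m] {ξ : (Fin n → ℂ) → m → ℂ} {θ : Fin n → ℂ}
    (hξ : DifferentiableAt ℂ ξ θ) (i : m) :
    dOmega ω ξ θ i = fderiv ℂ (fun τ => ξ τ i) θ (toC ω) := by
  rw [(hasFDerivAt_pi'.1 hξ.hasFDerivAt i).fderiv]
  rfl

theorem triS0_mulVec (θ : Fin n → ℂ) (v : Idx n → ℂ) :
    triS0 X.B X.H K θ *ᵥ v =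
      Sum.elim (matS0 X.B X.H K θ *ᵥ fun i => v (Sum.inr i)) 0 := by
  rw [triS0, Matrix.fromBlocks_mulVec]
  simp [Function.comp_def]

/-- Without `C` and `w` the transformed equation is the triangular system, row by row. -/
theorem triangular_iff_reducedAt {ξ : (Fin n → ℂ) → Idx n → ℂ} {θ : Fin n → ℂ}
    (hξ : DifferentiableAt ℂ ξ θ) :
    triS0 X.B X.H K θ *ᵥ ξ θ - dOmega ω ξ θ = vecP X.B X.H ω K θ ↔
      ReducedAt X.B X.H ω K ξ θ := by
  have hx : DifferentiableAt ℂ (xPart ξ) θ :=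
    differentiableAt_pi.2 fun i => differentiableAt_pi.1 hξ (Sum.inl i)
  have hy : DifferentiableAt ℂ (yPart ξ) θ :=
    differentiableAt_pi.2 fun i => differentiableAt_pi.1 hξ (Sum.inr i)
  simp only [ReducedAt, funext_iff, triS0_mulVec, Pi.sub_apply, Sum.forall, Sum.elim_inl,
    Sum.elim_inr, vecP, dOmega_pi hξ, dOmega_pi hx, dOmega_pi hy, Pi.zero_apply, zero_sub,
    Pi.neg_apply]
  refine and_congr (forall_congr' fun i => ?_) (forall_congr' fun i => ?_)
  · constructor <;> intro h
    · exact eq_sub_of_add_eq' (sub_eq_iff_eq_add.1 h).symm |>.trans rfl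
    · exact sub_eq_of_eq_add' (eq_sub_iff_add_eq.1 h).symm |>.trans rfl
  · exact neg_eq_iff_eq_neg

/-- The reduced system is solved from the bottom up: the first equation is solvable once the
average of `ξ_y` is adjusted, which is possible because `⟨S⁰⟩` is invertible. -/
theorem NondegenerateTorus.exists_reducedAt (hK : NondegenerateTorus X ρ K) (hρ : 0 < ρ)
    (hσ : 0 < σ) (hc : IsSolBound n σ c) (hcT : c ≤ T) (hγ : 0 < γ) (hγ1 : γ < 1)
    (hω : IsDiophantine γ σ ω) (hF : ∀ θ ∈ strip n ρ, FieldBound X K T θ)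
    (hS : maxNorm (avg (matS0 X.B X.H K))⁻¹ ≤ T)
    (hε0 : 0 ≤ ε) (hε : ∀ θ ∈ strip n ρ, ‖err X.B X.H ω K θ‖ ≤ ε)
    (hδ : 0 < δ) (hδρ : δ < ρ / 2) (hδ1 : δ ≤ 1) :
    ∃ ξ : (Fin n → ℂ) → Idx n → ℂ, PeriodicAnalytic false (strip n (ρ - δ)) ξ ∧
      (∀ θ ∈ strip n (ρ - δ), ReducedAt X.B X.H ω K ξ θ) ∧
      (∀ θ ∈ strip n (ρ - δ), ‖yPart ξ θ‖ ≤ T ^ 46 * (γ⁻¹ * δ ^ (-σ) * ε)) ∧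
      (∀ θ ∈ strip n (ρ - 2 * δ),
        ‖xPart ξ θ‖ ≤ T ^ 46 * ((γ ^ 2)⁻¹ * δ ^ (-(2 * σ)) * ε)) := by
  have hρδ : 0 < ρ - δ := by linarith
  have hsub : strip n (ρ - δ) ⊆ strip n ρ := strip_mono (by linarith)
  have h0 : (0 : Fin n → ℂ) ∈ strip n ρ := by
    simpa [toC_zero] using toC_mem_strip hρ (0 : Fin n → ℝ)
  have hT := (hF 0 h0).four_le
  have hT2 := (hF 0 h0).two_le
  have hcard := (hF 0 h0).card_le'
  have hFr : ∀ θ ∈ strip n ρ, FrameBound X K T θ := fun θ hθ => (hF θ hθ).toFrameBound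
  have hpow : 0 < δ ^ (-σ) := by positivity
  set ν := γ⁻¹ * δ ^ (-σ) with hν
  have hν1 : 1 ≤ ν := by
    rw [hν]
    exact one_le_mul_of_one_le_of_one_le ((one_le_inv₀ hγ).2 hγ1.le)
      (Real.one_le_rpow_of_pos_of_le_one_of_nonpos hδ hδ1 (by linarith))
  set s := ν * ε with hs
  have hs0 : 0 ≤ s := by positivity
  have hεs : ε ≤ s := le_mul_of_one_le_left hε0 hν1
  -- the mean-zero part of `ξ_y`
  set u := solY X ω K with hudef
  have hu := fun j => hK.stripFun_solY hρ hσ hγ hω hFr hε j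
  have hub : ∀ θ ∈ strip n (ρ - δ), ‖u θ‖ ≤ T ^ 4 * s := fun θ hθ => by
    refine (pi_norm_le_iff_of_nonneg (by positivity)).2 fun j => ?_
    refine (hK.norm_solY_le hρ hc hγ hω hFr hε hδ (by linarith) j hθ).trans ?_
    calc c * γ⁻¹ * δ ^ (-σ) * (T ^ 3 * ε) = c * (T ^ 3 * s) := by rw [hs, hν]; ring
      _ ≤ T * (T ^ 3 * s) := mul_le_mul_of_nonneg_right hcT (by positivity)
      _ = _ := by ring
  -- the defect of the average of the first equation
  set b : (Fin n → ℂ) → Fin n → ℂ := fun θ =>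
    px X.B X.H ω K θ - matS0 X.B X.H K θ *ᵥ u θ with hb
  have hbs : ∀ i, StripFun n ρ fun θ => b θ i := fun i =>
    (hK.stripFun_px hρ ω i).sub
      (RealPeriodic.mulVec (hK.stripFun_matS0 hρ) (fun j => (hu j).1) i)
  have hbb : ∀ θ ∈ strip n (ρ - δ), ‖b θ‖ ≤ T ^ 23 * s := fun θ hθ =>
    (norm_sub_le _ _).trans (add_le_pow_mul hT2 hs0
      (((hFr θ (hsub hθ)).norm_px ω).trans
        (mul_le_mul_of_nonneg_left ((hε θ (hsub hθ)).trans hεs) (by positivity)))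
      (norm_mulVec_le_pow_mul (hF θ (hsub hθ)).norm_matS0 (hub θ hθ)) (by norm_num) (by norm_num))
  set G := avg (matS0 X.B X.H K) with hG
  set b0 : Fin n → ℂ := fun i => fc (fun x => b (toC x) i) 0 with hb0
  set c0 : Fin n → ℂ := G⁻¹ *ᵥ b0 with hc0
  have hGS : ∀ i j, StripFun n ρ fun _ => G i j := fun i j => by
    simp only [hG, avg_apply_eq_fc]
    exact StripFun.average (hK.stripFun_matS0 hρ i j) hρ ρ
  have hc0S : ∀ i, StripFun n ρ fun _ => c0 i :=
    RealPeriodic.mulVec (RealPeriodic.matrix_inv hGS fun _ _ => hK.nd2)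
      (fun j => StripFun.average (hbs j) hρ ρ)
  have hc0b : ‖c0‖ ≤ T ^ 25 * s := by
    have h1 : ‖G⁻¹‖ ≤ T ^ 2 := by
      refine (opNorm_le_of_entries (C := T) (by linarith) fun i j => ?_).trans ?_
      · exact (norm_le_pi_norm (fun p : Fin n × Fin n => G⁻¹ p.1 p.2) (i, j)).trans hS
      · rw [sq]
        exact mul_le_mul_of_nonneg_right hcard (by linarith)
    refine norm_mulVec_le_pow_mul (k := 23) h1 ?_
    refine (pi_norm_le_iff_of_nonneg (by positivity)).2 fun i => ?_
    exact norm_fc_zero_le (f := fun θ => b θ i) fun x =>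
      (norm_le_pi_norm _ i).trans (hbb _ (toC_mem_strip hρδ x))
  set y : (Fin n → ℂ) → Fin n → ℂ := fun θ => u θ + c0 with hy
  have hyS : ∀ i, StripFun n ρ fun θ => y θ i := fun i => (hu i).1.add (hc0S i)
  have hyb : ∀ θ ∈ strip n (ρ - δ), ‖y θ‖ ≤ T ^ 26 * s := fun θ hθ =>
    (norm_add_le _ _).trans
      (add_le_pow_mul hT2 hs0 (hub θ hθ) hc0b (by norm_num) (by norm_num))
  set q : (Fin n → ℂ) → Fin n → ℂ := fun θ =>
    matS0 X.B X.H K θ *ᵥ y θ - px X.B X.H ω K θ with hq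
  have hqS : ∀ i, StripFun n ρ fun θ => q θ i := fun i =>
    (RealPeriodic.mulVec (hK.stripFun_matS0 hρ) hyS i).sub (hK.stripFun_px hρ ω i)
  have hqb : ∀ θ ∈ strip n (ρ - δ), ‖q θ‖ ≤ T ^ 45 * s := fun θ hθ =>
    (norm_sub_le _ _).trans (add_le_pow_mul hT2 hs0
      (norm_mulVec_le_pow_mul (hF θ (hsub hθ)).norm_matS0 (hyb θ hθ))
      (((hFr θ (hsub hθ)).norm_px ω).trans
        (mul_le_mul_of_nonneg_left ((hε θ (hsub hθ)).trans hεs) (by positivity)))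
      (by norm_num) (by norm_num))
  have hq0 : ∀ i, fc (fun x => q (toC x) i) 0 = 0 := fun i => by
    have h1 : ∀ x : Fin n → ℝ, q (toC x) i =
        (∑ j, c0 j * matS0 X.B X.H K (toC x) i j) - b (toC x) i := fun x => by
      simp only [hq, hb, hy, Pi.sub_apply, Matrix.mulVec_add, Pi.add_apply]
      rw [Matrix.mulVec, Matrix.mulVec, dotProduct, dotProduct]
      simp only [mul_comm (c0 _)]
      ring
    have hcont : ∀ j, Continuous fun x : Fin n → ℝ => c0 j * matS0 X.B X.H K (toC x) i j :=
      fun j => continuous_const.mul (StripFun.continuous_real (hK.stripFun_matS0 hρ i j) hρ)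
    simp only [h1]
    rw [fc_sub (continuous_finsetSum _ fun j _ => hcont j)
      (StripFun.continuous_real (hbs i) hρ), fc_sum _ fun j _ => hcont j]
    simp only [fc_const_mul, ← avg_apply_eq_fc]
    have h2 : G *ᵥ c0 = b0 := by
      rw [hc0, Matrix.mulVec_mulVec, Matrix.mul_nonsing_inv _
        ((Matrix.isUnit_iff_isUnit_det _).1 hK.nd2), Matrix.one_mulVec]
    rw [sub_eq_zero]
    refine Eq.trans ?_ (congrFun h2 i)
    rw [Matrix.mulVec, dotProduct]
    exact Finset.sum_congr rfl fun j _ => mul_comm _ _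
  -- the second small divisor problem is posed on the strip of width `ρ - δ`
  have hqS' : ∀ i, StripFun n (ρ - δ) fun θ => q θ i := fun i => (hqS i).mono hsub
  have hqb' : ∀ i, ∀ θ ∈ strip n (ρ - δ), ‖q θ i‖ ≤ T ^ 45 * s := fun i θ hθ =>
    (norm_le_pi_norm _ i).trans (hqb θ hθ)
  have hqr : ∀ i, ∀ r < ρ - δ, ∃ M, ∀ θ ∈ strip n r, ‖q θ i‖ ≤ M := fun i r hr =>
    ⟨_, fun θ hθ => hqb' i θ (strip_mono hr.le hθ)⟩
  set x : (Fin n → ℂ) → Fin n → ℂ := fun θ i => sol ω (fun τ => q τ i) θ with hx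
  have hxS : ∀ i, StripFun n (ρ - δ) fun θ => x θ i := fun i =>
    stripFun_sol hσ hγ hω (hqS' i) (hqr i) hρδ
  set ξ : (Fin n → ℂ) → Idx n → ℂ := fun θ => Sum.elim (x θ) (y θ) with hξ
  have hξS : ∀ i, StripFun n (ρ - δ) fun θ => ξ θ i := by
    rintro (i | i)
    · exact hxS i
    · exact (hyS i).mono hsub
  have hxb : ∀ θ ∈ strip n (ρ - 2 * δ), ‖x θ‖ ≤ T ^ 46 * (ν * s) := fun θ hθ => by
    refine (pi_norm_le_iff_of_nonneg (by positivity)).2 fun i => ?_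
    refine (hc γ hγ ω hω _ _ (hqS' i) (ρ - δ) δ _ le_rfl hδ (by linarith) (hqb' i) θ
      (by rwa [sub_sub, ← two_mul])).trans ?_
    calc c * γ⁻¹ * δ ^ (-σ) * (T ^ 45 * s) = c * (T ^ 45 * (ν * s)) := by rw [hν]; ring
      _ ≤ T * (T ^ 45 * (ν * s)) := mul_le_mul_of_nonneg_right hcT (by positivity)
      _ = _ := by ring
  have hν2 : ν * s = (γ ^ 2)⁻¹ * δ ^ (-(2 * σ)) * ε := by
    have h1 : δ ^ (-(2 * σ)) = δ ^ (-σ) * δ ^ (-σ) := by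
      rw [← Real.rpow_add hδ]; ring_nf
    rw [hs, hν, h1, ← inv_pow, sq]
    ring
  refine ⟨ξ, ⟨?_, ?_, ?_, ?_⟩, fun θ hθ => ⟨?_, ?_⟩, fun θ hθ => ?_, fun θ hθ => ?_⟩
  · exact continuousOn_pi.2 fun i => (hξS i).holo.continuousOn
  · rw [isOpen_strip.interior_eq]
    exact differentiableOn_pi.2 fun i => (hξS i).holo
  · refine fun k θ hθ _ => ⟨0, ⟨fun _ => rfl, by simp⟩, ?_⟩
    rw [toC_zero, add_zero]
    funext i
    rw [intC_eq_toC]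
    exact (hξS i).per _ ⟨k, rfl⟩ θ hθ
  · exact fun t ht i => (hξS i).real t (mem_univ t) ht
  · have hd : DifferentiableAt ℂ (xPart ξ) θ :=
      differentiableAt_pi.2 fun i => (hxS i).differentiableAt isOpen_strip hθ
    funext i
    rw [dOmega_pi hd]
    exact fderiv_sol hσ hγ hω (hqS' i) (hqr i) hρδ (hq0 i) hθ
  · have hd : DifferentiableAt ℂ (yPart ξ) θ :=
      differentiableAt_pi.2 fun i => (hyS i).differentiableAt isOpen_strip (hsub hθ)
    funext i
    rw [dOmega_pi hd]
    change fderiv ℂ (fun τ => u τ i + c0 i) θ (toC ω) = _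
    rw [fderiv_add_const]
    exact (hu i).2 θ (hsub hθ)
  · exact le_pow_mul_of_le hT2 hs0 (hyb θ hθ) (by norm_num)
  · rw [← hν2]
    exact hxb θ hθ

end ReducedSystem

/-! ### Polynomial majorants -/

section Majorants

theorem le_mul_one_add {κ t : ℝ} (hκ : 1 ≤ κ) (ht : 0 ≤ t) :
    κ ≤ κ * (1 + t) ∧ t ≤ κ * (1 + t) :=
  ⟨le_mul_of_one_le_right (by linarith) (by linarith),
    (by linarith : t ≤ 1 + t).trans (le_mul_of_one_le_left (by linarith) hκ)⟩

theorem NonnegCoeffs.mul {m : ℕ} {P Q : MvPolynomial (Fin m) ℝ} (hP : NonnegCoeffs P)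
    (hQ : NonnegCoeffs Q) : NonnegCoeffs (P * Q) := fun a => by
  rw [MvPolynomial.coeff_mul]
  exact Finset.sum_nonneg fun p _ => mul_nonneg (hP _) (hQ _)

theorem NonnegCoeffs.add {m : ℕ} {P Q : MvPolynomial (Fin m) ℝ} (hP : NonnegCoeffs P)
    (hQ : NonnegCoeffs Q) : NonnegCoeffs (P + Q) := fun a => by
  rw [MvPolynomial.coeff_add]
  exact add_nonneg (hP a) (hQ a)

theorem nonnegCoeffs_C {m : ℕ} {κ : ℝ} (hκ : 0 ≤ κ) :
    NonnegCoeffs (MvPolynomial.C κ : MvPolynomial (Fin m) ℝ) := fun a => by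
  rw [MvPolynomial.coeff_C]
  split_ifs <;> simp [hκ]

theorem nonnegCoeffs_X {m : ℕ} (i : Fin m) :
    NonnegCoeffs (MvPolynomial.X i : MvPolynomial (Fin m) ℝ) := fun a => by
  rw [MvPolynomial.coeff_X]
  split_ifs <;> simp

theorem NonnegCoeffs.sum {m : ℕ} {α : Type*} (s : Finset α) {P : α → MvPolynomial (Fin m) ℝ}
    (hP : ∀ a ∈ s, NonnegCoeffs (P a)) : NonnegCoeffs (∑ a ∈ s, P a) := fun d => by
  rw [MvPolynomial.coeff_sum]
  exact Finset.sum_nonneg fun a ha => hP a ha d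

theorem NonnegCoeffs.pow {m : ℕ} {P : MvPolynomial (Fin m) ℝ} (hP : NonnegCoeffs P) (k : ℕ) :
    NonnegCoeffs (P ^ k) := by
  induction k with
  | zero => simpa using nonnegCoeffs_C (m := m) zero_le_one
  | succ k ih => rw [pow_succ]; exact ih.mul hP

/-- The polynomial `(κ (1 + x₁ + ⋯ + x_m))^k`. -/
noncomputable def majorant (m : ℕ) (κ : ℝ) (k : ℕ) : MvPolynomial (Fin m) ℝ :=
  (MvPolynomial.C κ * (MvPolynomial.C 1 + ∑ i, MvPolynomial.X i)) ^ k

theorem nonnegCoeffs_majorant (m : ℕ) {κ : ℝ} (hκ : 0 ≤ κ) (k : ℕ) :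
    NonnegCoeffs (majorant m κ k) :=
  ((nonnegCoeffs_C hκ).mul ((nonnegCoeffs_C zero_le_one).add
    (NonnegCoeffs.sum _ fun i _ => nonnegCoeffs_X i))).pow k

theorem eval_majorant (m : ℕ) (κ : ℝ) (k : ℕ) (v : Fin m → ℝ) :
    MvPolynomial.eval v (majorant m κ k) = (κ * (1 + ∑ i, v i)) ^ k := by
  simp [majorant]

end Majorants

/-! ### The transformed equation -/

section Transformation

variable {n : ℕ} {S : GenHamSystem n} {D : Set (Idx n → ℂ)} {X : HolomorphicExtension S D}
  {ρ γ σ c T T' ε δ : ℝ} {K : (Fin n → ℂ) → Idx n → ℂ} {ω : Fin n → ℝ}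

/-- The smallness condition makes `V⁻¹R` small, which validates the change of variables and gives
the bounds of `C` and `w`.  The smallness condition involves only the bound `T` of the frame, while
the bounds of `C` and `w` involve the bound `T'` of the vector field. -/
theorem NondegenerateTorus.transformation (hK : NondegenerateTorus X ρ K) (hρ : 0 < ρ)
    (hσ : 0 < σ) (hc : IsSolBound n σ c) (hcT : c * 2 ^ σ ≤ T) (hTT' : T ≤ T')
    (hγ : 0 < γ) (hγ1 : γ < 1) (hω : IsDiophantine γ σ ω)
    (hF : ∀ θ ∈ strip n ρ, FrameBound X K T θ) (hF' : ∀ θ ∈ strip n ρ, FieldBound X K T' θ)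
    (hε0 : 0 ≤ ε) (hε : ∀ θ ∈ strip n ρ, ‖err X.B X.H ω K θ‖ ≤ ε)
    (hδ : 0 < δ) (hδρ : δ < ρ / 2) (hδ1 : δ ≤ 1)
    (hsmall : T ^ 13 * (γ⁻¹ * δ ^ (-(σ + 1)) * ε) ≤ 1 / 2) :
    (∀ θ ∈ strip n (ρ - δ), IsUnit (matM X.B K θ) ∧
      IsUnit (1 + (matV X.B K θ)⁻¹ * matR X.B K θ) ∧
      ∀ ξ : (Fin n → ℂ) → Idx n → ℂ, DifferentiableAt ℂ ξ θ →
        (LinearizedAt X.B X.H ω K (fun τ => matM X.B K τ *ᵥ ξ τ) θ ↔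
          TransformedAt X.B X.H ω K ξ θ)) ∧
    (∀ θ ∈ strip n (ρ - 2 * δ),
      ‖matC X.B X.H ω K θ‖ ≤ T' ^ 43 * (γ⁻¹ * δ ^ (-(σ + 1)) * ε)) ∧
    (∀ θ ∈ strip n (ρ - δ),
      ‖vecW X.B X.H ω K θ‖ ≤ T' ^ 43 * (γ⁻¹ * δ ^ (-(σ + 1)) * ε ^ 2)) := by
  have hsub : strip n (ρ - δ) ⊆ strip n ρ := strip_mono (by linarith)
  have hsub' : strip n (ρ - 2 * δ) ⊆ strip n (ρ - δ) := strip_mono (by linarith)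
  have hpow : 0 < δ ^ (-(σ + 1)) := by positivity
  have hγinv : 1 ≤ γ⁻¹ := (one_le_inv₀ hγ).2 hγ1.le
  set m := γ⁻¹ * δ ^ (-(σ + 1)) * ε with hm
  have hm0 : 0 ≤ m := by positivity
  have hdε : ε / δ ≤ m := by
    have h1 : 1 ≤ γ⁻¹ * δ ^ (-σ) := one_le_mul_of_one_le_of_one_le hγinv
      (Real.one_le_rpow_of_pos_of_le_one_of_nonpos hδ hδ1 (by linarith))
    have h2 : m = γ⁻¹ * δ ^ (-σ) * (ε / δ) := by
      rw [hm, rpow_neg_add_one hδ]; ring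
    rw [h2]
    exact le_mul_of_one_le_left (by positivity) h1
  have hεm : ε ≤ m := ((le_div_iff₀ hδ).2 (mul_le_of_le_one_right hε0 hδ1)).trans hdε
  have hL : ∀ θ ∈ strip n (ρ - δ), ‖matL X.B K θ‖ ≤ T ^ 6 * m := fun θ hθ =>
    hK.norm_matL_le hρ hσ hc hcT hγ hω hF hε0 hε hδ (by linarith) hθ
  have hL' : ∀ θ ∈ strip n (ρ - δ), ‖matL X.B K θ‖ ≤ T' ^ 6 * m := fun θ hθ =>
    hK.norm_matL_le hρ hσ hc (hcT.trans hTT') hγ hω (fun θ hθ => (hF' θ hθ).toFrameBound)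
      hε0 hε hδ (by linarith) hθ
  have hR : ∀ θ ∈ strip n (ρ - δ), ‖(matV X.B K θ)⁻¹ * matR X.B K θ‖ ≤ 1 / 2 := fun θ hθ =>
    ((hF θ (hsub hθ)).norm_matV_inv_mul_matR (hL θ hθ)).trans hsmall
  refine ⟨fun θ hθ => ?_, fun θ hθ => ?_, fun θ hθ => ?_⟩
  · have hu := (isUnit_one_add_of_opNorm_le (hR θ hθ)).1
    exact ⟨(hK.matM_inv hρ (hsub hθ) hu).1, hu,
      fun ξ hξ => hK.linearizedAt_iff hρ (hsub hθ) hu ω hξ⟩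
  · have hθ' := hsub' hθ
    have hF1 := hF' θ (hsub hθ')
    have hT' := hF1.four_le
    exact hF1.norm_matC hK hρ (hsub hθ') ((hε θ (hsub hθ')).trans hεm)
      ((hK.norm_derr_le hρ (fun θ hθ => (hF' θ hθ).toFrameBound) hε0 hε hδ hθ').trans
        (mul_le_mul_of_nonneg_left hdε (by linarith))) (hL' θ hθ') (hR θ hθ')
  · have hF1 := hF' θ (hsub hθ)
    have hT' := hF1.four_le
    have h1 : m * ε = γ⁻¹ * δ ^ (-(σ + 1)) * ε ^ 2 := by rw [hm]; ring
    rw [vecW, norm_neg, ← h1]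
    refine (Matrix.linfty_opNorm_mulVec _ _).trans
      ((mul_le_mul (hF1.norm_matMe (hL' θ hθ) (hR θ hθ)) (hε θ (hsub hθ)) (norm_nonneg _) (by positivity)).trans ?_)
    exact le_pow_mul_of_le (j := 27) hF1.two_le (by positivity) (by rw [mul_assoc]) (by norm_num)

end Transformation

end KAM

theorem theorem4p1 (n : ℕ) (hn : 2 ≤ n) (σ : ℝ) (hσ : 0 < σ) :
    ∃ (c₂ : MvPolynomial (Fin 4) ℝ) (c₄ : MvPolynomial (Fin 5) ℝ) (c₅ : (Fin 6 → ℝ) → ℝ),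
      KAM.NonnegCoeffs c₂ ∧ KAM.NonnegCoeffs c₄ ∧
      ∀ (γ : ℝ), 0 < γ → γ < 1 →
      ∀ (ω : Fin n → ℝ), KAM.IsDiophantine γ σ ω →
      ∀ (S : KAM.GenHamSystem n) (D : Set (KAM.Idx n → ℂ)) (X : KAM.HolomorphicExtension S D)
        (ρ : ℝ), 0 < ρ →
      ∀ (K : (Fin n → ℂ) → KAM.Idx n → ℂ), KAM.NondegenerateTorus X ρ K →
      ∀ (nDK nN nB nB1 nBinv nH nS ε C₂ C₄ C₅ : ℝ),
        nDK = KAM.supNorm (KAM.strip n ρ) (KAM.DK K) →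
        nN = KAM.supNorm (KAM.strip n ρ) (KAM.matN K) →
        nB = KAM.supNorm D X.B →
        nB1 = KAM.c1NormMat D X.B →
        nBinv = KAM.supNorm D (fun z => (X.B z)⁻¹) →
        nH = KAM.ckNorm 2 D X.H →
        nS = KAM.maxNorm (KAM.avg (KAM.matS0 X.B X.H K))⁻¹ →
        ε = KAM.supNorm (KAM.strip n ρ) (KAM.err X.B X.H ω K) →
        C₂ = MvPolynomial.eval ![nDK, nN, nB, nBinv] c₂ →
        C₄ = MvPolynomial.eval ![nDK, nN, nB1, nBinv, nH] c₄ →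
        C₅ = c₅ ![nDK, nN, nS, nB1, nBinv, nH] →
        1 ≤ C₂ ∧ C₂ ≤ C₄ ∧ C₄ ≤ C₅ ∧
        -- transformation of the linearized equation
        (∀ δ : ℝ, 0 < δ → δ < ρ / 2 → δ ≤ 1 →
          C₂ * γ⁻¹ * δ ^ (-(σ + 1)) * ε ≤ 1 / 2 →
          (∀ θ ∈ KAM.strip n (ρ - δ),
            IsUnit (KAM.matM X.B K θ) ∧
            IsUnit (1 + (KAM.matV X.B K θ)⁻¹ * KAM.matR X.B K θ) ∧
            ∀ ξ : (Fin n → ℂ) → KAM.Idx n → ℂ, DifferentiableAt ℂ ξ θ →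
              (KAM.LinearizedAt X.B X.H ω K (fun τ => (KAM.matM X.B K τ).mulVec (ξ τ)) θ ↔
                KAM.TransformedAt X.B X.H ω K ξ θ)) ∧
          (∀ θ ∈ KAM.strip n (ρ - 2 * δ),
            ‖KAM.matC X.B X.H ω K θ‖ ≤ C₄ * γ⁻¹ * δ ^ (-(σ + 1)) * ε) ∧
          (∀ θ ∈ KAM.strip n (ρ - δ),
            ‖KAM.vecW X.B X.H ω K θ‖ ≤ C₄ * γ⁻¹ * δ ^ (-(σ + 1)) * ε ^ 2)) ∧
        -- the system with `C = 0` and `w = 0` is the reduced triangular system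
        (∀ θ ∈ KAM.strip n ρ, ∀ ξ : (Fin n → ℂ) → KAM.Idx n → ℂ, DifferentiableAt ℂ ξ θ →
          ((KAM.triS0 X.B X.H K θ).mulVec (ξ θ) - KAM.dOmega ω ξ θ = KAM.vecP X.B X.H ω K θ ↔
            KAM.ReducedAt X.B X.H ω K ξ θ)) ∧
        -- solvability of the reduced triangular system, with bounds
        (∀ δ : ℝ, 0 < δ → δ < ρ / 2 → δ ≤ 1 →
          ∃ ξ : (Fin n → ℂ) → KAM.Idx n → ℂ,
            KAM.PeriodicAnalytic false (KAM.strip n (ρ - δ)) ξ ∧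
            (∀ θ ∈ KAM.strip n (ρ - δ), KAM.ReducedAt X.B X.H ω K ξ θ) ∧
            (∀ θ ∈ KAM.strip n (ρ - δ),
              ‖KAM.yPart ξ θ‖ ≤ C₅ * γ⁻¹ * δ ^ (-σ) * ε) ∧
            (∀ θ ∈ KAM.strip n (ρ - 2 * δ),
              ‖KAM.xPart ξ θ‖ ≤ C₅ * (γ ^ 2)⁻¹ * δ ^ (-(2 * σ)) * ε)) := by
  obtain ⟨c, hc1, hc⟩ := KAM.exists_norm_sol_le n hσ
  have h2σ : (1 : ℝ) ≤ 2 ^ σ := Real.one_le_rpow one_le_two hσ.le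
  have hn0 : (0 : ℝ) ≤ n := Nat.cast_nonneg n
  have hcc : c ≤ c * 2 ^ σ := le_mul_of_one_le_right (by linarith) h2σ
  obtain ⟨κ, hκ⟩ : ∃ κ : ℝ, κ = 4 + 2 * n + c * 2 ^ σ := ⟨_, rfl⟩
  have hκ4 : 4 ≤ κ := by linarith
  have hκ1 : 1 ≤ κ := by linarith
  refine ⟨KAM.majorant 4 κ 13, KAM.majorant 5 κ 43, fun v => (κ * (1 + ∑ i, v i)) ^ 46,
    KAM.nonnegCoeffs_majorant 4 (by linarith) 13, KAM.nonnegCoeffs_majorant 5 (by linarith) 43, ?_⟩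
  intro γ hγ hγ1 ω hω S D X ρ hρ K hK nDK nN nB nB1 nBinv nH nS ε C₂ C₄ C₅
    eDK eN eB eB1 eBinv eH eS eε eC₂ eC₄ eC₅
  obtain ⟨T₂, hT₂⟩ : ∃ T, T = κ * (1 + (nDK + nN + nB + nBinv)) := ⟨_, rfl⟩
  obtain ⟨T₄, hT₄⟩ : ∃ T, T = κ * (1 + (nDK + nN + nB1 + nBinv + nH)) := ⟨_, rfl⟩
  obtain ⟨T₅, hT₅⟩ : ∃ T, T = κ * (1 + (nDK + nN + nS + nB1 + nBinv + nH)) := ⟨_, rfl⟩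
  have hC₂ : C₂ = T₂ ^ 13 := by
    rw [eC₂, KAM.eval_majorant, hT₂]; simp [Fin.sum_univ_succ, add_assoc]
  have hC₄ : C₄ = T₄ ^ 43 := by
    rw [eC₄, KAM.eval_majorant, hT₄]; simp [Fin.sum_univ_succ, add_assoc]
  have hC₅ : C₅ = T₅ ^ 46 := by
    rw [eC₅, hT₅]; simp [Fin.sum_univ_succ, add_assoc]
  clear eC₂ eC₄ eC₅
  have pDK : 0 ≤ nDK := eDK ▸ KAM.supNorm_nonneg _ _
  have pN : 0 ≤ nN := eN ▸ KAM.supNorm_nonneg _ _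
  have pB : 0 ≤ nB := eB ▸ KAM.supNorm_nonneg _ _
  have pBinv : 0 ≤ nBinv := eBinv ▸ KAM.supNorm_nonneg _ _
  have pH : 0 ≤ nH := eH ▸ KAM.ckNorm_nonneg X
  have pS : 0 ≤ nS := eS ▸ norm_nonneg _
  have pε : 0 ≤ ε := eε ▸ KAM.supNorm_nonneg _ _
  have hBB1 : nB ≤ nB1 := eB ▸ eB1 ▸ KAM.supNorm_le_c1NormMat X.B D
  have hT₂κ := KAM.le_mul_one_add hκ1 (t := nDK + nN + nB + nBinv) (by positivity)
  have hT₅κ := KAM.le_mul_one_add hκ1 (t := nDK + nN + nS + nB1 + nBinv + nH) (by linarith)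
  have hT₂₄ : T₂ ≤ T₄ := by
    rw [hT₂, hT₄]; exact mul_le_mul_of_nonneg_left (by linarith) (by linarith)
  have hT₄₅ : T₄ ≤ T₅ := by
    rw [hT₄, hT₅]; exact mul_le_mul_of_nonneg_left (by linarith) (by linarith)
  have hT₄κ := KAM.le_mul_one_add hκ1 (t := nDK + nN + nB1 + nBinv + nH) (by linarith)
  rw [← hT₂] at hT₂κ
  rw [← hT₄] at hT₄κ
  rw [← hT₅] at hT₅κ
  have hc2 : 0 ≤ c * 2 ^ σ := by linarith
  have hF₂ : ∀ θ ∈ KAM.strip n ρ, KAM.FrameBound X K T₂ θ := fun θ hθ =>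
    hK.frameBound hθ (by linarith) (by linarith) (by linarith) (by linarith) (by linarith)
      (by linarith)
  have hF₄ : ∀ θ ∈ KAM.strip n ρ, KAM.FieldBound X K T₄ θ := fun θ hθ =>
    (hK.frameBound hθ (by linarith) (by linarith) (by linarith) (by linarith) (by linarith)
      (by linarith)).fieldBound (hK.mapsTo_strip hθ) (by linarith) (by linarith)
  have hF₅ : ∀ θ ∈ KAM.strip n ρ, KAM.FieldBound X K T₅ θ := fun θ hθ =>
    (hK.frameBound hθ (by linarith) (by linarith) (by linarith) (by linarith) (by linarith)
      (by linarith)).fieldBound (hK.mapsTo_strip hθ) (by linarith) (by linarith)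
  have hε : ∀ θ ∈ KAM.strip n ρ, ‖KAM.err X.B X.H ω K θ‖ ≤ ε := fun θ hθ =>
    eε ▸ KAM.le_supNorm (hK.err_bddOn ω) hθ
  refine ⟨?_, ?_, ?_, fun δ hδ hδρ hδ1 hsmall => ?_,
    fun θ _ ξ hξ => KAM.triangular_iff_reducedAt hξ, fun δ hδ hδρ hδ1 => ?_⟩
  · rw [hC₂]
    exact one_le_pow₀ (by linarith)
  · rw [hC₂, hC₄]
    exact (pow_le_pow_left₀ (by linarith) hT₂₄ 13).trans
      (pow_le_pow_right₀ (by linarith) (by norm_num))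
  · rw [hC₄, hC₅]
    exact (pow_le_pow_left₀ (by linarith) hT₄₅ 43).trans
      (pow_le_pow_right₀ (by linarith) (by norm_num))
  · simp only [hC₂, mul_assoc] at hsmall
    simp only [hC₄, mul_assoc]
    simpa only [mul_assoc] using hK.transformation hρ hσ hc (by linarith) hT₂₄ hγ hγ1 hω hF₂ hF₄ pε
      hε hδ hδρ hδ1 (by simpa only [mul_assoc] using hsmall)
  · simp only [hC₅, mul_assoc]
    simpa only [mul_assoc] using hK.exists_reducedAt hρ hσ hc (by linarith) hγ hγ1 hω hF₅
      (by linarith) pε hε hδ hδρ hδ1
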